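/- Let $(p_k)_{k\ge 0}$ be a probability distribution on $\{0,1,2,\dots\}$ (the out-degree distribution) with generating function $f(x)=\sum_k p_kx^k$ and finite mean $z=f'(1)=\sum_k kp_k>0$, and let $0<\lambda\le 1$. For $0\le\mu<1$ let $G(\infty,x)\in[0,1]$, $x\in[0,1]$, be the solution of the steady-state equation $$\lambda z+\mu-(\lambda z+1)G+(1-\mu)\,x\,G\,f(1-\lambda+\lambda G)=0,$$ and let $q_n=q_n(\infty)$ be the coefficients of $H(\infty,x)=x\,G(\infty,x)\,f(1-\lambda+\lambda G(\infty,x))=\sum_n q_nx^n$. Then $(q_n)$ exists, is unique and is a probability distribution. Moreover, for every integer $c\ge1$ and $x\in[0,1]$, $G(\infty,x)=\lim_{a\to\infty}G(a,x)$ for every solution $G(a,x)\in[0,1]$, $a\ge 0$, of $$c\,\partial_aG=\lambda z+\mu-(\lambda z+1)G+(1-\mu)xGf(1-\lambda+\lambda G),\qquad G(0,x)=1.$$ Write $f''(1)=\sum_k k(k-1)p_k\in[0,\infty]$ and, when it is finite, $$A=(\lambda z+1)\left[2\pi\lambda(\lambda f''(1)+2z)\right]^{-1/2},\qquad \kappa=\kappa(\mu)=\frac{2\lambda(\lambda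 f''(1)+2z)}{\mu^2(\lambda z+1)^2}.$$ 1. If $f''(1)<\infty$ and $\mu=0$, then $q_n\sim A\,n^{-3/2}$ as $n\to\infty$. 2. If $f''(1)<\infty$ and $\mu>0$ is small, then $q_n\sim A\,n^{-3/2}e^{-n/\kappa}$ in the following sense. (a) For every $K$, the ratio of the two sides tends to $1$ as $n\to\infty$ and $\mu\downarrow0$ jointly, uniformly over $n\le K\kappa(\mu)$; and without restriction on $n/\kappa$, $n^{3/2}q_n-A\,e^{-n/\kappa}\to0$ as $n\to\infty$ and $\mu\downarrow 0$ jointly. (b) If moreover $f$ is analytic at $1$ (that is, $\sum_kp_kR^k<\infty$ for some $R>1$), then there are $A'(\mu)$ and $\kappa'(\mu)$ with $A'(\mu)\to A$ and $\kappa'(\mu)/\kappa(\mu)\to1$ as $\mu\downarrow0$ such that, for each fixed sufficiently small $\mu>0$, $q_n\sim A'(\mu)\,n^{-3/2}e^{-n/\kappa'(\mu)}$ as $n\to\infty$. 3. If $p_k\sim Dk^{-\gamma}$ as $k\to\infty$ with $D>0$, $2<\gamma<3$, and $\mu=0$, then $q_n\sim B\,n^{-\gamma/(\gamma-1)}$ as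 $n\to\infty$, where $$B=-(\lambda z+1)\,\frac{\left(D\,\Gamma(1-\gamma)\right)^{-1/(\gamma-1)}}{\lambda\,\Gamma\!\left(\frac1{1-\gamma}\right)}.$$ 4. If $p_k\sim Dk^{-\gamma}$ as $k\to\infty$ with $D>0$, $2<\gamma<3$, and $0<\mu<1$, then $q_n\sim C\,n^{-\gamma}$ as $n\to\infty$, where $$C=\frac{D(\lambda z+1)}{\lambda(1-\mu)}\left(\frac{\lambda(1-\mu)}{\mu(\lambda z+1)}\right)^{\gamma}.$$ -/

import Mathlib

open Filter Topology Asymptotics Set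

noncomputable section

namespace MemeModel

/-- `p k` is the probability of out-degree `k`; the mean degree is finite and positive. -/
structure IsOutDegreeDistribution (p : ℕ → ℝ) : Prop where
  nonneg : ∀ k, 0 ≤ p k
  hasSum_one : HasSum p 1
  summable_mean : Summable fun k : ℕ => (k : ℝ) * p k
  mean_pos : 0 < ∑' k : ℕ, (k : ℝ) * p k

/-- The probability generating function `f(x) = ∑ p_k x^k` of the out-degree distribution. -/
def degreePGF (p : ℕ → ℝ) (x : ℝ) : ℝ := ∑' k : ℕ, p k * x ^ k

/-- The mean degree `z = f'(1) = ∑ k p_k`. -/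
def meanDegree (p : ℕ → ℝ) : ℝ := ∑' k : ℕ, (k : ℝ) * p k

/-- `f''(1) = ∑ k (k - 1) p_k` is finite. -/
def FiniteSecondMoment (p : ℕ → ℝ) : Prop :=
  Summable fun k : ℕ => (k : ℝ) * ((k : ℝ) - 1) * p k

/-- `f''(1) = ∑ k (k - 1) p_k`. -/
def secondFactorialMoment (p : ℕ → ℝ) : ℝ := ∑' k : ℕ, (k : ℝ) * ((k : ℝ) - 1) * p k

/-- The power-law tail `p_k ~ D k ^ (-γ)`. -/
def HasPowerTail (p : ℕ → ℝ) (D γ : ℝ) : Prop :=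
  p ~[atTop] fun k : ℕ => D * (k : ℝ) ^ (-γ)

/-- The right-hand side `λz + μ - (λz + 1) G + (1 - μ) x G f(1 - λ + λG)` of the evolution
equation for the generating function `G` of the excess popularity. -/
def drift (p : ℕ → ℝ) (lam μ x G : ℝ) : ℝ :=
  lam * meanDegree p + μ - (lam * meanDegree p + 1) * G
    + (1 - μ) * x * G * degreePGF p (1 - lam + lam * G)

/-- The generating function `H = x G f(1 - λ + λG)` of the popularity, in terms of `G`. -/
def popularityPGF (p : ℕ → ℝ) (lam x G : ℝ) : ℝ :=
  x * G * degreePGF p (1 - lam + lam * G)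

/-- `a ↦ g a` is the solution `G(a, x)`, for fixed `x`, of `c ∂G/∂a = drift`, `G(0, x) = 1`, with
values in `[0, 1]`; here `c` is the screen capacity. -/
def IsAgeSolution (p : ℕ → ℝ) (lam μ : ℝ) (c : ℕ) (x : ℝ) (g : ℝ → ℝ) : Prop :=
  g 0 = 1 ∧ ∀ a : ℝ, 0 ≤ a →
    g a ∈ Icc (0 : ℝ) 1 ∧ HasDerivWithinAt g (drift p lam μ x (g a) / c) (Ici 0) a

/-- `G` is the stationary solution `G(∞, x)`: for `x ∈ [0, 1]` it takes values in `[0, 1]` and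
solves the steady-state equation. -/
def IsStationarySolution (p : ℕ → ℝ) (lam μ : ℝ) (G : ℝ → ℝ) : Prop :=
  ∀ x ∈ Icc (0 : ℝ) 1, G x ∈ Icc (0 : ℝ) 1 ∧ drift p lam μ x (G x) = 0

/-- `q n = q_n(∞)`: the coefficients of `H(∞, x) = x G f(1 - λ + λG)`, where `G = G(∞, x)` is the
stationary solution. -/
def IsLimitingPopularity (p : ℕ → ℝ) (lam μ : ℝ) (q : ℕ → ℝ) : Prop :=
  ∃ G : ℝ → ℝ, IsStationarySolution p lam μ G ∧
    ∀ x ∈ Icc (0 : ℝ) 1, HasSum (fun n : ℕ => q n * x ^ n) (popularityPGF p lam x (G x))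

/-- `A = (λz + 1) [2πλ (λ f''(1) + 2z)] ^ (-1/2)`. -/
def prefactorA (p : ℕ → ℝ) (lam : ℝ) : ℝ :=
  (lam * meanDegree p + 1) *
    (2 * Real.pi * lam * (lam * secondFactorialMoment p + 2 * meanDegree p)) ^ (-(1 / 2) : ℝ)

/-- `κ = 2λ (λ f''(1) + 2z) / (μ² (λz + 1)²)`. -/
def cutoff (p : ℕ → ℝ) (lam μ : ℝ) : ℝ :=
  2 * lam * (lam * secondFactorialMoment p + 2 * meanDegree p)
    / (μ ^ 2 * (lam * meanDegree p + 1) ^ 2)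

/-- `B = -(λz + 1) (D Γ(1 - γ)) ^ (-1/(γ - 1)) / (λ Γ(1/(1 - γ)))`. -/
def prefactorB (p : ℕ → ℝ) (lam D γ : ℝ) : ℝ :=
  -(lam * meanDegree p + 1) *
    ((D * Real.Gamma (1 - γ)) ^ (-(1 / (γ - 1))) / (lam * Real.Gamma (1 / (1 - γ))))

/-- `C = D (λz + 1) / (λ (1 - μ)) * (λ (1 - μ) / (μ (λz + 1))) ^ γ`. -/
def prefactorC (p : ℕ → ℝ) (lam μ D γ : ℝ) : ℝ :=
  D * (lam * meanDegree p + 1) / (lam * (1 - μ)) *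
    (lam * (1 - μ) / (μ * (lam * meanDegree p + 1))) ^ γ

end MemeModel

end

/-! The popularity is the total progeny of a Galton-Watson tree. Put `ρ = (1 - μ) / (λz + 1)` and `G
= 1 - ρ + ρH`. The steady-state equation becomes `H = x Φ(H)` with `Φ(w) = (1 - ρ + ρw) f(1 - λρ +
λρw)`, the generating function of a Bernoulli(ρ) variable plus an independent out-degree thinned
with probability `λρ`. Its mean is `ρ(1 + λz) = 1 - μ`, so `μ = 0` is the critical case and `μ > 0`
the subcritical one. Convexity of the drift in `G` makes its root in `[0, 1]` unique and attracting,
which settles existence, uniqueness and the old-age limit (`isLimitingPopularity_progeny`,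
`drift_zero_unique`, `tendsto_ageSolution`).

Lagrange inversion (`mul_firstPassage`, `mul_progeny`) gives `n q_n = P(S_n = n - 1)`, where `S_n`
is a sum of `n` independent offspring numbers. All asymptotics are local estimates for `S_n` at a
point about `nμ` above its mean.

Finite second moment: a Gaussian local limit theorem, uniform in the parameters
(`tendsto_sqrt_mul_coeff`), gives `A` at `μ = 0`, and the Gaussian factor at distance `nμ` is
`e^{-n/κ}`. If `f` is analytic beyond `1`, an exponential tilt makes the offspring law critical at
fixed `μ > 0`; the tilted law is again Bernoulli plus thinning, so the same theorem applies, and the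
inverse function theorem follows the tilt as `μ → 0`.

Power tail with index `α = γ - 1` between `1` and `2`: the out-degrees are compared with the
coefficients of `(1 - w)^α`, which have the same tail up to a constant and an explicit generating
function. At `μ = 0` this yields the singular expansion of `f` at `1` and a stable local limit
theorem (`tendsto_coeff_offspringSeries_stable`). For `μ > 0` one single large offspring number must
bridge the gap of about `nμ`, which gives `n · c (nμ)^{-γ}` for `P(S_n = n - 1)`
(`tendsto_coeff_pow_of_powerTail`). -/

noncomputable section

namespace MemeModel

open MeasureTheory

/-! ### Evaluation of power series, binomial thinning and the offspring series. -/

/-- The power series `P` converges absolutely at `w`, with value `s`. -/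
def SumsTo (P : PowerSeries ℝ) (w s : ℂ) : Prop :=
  Summable (fun n => ‖((PowerSeries.coeff n P : ℝ) : ℂ) * w ^ n‖) ∧
    ∑' n, ((PowerSeries.coeff n P : ℝ) : ℂ) * w ^ n = s

lemma SumsTo.hasSum {P : PowerSeries ℝ} {w s : ℂ} (h : SumsTo P w s) :
    HasSum (fun n => ((PowerSeries.coeff n P : ℝ) : ℂ) * w ^ n) s := by
  rw [← h.2]; exact h.1.of_norm.hasSum

lemma SumsTo.mul {P Q : PowerSeries ℝ} {w s t : ℂ} (hP : SumsTo P w s) (hQ : SumsTo Q w t) :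
    SumsTo (P * Q) w (s * t) := by
  have key : ∀ n, ((PowerSeries.coeff n (P * Q) : ℝ) : ℂ) * w ^ n =
      ∑ kl ∈ Finset.HasAntidiagonal.antidiagonal n, (((PowerSeries.coeff kl.1 P : ℝ) : ℂ) * w ^ kl.1) *
        (((PowerSeries.coeff kl.2 Q : ℝ) : ℂ) * w ^ kl.2) := by
    intro n
    rw [PowerSeries.coeff_mul, Complex.ofReal_sum, Finset.sum_mul]
    refine Finset.sum_congr rfl fun kl hkl => ?_
    rw [← Finset.HasAntidiagonal.mem_antidiagonal.mp hkl, pow_add, Complex.ofReal_mul]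
    ring
  have h1 := summable_norm_sum_mul_antidiagonal_of_summable_norm hP.1 hQ.1
  have h2 := tsum_mul_tsum_eq_tsum_sum_antidiagonal_of_summable_norm hP.1 hQ.1
  rw [hP.2, hQ.2] at h2
  unfold SumsTo
  simp_rw [key]
  exact ⟨h1, h2.symm⟩

lemma SumsTo.of_finite {P : PowerSeries ℝ} (N : ℕ) (hP : ∀ n, N ≤ n → PowerSeries.coeff n P = 0)
    (w : ℂ) :
    SumsTo P w (∑ n ∈ Finset.range N, ((PowerSeries.coeff n P : ℝ) : ℂ) * w ^ n) := by
  have h0 : ∀ n ∉ Finset.range N, ((PowerSeries.coeff n P : ℝ) : ℂ) * w ^ n = 0 := by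
    intro n hn
    simp [hP n (by simpa using hn)]
  refine ⟨summable_of_ne_finset_zero (s := Finset.range N) fun n hn => by rw [h0 n hn, norm_zero],
    tsum_eq_sum h0⟩

lemma SumsTo.one (w : ℂ) : SumsTo 1 w 1 := by
  have := SumsTo.of_finite (P := 1) 1 (fun n hn => by
    rw [PowerSeries.coeff_one, if_neg (by omega)]) w
  simpa using this

lemma SumsTo.pow {P : PowerSeries ℝ} {w s : ℂ} (hP : SumsTo P w s) (n : ℕ) :
    SumsTo (P ^ n) w (s ^ n) := by
  induction n with
  | zero => simpa using SumsTo.one w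
  | succ n ih => rw [pow_succ, pow_succ]; exact ih.mul hP

lemma SumsTo.affine (a b : ℝ) (w : ℂ) :
    SumsTo (PowerSeries.C a + PowerSeries.C b * PowerSeries.X) w (a + b * w) := by
  have := SumsTo.of_finite (P := PowerSeries.C a + PowerSeries.C b * PowerSeries.X) 2 (fun n hn => by
    obtain ⟨m, rfl⟩ := Nat.exists_eq_add_of_le hn
    rw [show 2 + m = (m + 1) + 1 by ring]
    simp) w
  simpa [Finset.sum_range_succ, PowerSeries.coeff_C, PowerSeries.coeff_X] using this

/-- The complex probability generating function. -/
def complexPGF (p : ℕ → ℝ) (w : ℂ) : ℂ := ∑' k : ℕ, (p k : ℂ) * w ^ k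

/-- The law of a binomially thinned variable: each of `j` items, `j` with weight `p j`, is kept
with probability `r`. -/
def thinning (p : ℕ → ℝ) (r : ℝ) (k : ℕ) : ℝ :=
  ∑' j : ℕ, p j * ((j.choose k : ℝ) * r ^ k * (1 - r) ^ (j - k))

lemma tsum_binomial (j : ℕ) (x y : ℂ) :
    HasSum (fun k => (j.choose k : ℂ) * x ^ k * y ^ (j - k)) ((x + y) ^ j) := by
  rw [add_pow]
  have : ∀ k ∉ Finset.range (j + 1), (j.choose k : ℂ) * x ^ k * y ^ (j - k) = 0 := by
    intro k hk
    rw [Nat.choose_eq_zero_of_lt (by simpa using hk)]; simp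
  have h := hasSum_sum_of_ne_finset_zero (L := .unconditional ℕ) this
  rwa [Finset.sum_congr rfl fun k _ => show (j.choose k : ℂ) * x ^ k * y ^ (j - k) =
    x ^ k * y ^ (j - k) * j.choose k by ring] at h

lemma tsum_binomial_real (j : ℕ) (x y : ℝ) :
    HasSum (fun k => (j.choose k : ℝ) * x ^ k * y ^ (j - k)) ((x + y) ^ j) := by
  have := tsum_binomial j x y
  exact_mod_cast this

/-- For each `j` the sum over `k` is the binomial theorem, and absolute convergence allows the two
sums to be exchanged. The weights may change sign because `thinning_oneSubPowCoeff` applies this to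
binomial series coefficients. -/
lemma sumsTo_thinning {p : ℕ → ℝ} {r s : ℝ} (hr0 : 0 ≤ r) (hr1 : r ≤ 1)
    (hs : Summable fun j => |p j| * (1 - r + r * s) ^ j) {w : ℂ} (hw : ‖w‖ ≤ s) :
    SumsTo (PowerSeries.mk (thinning p r)) w (complexPGF p (1 - r + r * w)) := by
  set F : ℕ × ℕ → ℂ := fun jk => (p jk.1 : ℂ) *
    ((jk.1.choose jk.2 : ℂ) * (r * w) ^ jk.2 * (1 - r : ℂ) ^ (jk.1 - jk.2)) with hF
  have h1r : 0 ≤ 1 - r := by linarith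
  have hnorm : ∀ j k, ‖F (j, k)‖ = |p j| *
      ((j.choose k : ℝ) * (r * ‖w‖) ^ k * (1 - r) ^ (j - k)) := by
    intro j k
    have : ‖(1 - r : ℂ)‖ = 1 - r := by
      rw [← Complex.ofReal_one, ← Complex.ofReal_sub, Complex.norm_real, Real.norm_of_nonneg h1r]
    simp [hF, this, abs_of_nonneg hr0]
  have hrow : ∀ j, HasSum (fun k => ‖F (j, k)‖) (|p j| * (1 - r + r * ‖w‖) ^ j) := by
    intro j
    simp_rw [hnorm]
    rw [add_comm (1 - r)]
    exact (tsum_binomial_real j _ _).mul_left _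
  have hsum : Summable fun jk => ‖F jk‖ := by
    rw [summable_prod_of_nonneg (fun _ => norm_nonneg _)]
    refine ⟨fun j => (hrow j).summable, ?_⟩
    simp_rw [fun j => (hrow j).tsum_eq]
    refine hs.of_nonneg_of_le (fun j => by positivity) fun j => ?_
    gcongr
  have hsw : Summable fun kj : ℕ × ℕ => ‖F kj.swap‖ := by
    exact (Equiv.prodComm ℕ ℕ).summable_iff.mpr hsum
  have hcoef : ∀ k, ((PowerSeries.coeff k (PowerSeries.mk (thinning p r)) : ℝ) : ℂ) * w ^ k =
      ∑' j, F (j, k) := by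
    intro k
    rw [PowerSeries.coeff_mk, thinning, Complex.ofReal_tsum, ← tsum_mul_right]
    refine tsum_congr fun j => ?_
    simp only [hF, mul_pow]
    push_cast
    ring
  unfold SumsTo
  simp_rw [hcoef]
  constructor
  · refine Summable.of_nonneg_of_le (fun _ => norm_nonneg _) (fun k => ?_) hsw.prod
    exact norm_tsum_le_tsum_norm (hsw.prod_factor k)
  · rw [complexPGF, Summable.tsum_comm (f := fun j k => F (j, k)) hsum.of_norm]
    refine tsum_congr fun j => ?_
    have := (tsum_binomial j (r * w) (1 - r)).mul_left (p j : ℂ)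
    rw [add_comm] at this
    exact this.tsum_eq

lemma thinning_nonneg {p : ℕ → ℝ} (hp : ∀ k, 0 ≤ p k) {r : ℝ} (hr0 : 0 ≤ r) (hr1 : r ≤ 1) (k : ℕ) :
    0 ≤ thinning p r k := by
  have h1r : 0 ≤ 1 - r := by linarith
  exact tsum_nonneg fun j => mul_nonneg (hp j) (by positivity)

/-- The generating series of `Bernoulli(ρ) + thinning`. -/
def offspringSeries (p : ℕ → ℝ) (ρ r : ℝ) : PowerSeries ℝ :=
  (PowerSeries.C (1 - ρ) + PowerSeries.C ρ * PowerSeries.X) * PowerSeries.mk (thinning p r)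

lemma coeff_offspringSeries_zero (p : ℕ → ℝ) (ρ r : ℝ) :
    PowerSeries.coeff 0 (offspringSeries p ρ r) = (1 - ρ) * thinning p r 0 := by
  simp [offspringSeries]

lemma coeff_offspringSeries_succ (p : ℕ → ℝ) (ρ r : ℝ) (k : ℕ) :
    PowerSeries.coeff (k + 1) (offspringSeries p ρ r) =
      (1 - ρ) * thinning p r (k + 1) + ρ * thinning p r k := by
  rw [offspringSeries, add_mul, mul_assoc, map_add, PowerSeries.coeff_C_mul,
    PowerSeries.coeff_C_mul, PowerSeries.coeff_succ_X_mul]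
  simp

lemma sumsTo_offspringSeries {p : ℕ → ℝ} (ρ : ℝ) {r s : ℝ} (hr0 : 0 ≤ r) (hr1 : r ≤ 1)
    (hs : Summable fun j => |p j| * (1 - r + r * s) ^ j) {w : ℂ} (hw : ‖w‖ ≤ s) :
    SumsTo (offspringSeries p ρ r) w ((1 - ρ + ρ * w) * complexPGF p (1 - r + r * w)) := by
  have := (SumsTo.affine (1 - ρ) ρ w).mul (sumsTo_thinning hr0 hr1 hs hw)
  rwa [Complex.ofReal_sub, Complex.ofReal_one] at this

lemma coeff_offspringSeries_nonneg {p : ℕ → ℝ} (hp : ∀ k, 0 ≤ p k) {ρ r : ℝ} (hρ0 : 0 ≤ ρ)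
    (hρ1 : ρ ≤ 1) (hr0 : 0 ≤ r) (hr1 : r ≤ 1) (k : ℕ) :
    0 ≤ PowerSeries.coeff k (offspringSeries p ρ r) := by
  have h1 := thinning_nonneg hp hr0 hr1
  have h1ρ : 0 ≤ 1 - ρ := by linarith
  cases k with
  | zero => rw [coeff_offspringSeries_zero]; exact mul_nonneg h1ρ (h1 0)
  | succ k =>
    rw [coeff_offspringSeries_succ]
    exact add_nonneg (mul_nonneg h1ρ (h1 _)) (mul_nonneg hρ0 (h1 _))

lemma degreePGF_ofReal (p : ℕ → ℝ) (x : ℝ) : ((degreePGF p x : ℝ) : ℂ) = complexPGF p x := by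
  simp [degreePGF, complexPGF, Complex.ofReal_tsum]

/-! ### First passage of left-continuous walks and Lagrange inversion. -/

/-- `firstPassage a n k` is the weight of the walks with steps `j - 1`, of weight `a j`, that
lead from `k` to `0` for the first time after `n` steps. -/
def firstPassage (a : ℕ → ℝ) : ℕ → ℕ → ℝ
  | 0, 0 => 1
  | 0, _ + 1 => 0
  | _ + 1, 0 => 0
  -- A step lowers the walk by at most one, so from `k + j > n` the level `0` is out of reach in `n`
  -- steps; cutting the sum at `j ≤ n` loses nothing.
  | n + 1, k + 1 => ∑ j ∈ Finset.range (n + 1), a j * firstPassage a n (k + j)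

lemma firstPassage_eq_zero (a : ℕ → ℝ) {n k : ℕ} (h : n < k) : firstPassage a n k = 0 := by
  induction n generalizing k with
  | zero => obtain ⟨k, rfl⟩ := Nat.exists_eq_add_of_lt h; simp [firstPassage]
  | succ n ih =>
    cases k with
    | zero => omega
    | succ k =>
      rw [firstPassage]
      exact Finset.sum_eq_zero fun j _ => by rw [ih (by omega), mul_zero]

lemma firstPassage_succ (a : ℕ → ℝ) (n k : ℕ) {N : ℕ} (hN : n + 1 ≤ N) :
    firstPassage a (n + 1) (k + 1) = ∑ j ∈ Finset.range N, a j * firstPassage a n (k + j) := by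
  rw [firstPassage]
  refine Finset.sum_subset (Finset.range_subset_range.mpr hN) fun j _ hj => ?_
  rw [firstPassage_eq_zero a (by simp at hj; omega), mul_zero]

lemma firstPassage_nonneg {a : ℕ → ℝ} (ha : ∀ k, 0 ≤ a k) (n k : ℕ) :
    0 ≤ firstPassage a n k := by
  induction n generalizing k with
  | zero => cases k <;> simp [firstPassage]
  | succ n ih =>
    cases k with
    | zero => simp [firstPassage]
    | succ k => exact Finset.sum_nonneg fun j _ => mul_nonneg (ha j) (ih _)

/-- No level can be skipped on the way down, so a walk from `k + l` to `0` is cut at its first visit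
to `l`. -/
lemma firstPassage_add (a : ℕ → ℝ) (n k l : ℕ) :
    firstPassage a n (k + l) =
      ∑ ij ∈ Finset.HasAntidiagonal.antidiagonal n, firstPassage a ij.1 k * firstPassage a ij.2 l := by
  induction n generalizing k with
  | zero =>
    cases k <;> cases l <;> simp [firstPassage]
  | succ n ih =>
    rw [Finset.Nat.sum_antidiagonal_succ]
    cases k with
    | zero => simp [firstPassage]
    | succ k =>
      simp only [firstPassage, zero_mul, zero_add]
      rw [show k + 1 + l = k + l + 1 by ring, firstPassage_succ a n (k + l) le_rfl]
      have : ∀ ij ∈ Finset.HasAntidiagonal.antidiagonal n,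
          (∑ j ∈ Finset.range (ij.1 + 1), a j * firstPassage a ij.1 (k + j)) *
            firstPassage a ij.2 l = ∑ j ∈ Finset.range (n + 1),
              a j * (firstPassage a ij.1 (k + j) * firstPassage a ij.2 l) := by
        intro ij hij
        rw [← firstPassage, firstPassage_succ a ij.1 k
          (N := n + 1) (by have := Finset.HasAntidiagonal.mem_antidiagonal.mp hij; omega), Finset.sum_mul]
        exact Finset.sum_congr rfl fun j _ => by ring
      rw [Finset.sum_congr rfl this, Finset.sum_comm]
      refine Finset.sum_congr rfl fun j _ => ?_
      rw [← Finset.mul_sum, ← ih, show k + l + j = k + j + l by ring]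

/-- First passages at different times are disjoint events. The induction conditions on the first
step. -/
lemma sum_firstPassage_le_one {a : ℕ → ℝ} (ha : ∀ k, 0 ≤ a k)
    (ha1 : ∀ N, ∑ j ∈ Finset.range N, a j ≤ 1) (N k : ℕ) :
    ∑ n ∈ Finset.range N, firstPassage a n k ≤ 1 := by
  induction N generalizing k with
  | zero => simp
  | succ N ih =>
    rw [Finset.sum_range_succ']
    cases k with
    | zero => simp [firstPassage]
    | succ k =>
      rw [show firstPassage a 0 (k + 1) = 0 by simp [firstPassage], add_zero]
      rw [Finset.sum_congr rfl fun n hn => firstPassage_succ a n k (N := N)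
        (by simp at hn; omega), Finset.sum_comm]
      calc _ ≤ ∑ j ∈ Finset.range N, a j * 1 := by
            refine Finset.sum_le_sum fun j _ => ?_
            rw [← Finset.mul_sum]
            exact mul_le_mul_of_nonneg_left (ih _) (ha j)
        _ ≤ 1 := by simpa using ha1 N

lemma coeff_X_mul_deriv (P : PowerSeries ℝ) (m : ℕ) :
    PowerSeries.coeff m (PowerSeries.X * PowerSeries.derivative ℝ P) =
      m * PowerSeries.coeff m P := by
  cases m with
  | zero => simp
  | succ m =>
    rw [PowerSeries.coeff_succ_X_mul, PowerSeries.coeff_derivative]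
    push_cast; ring

/-- The Lagrange inversion formula in the form of the first-passage identity. -/
lemma mul_firstPassage (P : PowerSeries ℝ) (n k : ℕ) (hk : k ≤ n) :
    (n : ℝ) * firstPassage (fun j => PowerSeries.coeff j P) n k =
      k * PowerSeries.coeff (n - k) (P ^ n) := by
  induction n generalizing k with
  | zero => obtain rfl : k = 0 := by omega
            simp
  | succ n ih =>
    cases k with
    | zero => simp [firstPassage]
    | succ k =>
      rcases Nat.eq_zero_or_pos n with rfl | hn
      · obtain rfl : k = 0 := by omega
        simp [firstPassage]
      set m := n - k with hm
      have hmk : m + k = n := by omega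
      -- After the first step the walk stands at `k + j`, where the induction hypothesis applies.
      -- The weight `k + j` is then split: `k` gives a coefficient of `P ^ (n + 1)`, and `j` one of
      -- `X P' P ^ n`.
      have h1 : (n : ℝ) * firstPassage (fun j => PowerSeries.coeff j P) (n + 1) (k + 1) =
          ∑ j ∈ Finset.range (m + 1), PowerSeries.coeff j P *
            ((k + j : ℝ) * PowerSeries.coeff (m - j) (P ^ n)) := by
        rw [firstPassage, Finset.mul_sum]
        symm
        rw [← Finset.sum_subset (Finset.range_subset_range.mpr (show m + 1 ≤ n + 1 by omega))]
        · refine Finset.sum_congr rfl fun j hj => ?_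
          have := ih (k + j) (by simp at hj; omega)
          rw [show m - j = n - (k + j) by omega]
          push_cast at this
          rw [← this]; ring
        · intro j _ hj
          rw [firstPassage_eq_zero _ (by simp at hj; omega)]; simp
      have h2 : ∑ j ∈ Finset.range (m + 1), PowerSeries.coeff j P *
            ((k + j : ℝ) * PowerSeries.coeff (m - j) (P ^ n)) =
          k * PowerSeries.coeff m (P ^ (n + 1)) +
            PowerSeries.coeff m (PowerSeries.X * PowerSeries.derivative ℝ P * P ^ n) := by
        rw [pow_succ', PowerSeries.coeff_mul, PowerSeries.coeff_mul,
          Finset.Nat.sum_antidiagonal_eq_sum_range_succ_mk,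
          Finset.Nat.sum_antidiagonal_eq_sum_range_succ_mk, Finset.mul_sum,
          ← Finset.sum_add_distrib]
        refine Finset.sum_congr rfl fun j _ => ?_
        simp only [coeff_X_mul_deriv]
        ring
      -- Since `(n + 1) X P' P ^ n = X (P ^ (n + 1))'`, the `j` part is `m / (n + 1)` times the
      -- coefficient of `P ^ (n + 1)`. With `m + k = n` the total factor is `k + m / (n + 1) = n (k
      -- + 1) / (n + 1)`.
      have h3 : ((n : ℝ) + 1) * PowerSeries.coeff m
            (PowerSeries.X * PowerSeries.derivative ℝ P * P ^ n) =
          m * PowerSeries.coeff m (P ^ (n + 1)) := by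
        have := (PowerSeries.derivative ℝ).leibniz_pow P (n + 1)
        rw [← coeff_X_mul_deriv, this]
        simp only [Nat.add_sub_cancel, smul_eq_mul, nsmul_eq_mul]
        rw [show PowerSeries.X * (((n + 1 : ℕ) : PowerSeries ℝ) * (P ^ n *
          (PowerSeries.derivative ℝ) P)) = PowerSeries.C ((n : ℝ) + 1) * (PowerSeries.X *
            (PowerSeries.derivative ℝ) P * P ^ n) by
          simp only [map_add, map_one, map_natCast]; push_cast; ring, PowerSeries.coeff_C_mul]
      have hn' : (n : ℝ) ≠ 0 := by positivity
      apply mul_left_cancel₀ hn'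
      rw [show n + 1 - (k + 1) = m by omega]
      have hmk' : (m : ℝ) + k = n := by exact_mod_cast hmk
      push_cast
      have e1 := h1.trans h2
      linear_combination ((n : ℝ) + 1) * e1 + h3 + PowerSeries.coeff m (P ^ (n + 1)) * hmk'

/-! ### Uniqueness of power series coefficients. -/

/-- Once the earlier coefficients vanish, division by `x ^ m` leaves `|u m| ≤ x K` with `K`
independent of `x`; then `x → 0`. -/
lemma powerSeries_coeff_eq_zero {u : ℕ → ℝ}
    (hu : ∀ x ∈ Ioo (0 : ℝ) 1, HasSum (fun n => u n * x ^ n) 0) : u = 0 := by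
  have habs : Summable fun n => |u n| * (1 / 2 : ℝ) ^ n := by
    have := (hu (1 / 2) (by norm_num)).summable.abs
    simpa [abs_mul] using this
  funext m
  induction m using Nat.strong_induction_on with
  | _ m ih =>
  have hsh : Summable fun n => |u (n + (m + 1))| * (1 / 2 : ℝ) ^ n := by
    have := ((summable_nat_add_iff (m + 1)).mpr habs).mul_right ((2 : ℝ) ^ (m + 1))
    refine this.congr fun n => ?_
    rw [pow_add, mul_assoc, mul_assoc, ← mul_pow]; norm_num
  set K := ∑' n, |u (n + (m + 1))| * (1 / 2 : ℝ) ^ n with hK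
  have hK0 : 0 ≤ K := tsum_nonneg fun n => by positivity
  have key : ∀ x ∈ Ioo (0 : ℝ) (1 / 2), |u m| ≤ x * K := by
    intro x hx
    have hx0 := hx.1
    have hx' : x ∈ Ioo (0 : ℝ) 1 := ⟨hx.1, by linarith [hx.2]⟩
    have h1 := (hasSum_nat_add_iff' (m + 1)).mpr (hu x hx')
    rw [Finset.sum_range_succ, Finset.sum_eq_zero (fun i hi => by
      rw [ih i (Finset.mem_range.mp hi)]; simp), zero_add, zero_sub] at h1
    have hle : ∀ n, |u (n + (m + 1)) * x ^ n| ≤ |u (n + (m + 1))| * (1 / 2 : ℝ) ^ n := by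
      intro n
      rw [abs_mul, abs_of_pos (pow_pos hx0 n)]
      gcongr
      exact hx.2.le
    have hs : Summable fun n => u (n + (m + 1)) * x ^ n :=
      Summable.of_norm_bounded hsh hle
    have h2 : (∑' n, u (n + (m + 1)) * x ^ n) * x ^ (m + 1) = -(u m * x ^ m) := by
      rw [← tsum_mul_right, ← h1.tsum_eq]
      exact tsum_congr fun n => by rw [pow_add]; ring
    have h3 : u m = -(x * ∑' n, u (n + (m + 1)) * x ^ n) := by
      have hxm : x ^ m ≠ 0 := (pow_pos hx0 m).ne'
      apply mul_right_cancel₀ hxm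
      rw [pow_succ] at h2
      linear_combination h2
    rw [h3, abs_neg, abs_mul, abs_of_pos hx0]
    gcongr
    calc |∑' n, u (n + (m + 1)) * x ^ n| ≤ ∑' n, |u (n + (m + 1)) * x ^ n| := by
          simpa using norm_tsum_le_tsum_norm (f := fun n => u (n + (m + 1)) * x ^ n) hs.norm
      _ ≤ K := hs.abs.tsum_le_tsum hle hsh
  have hlim : Tendsto (fun x : ℝ => x * K) (𝓝[>] 0) (𝓝 0) := by
    have : Tendsto (fun x : ℝ => x * K) (𝓝 0) (𝓝 (0 * K)) := tendsto_id.mul_const K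
    rw [zero_mul] at this
    exact this.mono_left nhdsWithin_le_nhds
  have : |u m| ≤ 0 := ge_of_tendsto hlim (by
    filter_upwards [Ioo_mem_nhdsGT (show (0 : ℝ) < 1 / 2 by norm_num)] with x hx using key x hx)
  simpa using this

lemma powerSeries_coeff_unique {u v : ℕ → ℝ} {F : ℝ → ℝ}
    (hu : ∀ x ∈ Ioo (0 : ℝ) 1, HasSum (fun n => u n * x ^ n) (F x))
    (hv : ∀ x ∈ Ioo (0 : ℝ) 1, HasSum (fun n => v n * x ^ n) (F x)) : u = v := by
  have : u - v = 0 := powerSeries_coeff_eq_zero fun x hx => by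
    simpa [sub_mul] using (hu x hx).sub (hv x hx)
  exact sub_eq_zero.mp this

/-! ### The generating function of the out-degree on `[0, 1]`. -/

section Degree

variable {p : ℕ → ℝ} (hp : IsOutDegreeDistribution p)
include hp

lemma IsOutDegreeDistribution.summable_abs : Summable fun k => |p k| := by
  simpa [abs_of_nonneg (hp.nonneg _)] using hp.hasSum_one.summable

lemma IsOutDegreeDistribution.summable_pow {x : ℝ} (hx : x ∈ Icc (0 : ℝ) 1) :
    Summable fun k => p k * x ^ k :=
  hp.hasSum_one.summable.of_nonneg_of_le
    (fun k => mul_nonneg (hp.nonneg k) (pow_nonneg hx.1 k))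
    (fun k => mul_le_of_le_one_right (hp.nonneg k) (pow_le_one₀ hx.1 hx.2))

lemma IsOutDegreeDistribution.meanDegree_pos : 0 < meanDegree p := hp.mean_pos

lemma degreePGF_one : degreePGF p 1 = 1 := by
  simpa [degreePGF] using hp.hasSum_one.tsum_eq

lemma degreePGF_nonneg {x : ℝ} (hx : 0 ≤ x) : 0 ≤ degreePGF p x :=
  tsum_nonneg fun k => mul_nonneg (hp.nonneg k) (pow_nonneg hx k)

lemma degreePGF_monotoneOn : MonotoneOn (degreePGF p) (Icc 0 1) := by
  intro x hx y hy hxy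
  refine (hp.summable_pow hx).tsum_le_tsum (fun k => ?_) (hp.summable_pow hy)
  exact mul_le_mul_of_nonneg_left (pow_le_pow_left₀ hx.1 hxy k) (hp.nonneg k)

lemma degreePGF_convexOn : ConvexOn ℝ (Icc 0 1) (degreePGF p) := by
  refine ⟨convex_Icc 0 1, fun x hx y hy a b ha hb hab => ?_⟩
  have hxy := convex_Icc (0 : ℝ) 1 hx hy ha hb hab
  simp only [smul_eq_mul] at hxy ⊢
  rw [degreePGF, degreePGF, degreePGF, ← tsum_mul_left, ← tsum_mul_left,
    ← ((hp.summable_pow hx).mul_left a).tsum_add ((hp.summable_pow hy).mul_left b)]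
  refine (hp.summable_pow hxy).tsum_le_tsum (fun k => ?_)
    (((hp.summable_pow hx).mul_left a).add ((hp.summable_pow hy).mul_left b))
  have h1 := (convexOn_pow k).2 (show x ∈ Ici (0 : ℝ) from hx.1) (show y ∈ Ici (0 : ℝ) from hy.1)
    ha hb hab
  simp only [smul_eq_mul] at h1
  have := mul_le_mul_of_nonneg_left h1 (hp.nonneg k)
  linarith

/-- Bernoulli's inequality term by term: `f` lies above its tangent at `1`. -/
lemma one_sub_mul_le_degreePGF {u : ℝ} (hu : u ∈ Icc (0 : ℝ) 1) :
    1 - meanDegree p * u ≤ degreePGF p (1 - u) := by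
  have hx : 1 - u ∈ Icc (0 : ℝ) 1 := ⟨by linarith [hu.2], by linarith [hu.1]⟩
  have h1 : HasSum (fun k => p k - (k : ℝ) * p k * u) (1 - meanDegree p * u) :=
    hp.hasSum_one.sub (hp.summable_mean.hasSum.mul_right u)
  refine hasSum_le (fun k => ?_) h1 (hp.summable_pow hx).hasSum
  have := one_add_mul_le_pow (show (-2 : ℝ) ≤ -u by linarith [hu.2]) k
  have := mul_le_mul_of_nonneg_left this (hp.nonneg k)
  rw [← sub_eq_add_neg] at this
  linarith

lemma degreePGF_continuousOn : ContinuousOn (degreePGF p) (Icc 0 1) := by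
  refine continuousOn_tsum (u := p) (fun k => by fun_prop) hp.hasSum_one.summable
    (fun k x hx => ?_)
  rw [Real.norm_of_nonneg (mul_nonneg (hp.nonneg k) (pow_nonneg hx.1 k))]
  exact mul_le_of_le_one_right (hp.nonneg k) (pow_le_one₀ hx.1 hx.2)

end Degree

/-! ### Convexity of the drift, its unique zero, and the old-age limit. -/

lemma one_sub_add_mul_mem {lam G : ℝ} (h0 : 0 < lam) (h1 : lam ≤ 1) (hG : G ∈ Icc (0 : ℝ) 1) :
    1 - lam + lam * G ∈ Icc (0 : ℝ) 1 := by
  constructor <;> nlinarith [hG.1, hG.2]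

/-- Up to an affine term and a non-negative factor the drift is `G · f(1 - λ + λG)`, a product of
non-negative, increasing, convex functions. -/
lemma drift_convexOn {p : ℕ → ℝ} (hp : IsOutDegreeDistribution p) {lam μ x : ℝ} (h0 : 0 < lam)
    (h1 : lam ≤ 1) (hμ : μ < 1) (hx : 0 ≤ x) :
    ConvexOn ℝ (Icc 0 1) (drift p lam μ x) := by
  have hf : ConvexOn ℝ (Icc 0 1) fun G => degreePGF p (1 - lam + lam * G) := by
    refine ⟨convex_Icc 0 1, fun y hy w hw a b ha hb hab => ?_⟩
    have := (degreePGF_convexOn hp).2 (one_sub_add_mul_mem h0 h1 hy)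
      (one_sub_add_mul_mem h0 h1 hw) ha hb hab
    convert this using 2
    simp only [smul_eq_mul]
    linear_combination (lam - 1) * hab
  have hmono : MonotoneOn (fun G => degreePGF p (1 - lam + lam * G)) (Icc 0 1) :=
    fun y hy w hw hyw => degreePGF_monotoneOn hp (one_sub_add_mul_mem h0 h1 hy)
      (one_sub_add_mul_mem h0 h1 hw) (by nlinarith)
  have hprod : ConvexOn ℝ (Icc (0 : ℝ) 1)
      ((fun G : ℝ => G) * fun G => degreePGF p (1 - lam + lam * G)) :=
    (convexOn_id (convex_Icc 0 1)).mul hf (fun y hy => hy.1)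
      (fun y hy => degreePGF_nonneg hp (one_sub_add_mul_mem h0 h1 hy).1)
      (monotoneOn_id.monovaryOn hmono)
  have hlin : ConvexOn ℝ (Icc (0 : ℝ) 1)
      fun G => lam * meanDegree p + μ - (lam * meanDegree p + 1) * G := by
    refine ⟨convex_Icc 0 1, fun y _ w _ a b _ _ hab => le_of_eq ?_⟩
    simp only [smul_eq_mul]
    linear_combination -(lam * meanDegree p + μ) * hab
  have := hlin.add (hprod.smul (show 0 ≤ (1 - μ) * x from mul_nonneg (by linarith) hx))
  refine this.congr fun y _ => ?_
  simp only [Pi.add_apply, Pi.mul_apply, smul_eq_mul, drift]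
  ring

lemma drift_one {p : ℕ → ℝ} (hp : IsOutDegreeDistribution p) (lam μ x : ℝ) :
    drift p lam μ x 1 = (1 - μ) * (x - 1) := by
  simp only [drift, mul_one, sub_add_cancel, degreePGF_one hp]
  ring

/-- At `x = 1` the drift vanishes at `G = 1`, so convexity alone does not isolate the root. The
tangent bound on `f` gives the lower bound `(1 - μ) λz (1 - G)² + μ (λz + 1)(1 - G)`. -/
lemma drift_pos_of_lt_one {p : ℕ → ℝ} (hp : IsOutDegreeDistribution p) {lam μ : ℝ} (h0 : 0 < lam)
    (h1 : lam ≤ 1) (hμ0 : 0 ≤ μ) (hμ : μ < 1) {G : ℝ} (hG0 : 0 ≤ G) (hG1 : G < 1) :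
    0 < drift p lam μ 1 G := by
  have hu : lam * (1 - G) ∈ Icc (0 : ℝ) 1 := ⟨by nlinarith, by nlinarith⟩
  have hf := one_sub_mul_le_degreePGF hp hu
  rw [show 1 - lam * (1 - G) = 1 - lam + lam * G by ring] at hf
  have hz := hp.meanDegree_pos
  have h2 : (1 - μ) * G * (1 - meanDegree p * (lam * (1 - G))) ≤
      (1 - μ) * G * degreePGF p (1 - lam + lam * G) :=
    mul_le_mul_of_nonneg_left hf (mul_nonneg (by linarith) hG0)
  have h3 : 0 < (1 - μ) * (meanDegree p * lam) * (1 - G) ^ 2 := by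
    have : 0 < 1 - G := by linarith
    have : 0 < 1 - μ := by linarith
    positivity
  have h4 : 0 ≤ (lam * meanDegree p + 1) * (1 - G) * μ := by
    have : 0 < 1 - G := by linarith
    positivity
  simp only [drift, mul_one]
  nlinarith

/-- To the right of its zero `a` a convex function lies below the chord from `(a, 0)` to `(1, d 1)`,
to the left above the extended chord; the factor `y - a` merges both cases. When `d 1 < 0` this
yields at once uniqueness of the zero and exponential attraction to it. -/
lemma ConvexOn.sub_mul_le {d : ℝ → ℝ} (hd : ConvexOn ℝ (Icc 0 1) d) {a y : ℝ} (ha0 : 0 ≤ a)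
    (ha1 : a < 1) (hda : d a = 0) (hy : y ∈ Icc (0 : ℝ) 1) :
    (y - a) * d y ≤ (y - a) ^ 2 / (1 - a) * d 1 := by
  have h1a : 0 < 1 - a := by linarith
  have ha : a ∈ Icc (0 : ℝ) 1 := ⟨ha0, ha1.le⟩
  have h1 : (1 : ℝ) ∈ Icc (0 : ℝ) 1 := ⟨zero_le_one, le_rfl⟩
  rw [div_mul_eq_mul_div, le_div_iff₀ h1a]
  rcases le_total a y with hay | hya
  · have := hd.2 ha h1
      (show 0 ≤ (1 - y) / (1 - a) from div_nonneg (by linarith [hy.2]) h1a.le)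
      (show 0 ≤ (y - a) / (1 - a) from div_nonneg (by linarith) h1a.le)
      (by field_simp; ring)
    simp only [smul_eq_mul, hda, mul_zero, zero_add, mul_one] at this
    rw [show (1 - y) / (1 - a) * a + (y - a) / (1 - a) = y by field_simp; ring,
      div_mul_eq_mul_div, le_div_iff₀ h1a] at this
    nlinarith [mul_le_mul_of_nonneg_left this (show 0 ≤ y - a by linarith)]
  · rcases eq_or_lt_of_le hya with rfl | hlt
    · simp
    have h1y : 0 < 1 - y := by linarith
    have := hd.2 hy h1
      (show 0 ≤ (1 - a) / (1 - y) from div_nonneg h1a.le h1y.le)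
      (show 0 ≤ (a - y) / (1 - y) from div_nonneg (by linarith) h1y.le) (by field_simp; ring)
    simp only [smul_eq_mul, mul_one] at this
    rw [show (1 - a) / (1 - y) * y + (a - y) / (1 - y) = a by field_simp; ring, hda,
      div_mul_eq_mul_div, div_mul_eq_mul_div, ← add_div, le_div_iff₀ h1y, zero_mul] at this
    nlinarith [mul_le_mul_of_nonneg_left this (show 0 ≤ a - y by linarith)]

lemma drift_zero_lt_one {p : ℕ → ℝ} (hp : IsOutDegreeDistribution p) {lam μ x G : ℝ}
    (hμ : μ < 1) (hx : x < 1) (hG : G ∈ Icc (0 : ℝ) 1) (h : drift p lam μ x G = 0) : G < 1 := by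
  refine lt_of_le_of_ne hG.2 fun h1 => ?_
  rw [h1, drift_one hp] at h
  have : (1 - μ) * (x - 1) < 0 := mul_neg_of_pos_of_neg (by linarith) (by linarith)
  linarith

lemma drift_zero_unique {p : ℕ → ℝ} (hp : IsOutDegreeDistribution p) {lam μ x : ℝ} (h0 : 0 < lam)
    (h1 : lam ≤ 1) (hμ0 : 0 ≤ μ) (hμ : μ < 1) (hx : x ∈ Icc (0 : ℝ) 1) {G G' : ℝ}
    (hG : G ∈ Icc (0 : ℝ) 1) (hG' : G' ∈ Icc (0 : ℝ) 1) (h : drift p lam μ x G = 0)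
    (h' : drift p lam μ x G' = 0) : G = G' := by
  rcases eq_or_lt_of_le hx.2 with rfl | hx1
  · have key : ∀ y ∈ Icc (0 : ℝ) 1, drift p lam μ 1 y = 0 → y = 1 := by
      intro y hy hy0
      by_contra hne
      exact (drift_pos_of_lt_one hp h0 h1 hμ0 hμ hy.1 (lt_of_le_of_ne hy.2 hne)).ne' hy0
    rw [key G hG h, key G' hG' h']
  · have hlt := drift_zero_lt_one hp hμ hx1 hG h
    have := ConvexOn.sub_mul_le (drift_convexOn hp h0 h1 hμ hx.1) hG.1 hlt h hG'
    rw [h', mul_zero, drift_one hp] at this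
    by_contra hne
    have h2 : 0 < (G' - G) ^ 2 / (1 - G) :=
      div_pos (sq_pos_of_ne_zero (sub_ne_zero.mpr (Ne.symm hne))) (by linarith)
    nlinarith [mul_pos h2 (mul_pos (show 0 < 1 - μ by linarith) (show 0 < 1 - x by linarith))]

/-- For `x = 1` the drift is non-negative and the start is at the maximum `1`, so the solution stays
there. For `x < 1` the square `(g - G)²` is a Lyapunov function with exponential decay, by the chord
estimate. -/
lemma tendsto_ageSolution {p : ℕ → ℝ} (hp : IsOutDegreeDistribution p) {lam μ : ℝ} (h0 : 0 < lam)
    (h1 : lam ≤ 1) (hμ0 : 0 ≤ μ) (hμ : μ < 1) {c : ℕ} (hc : 1 ≤ c) {x : ℝ}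
    (hx : x ∈ Icc (0 : ℝ) 1) {G : ℝ} (hG : G ∈ Icc (0 : ℝ) 1) (hG0 : drift p lam μ x G = 0)
    {g : ℝ → ℝ} (hg : IsAgeSolution p lam μ c x g) : Tendsto g atTop (𝓝 G) := by
  have hc0 : (0 : ℝ) < c := by exact_mod_cast hc
  have hcont : ContinuousOn g (Ici 0) := fun a ha => (hg.2 a ha).2.continuousWithinAt
  have hder : ∀ a ∈ interior (Ici (0 : ℝ)), HasDerivWithinAt g (drift p lam μ x (g a) / c)
      (interior (Ici 0)) a := fun a ha =>
    (hg.2 a (interior_subset ha)).2.mono interior_subset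
  rcases eq_or_lt_of_le hx.2 with rfl | hx1
  · have hG1 : G = 1 := drift_zero_unique hp h0 h1 hμ0 hμ hx hG ⟨zero_le_one, le_rfl⟩ hG0
      (by rw [drift_one hp]; ring)
    have hmono : MonotoneOn g (Ici 0) := by
      refine monotoneOn_of_hasDerivWithinAt_nonneg (convex_Ici 0) hcont hder fun a ha => ?_
      refine div_nonneg ?_ hc0.le
      have hm := (hg.2 a (interior_subset ha)).1
      rcases eq_or_lt_of_le hm.2 with h | h
      · rw [h, drift_one hp]; simp
      · exact (drift_pos_of_lt_one hp h0 h1 hμ0 hμ hm.1 h).le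
    refine tendsto_const_nhds.congr' ?_
    filter_upwards [eventually_ge_atTop 0] with a ha
    have := hmono self_mem_Ici ha ha
    rw [hg.1] at this
    rw [hG1]
    exact le_antisymm this (hg.2 a ha).1.2
  · have hlt := drift_zero_lt_one hp hμ hx1 hG hG0
    -- Minus the slope of the chord from `(G, 0)` to `(1, drift 1)`, where `drift 1 = -(1 - μ)(1 -
    -- x)`, divided by the capacity.
    set κ : ℝ := (1 - μ) * (1 - x) / (1 - G) / c with hκ
    have hκ0 : 0 < κ := by
      have : 0 < 1 - μ := by linarith
      have : 0 < 1 - x := by linarith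
      have : 0 < 1 - G := by linarith
      positivity
    have hanti : AntitoneOn (fun a => Real.exp (2 * κ * a) * (g a - G) ^ 2) (Ici 0) := by
      refine antitoneOn_of_hasDerivWithinAt_nonpos (convex_Ici 0) (by fun_prop)
        (f' := fun a => Real.exp (2 * κ * a) * (2 * κ) * (g a - G) ^ 2 +
          Real.exp (2 * κ * a) * (2 * (g a - G) * (drift p lam μ x (g a) / c)))
        (fun a ha => ?_) fun a ha => ?_
      · have e1 : HasDerivWithinAt (fun a => Real.exp (2 * κ * a))
            (Real.exp (2 * κ * a) * (2 * κ)) (interior (Ici 0)) a := by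
          have := ((hasDerivAt_id a).const_mul (2 * κ)).exp
          simpa using this.hasDerivWithinAt
        have e2 := ((hder a ha).sub_const G).pow 2
        refine (e1.mul e2).congr_deriv ?_
        simp
      · have := ConvexOn.sub_mul_le (drift_convexOn hp h0 h1 hμ hx.1) hG.1 hlt hG0
          (hg.2 a (interior_subset ha)).1
        rw [drift_one hp] at this
        have h2 : (g a - G) * (drift p lam μ x (g a) / c) ≤ -κ * (g a - G) ^ 2 := by
          rw [← mul_div_assoc, div_le_iff₀ hc0]
          refine this.trans (le_of_eq ?_)
          rw [hκ]
          have : 1 - G ≠ 0 := by linarith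
          field_simp
          ring
        have h3 := Real.exp_pos (2 * κ * a)
        nlinarith
    have hbound : ∀ a, 0 ≤ a → (g a - G) ^ 2 ≤ Real.exp (-(2 * κ * a)) := by
      intro a ha
      have := hanti self_mem_Ici ha ha
      simp only [mul_zero, Real.exp_zero, one_mul, hg.1] at this
      rw [Real.exp_neg, ← one_div, le_div_iff₀ (Real.exp_pos _), mul_comm]
      refine this.trans ?_
      nlinarith [hG.1, hG.2]
    have hlim : Tendsto (fun a => Real.exp (-(2 * κ * a))) atTop (𝓝 0) :=
      Real.tendsto_exp_neg_atTop_nhds_zero.comp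
        (tendsto_id.const_mul_atTop (show 0 < 2 * κ by positivity))
    have hsq : Tendsto (fun a => (g a - G) ^ 2) atTop (𝓝 0) :=
      squeeze_zero' (Eventually.of_forall fun a => sq_nonneg _)
        ((eventually_ge_atTop 0).mono hbound) hlim
    have := hsq.sqrt
    simp only [Real.sqrt_sq_eq_abs, Real.sqrt_zero] at this
    exact tendsto_sub_nhds_zero_iff.mp ((tendsto_zero_iff_abs_tendsto_zero _).mpr this)

/-! ### The branching process: popularity as total progeny. -/

/-- The success probability `ρ = (1 - μ) / (λz + 1)`. -/
def reshareProb (p : ℕ → ℝ) (lam μ : ℝ) : ℝ := (1 - μ) / (lam * meanDegree p + 1)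

/-- The generating series of the number of children of a reshared post. -/
def childSeries (p : ℕ → ℝ) (lam μ : ℝ) : PowerSeries ℝ :=
  offspringSeries p (reshareProb p lam μ) (lam * reshareProb p lam μ)

section Params

variable {p : ℕ → ℝ} (hp : IsOutDegreeDistribution p) {lam μ : ℝ} (h0 : 0 < lam) (h1 : lam ≤ 1)
include hp h0

lemma lam_mul_mean_pos : 0 < lam * meanDegree p := mul_pos h0 hp.meanDegree_pos

lemma reshareProb_pos (hμ : μ < 1) : 0 < reshareProb p lam μ :=
  div_pos (by linarith) (by linarith [lam_mul_mean_pos hp h0])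

lemma reshareProb_lt_one (hμ0 : 0 ≤ μ) : reshareProb p lam μ < 1 := by
  have := lam_mul_mean_pos hp h0
  rw [reshareProb, div_lt_one (by linarith)]
  linarith

/-- The left side is the mean `ρ + λρz` of the number of children, so `μ` measures the distance from
criticality. -/
lemma mul_reshareProb : (lam * meanDegree p + 1) * reshareProb p lam μ = 1 - μ := by
  have := lam_mul_mean_pos hp h0
  rw [reshareProb]
  field_simp

include h1

lemma lam_mul_reshareProb_mem (hμ0 : 0 ≤ μ) (hμ : μ < 1) :
    lam * reshareProb p lam μ ∈ Ioo (0 : ℝ) 1 := by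
  have := reshareProb_pos hp h0 hμ
  have := reshareProb_lt_one hp h0 hμ0
  constructor
  · positivity
  · nlinarith

lemma coeff_childSeries_nonneg (hμ0 : 0 ≤ μ) (hμ : μ < 1) (k : ℕ) :
    0 ≤ PowerSeries.coeff k (childSeries p lam μ) :=
  coeff_offspringSeries_nonneg hp.nonneg (reshareProb_pos hp h0 hμ).le
    (reshareProb_lt_one hp h0 hμ0).le (lam_mul_reshareProb_mem hp h0 h1 hμ0 hμ).1.le
    (lam_mul_reshareProb_mem hp h0 h1 hμ0 hμ).2.le k

lemma hasSum_childSeries (hμ0 : 0 ≤ μ) (hμ : μ < 1) {w : ℝ} (hw : w ∈ Icc (0 : ℝ) 1) :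
    HasSum (fun k => PowerSeries.coeff k (childSeries p lam μ) * w ^ k)
      ((1 - reshareProb p lam μ + reshareProb p lam μ * w) *
        degreePGF p (1 - lam * reshareProb p lam μ + lam * reshareProb p lam μ * w)) := by
  have hr := lam_mul_reshareProb_mem hp h0 h1 hμ0 hμ
  have := (sumsTo_offspringSeries (p := p) (reshareProb p lam μ) hr.1.le hr.2.le (s := 1)
    (by simpa using hp.summable_abs) (w := w)
    (by rw [Complex.norm_real, Real.norm_of_nonneg hw.1]; exact hw.2)).hasSum
  have e : (1 - ((lam * reshareProb p lam μ : ℝ) : ℂ) + ((lam * reshareProb p lam μ : ℝ) : ℂ) * w)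
      = ((1 - lam * reshareProb p lam μ + lam * reshareProb p lam μ * w : ℝ) : ℂ) := by
    push_cast; ring
  rw [e, ← degreePGF_ofReal] at this
  rw [childSeries, ← Complex.hasSum_ofReal]
  convert this using 1
  · ext k; push_cast; ring
  · push_cast; ring

lemma hasSum_coeff_childSeries (hμ0 : 0 ≤ μ) (hμ : μ < 1) :
    HasSum (fun k => PowerSeries.coeff k (childSeries p lam μ)) 1 := by
  have := hasSum_childSeries hp h0 h1 hμ0 hμ (w := 1) ⟨zero_le_one, le_rfl⟩
  simpa [degreePGF_one hp] using this

end Params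

/-- The law of the total progeny of one individual. -/
def progeny (p : ℕ → ℝ) (lam μ : ℝ) (n : ℕ) : ℝ :=
  firstPassage (fun k => PowerSeries.coeff k (childSeries p lam μ)) n 1

section Progeny

variable {a : ℕ → ℝ} (ha : ∀ k, 0 ≤ a k) (ha1 : HasSum a 1)
include ha ha1

lemma summable_firstPassage (k : ℕ) : Summable fun n => firstPassage a n k :=
  summable_of_sum_range_le (fun n => firstPassage_nonneg ha n k)
    fun N => sum_firstPassage_le_one ha (fun _ => sum_le_hasSum _ (fun j _ => ha j) ha1) N k

lemma summable_firstPassage_mul_pow (k : ℕ) {x : ℝ} (hx : x ∈ Icc (0 : ℝ) 1) :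
    Summable fun n => firstPassage a n k * x ^ n :=
  (summable_firstPassage ha ha1 k).of_nonneg_of_le
    (fun n => mul_nonneg (firstPassage_nonneg ha n k) (pow_nonneg hx.1 n))
    (fun n => mul_le_of_le_one_right (firstPassage_nonneg ha n k) (pow_le_one₀ hx.1 hx.2))

lemma tsum_firstPassage_pow (k : ℕ) {x : ℝ} (hx : x ∈ Icc (0 : ℝ) 1) :
    ∑' n, firstPassage a n k * x ^ n = (∑' n, firstPassage a n 1 * x ^ n) ^ k := by
  induction k with
  | zero =>
    rw [pow_zero, tsum_eq_single 0]
    · simp [firstPassage]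
    · intro n hn
      obtain ⟨m, rfl⟩ := Nat.exists_eq_succ_of_ne_zero hn
      simp [firstPassage]
  | succ k ih =>
    rw [pow_succ, ← ih, tsum_mul_tsum_eq_tsum_sum_antidiagonal_of_summable_norm
      (summable_firstPassage_mul_pow ha ha1 k hx).norm
      (summable_firstPassage_mul_pow ha ha1 1 hx).norm]
    refine tsum_congr fun n => ?_
    rw [firstPassage_add, Finset.sum_mul]
    refine Finset.sum_congr rfl fun ij hij => ?_
    rw [← Finset.HasAntidiagonal.mem_antidiagonal.mp hij, pow_add]
    ring

lemma tsum_firstPassage_mem {x : ℝ} (hx : x ∈ Icc (0 : ℝ) 1) :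
    ∑' n, firstPassage a n 1 * x ^ n ∈ Icc (0 : ℝ) 1 := by
  refine ⟨tsum_nonneg fun n => mul_nonneg (firstPassage_nonneg ha n 1) (pow_nonneg hx.1 n), ?_⟩
  refine (summable_firstPassage_mul_pow ha ha1 1 hx).tsum_le_of_sum_range_le fun N => ?_
  refine le_trans (Finset.sum_le_sum fun n _ => mul_le_of_le_one_right
    (firstPassage_nonneg ha n 1) (pow_le_one₀ hx.1 hx.2)) ?_
  exact sum_firstPassage_le_one ha (fun N => sum_le_hasSum _ (fun j _ => ha j) ha1) N 1

/-- Conditioning on the first step, the number of children of the root: from level `j` the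
first-passage generating function is the `j`-th power of the one from level `1`. -/
lemma tsum_firstPassage_eq {x : ℝ} (hx : x ∈ Icc (0 : ℝ) 1) :
    ∑' n, firstPassage a n 1 * x ^ n =
      x * ∑' j, a j * (∑' n, firstPassage a n 1 * x ^ n) ^ j := by
  set S := ∑' n, firstPassage a n 1 * x ^ n with hS
  have hS01 : S ∈ Icc (0 : ℝ) 1 := tsum_firstPassage_mem ha ha1 hx
  set F : ℕ × ℕ → ℝ := fun jn => a jn.1 * (firstPassage a jn.2 jn.1 * x ^ jn.2) with hF
  have hF0 : 0 ≤ F := fun jn => mul_nonneg (ha _) (mul_nonneg (firstPassage_nonneg ha _ _)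
    (pow_nonneg hx.1 _))
  have hrow : ∀ j, HasSum (fun n => F (j, n)) (a j * S ^ j) := by
    intro j
    rw [← tsum_firstPassage_pow ha ha1 j hx]
    exact (summable_firstPassage_mul_pow ha ha1 j hx).hasSum.mul_left _
  have hsum : Summable F := by
    rw [summable_prod_of_nonneg hF0]
    refine ⟨fun j => (hrow j).summable, ?_⟩
    simp_rw [fun j => (hrow j).tsum_eq]
    exact ha1.summable.of_nonneg_of_le (fun j => mul_nonneg (ha j) (pow_nonneg hS01.1 j))
      (fun j => mul_le_of_le_one_right (ha j) (pow_le_one₀ hS01.1 hS01.2))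
  calc S = ∑' n, firstPassage a (n + 1) 1 * x ^ (n + 1) := by
        rw [hS, (summable_firstPassage_mul_pow ha ha1 1 hx).tsum_eq_zero_add]
        simp [firstPassage]
    _ = ∑' n, x * ∑' j, F (j, n) := by
        refine tsum_congr fun n => ?_
        have : ∑' j, F (j, n) = ∑ j ∈ Finset.range (n + 1), F (j, n) :=
          tsum_eq_sum fun j hj => by
            simp only [hF]
            rw [firstPassage_eq_zero a (by simpa using hj)]; simp
        rw [this, show (1 : ℕ) = 0 + 1 by rfl, firstPassage_succ a n 0 le_rfl, Finset.sum_mul,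
          Finset.mul_sum]
        refine Finset.sum_congr rfl fun j _ => ?_
        simp only [hF, zero_add]
        ring
    _ = x * ∑' n, ∑' j, F (j, n) := tsum_mul_left
    _ = x * ∑' j, ∑' n, F (j, n) := by
        rw [Summable.tsum_comm (f := fun j n => F (j, n)) hsum]
    _ = _ := by simp_rw [fun j => (hrow j).tsum_eq]

end Progeny

section Popularity

variable {p : ℕ → ℝ} (hp : IsOutDegreeDistribution p) {lam μ : ℝ} (h0 : 0 < lam) (h1 : lam ≤ 1)
  (hμ0 : 0 ≤ μ) (hμ : μ < 1)
include hp h0 h1 hμ0 hμ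

/-- With `G = 1 - ρ + ρH` one has `(λz + 1) G = λz + μ + (1 - μ) H`, so the steady-state equation
reduces to `H = x G f(1 - λ + λG)`, the fixed-point equation of the total progeny. -/
lemma isLimitingPopularity_progeny : IsLimitingPopularity p lam μ (progeny p lam μ) := by
  set ρ := reshareProb p lam μ with hρ
  have hρ0 := reshareProb_pos hp h0 hμ
  have hρ1 := reshareProb_lt_one hp h0 hμ0
  have hρe := mul_reshareProb hp h0 (μ := μ)
  rw [← hρ] at hρ0 hρ1 hρe
  have ha := coeff_childSeries_nonneg hp h0 h1 hμ0 hμ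
  have ha1 := hasSum_coeff_childSeries hp h0 h1 hμ0 hμ
  have main : ∀ x ∈ Icc (0 : ℝ) 1, ∃ C ∈ Icc (0 : ℝ) 1,
      HasSum (fun n => progeny p lam μ n * x ^ n) C ∧
      C = popularityPGF p lam x (1 - ρ + ρ * C) := by
    intro x hx
    have hC := tsum_firstPassage_mem ha ha1 hx
    refine ⟨_, hC, (summable_firstPassage_mul_pow ha ha1 1 hx).hasSum, ?_⟩
    have h2 := tsum_firstPassage_eq ha ha1 hx
    rw [(hasSum_childSeries hp h0 h1 hμ0 hμ hC).tsum_eq] at h2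
    generalize (∑' n, firstPassage (fun k => PowerSeries.coeff k (childSeries p lam μ)) n 1 *
      x ^ n) = C at h2 ⊢
    rw [popularityPGF, show 1 - lam + lam * (1 - ρ + ρ * C) = 1 - lam * ρ + lam * ρ * C by ring,
      mul_assoc x]
    exact h2
  choose! C hC hsum heq using main
  refine ⟨fun x => 1 - ρ + ρ * C x, fun x hx => ?_, fun x hx => ?_⟩
  · have hCx := hC x hx
    refine ⟨⟨by nlinarith [hCx.1], by nlinarith [hCx.2]⟩, ?_⟩
    have := heq x hx
    rw [popularityPGF] at this
    rw [drift]
    linear_combination (1 - C x) * hρe - (1 - μ) * this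
  · rw [← heq x hx]; exact hsum x hx

lemma eq_progeny {q : ℕ → ℝ} (hq : IsLimitingPopularity p lam μ q) : q = progeny p lam μ := by
  obtain ⟨G, hG, hs⟩ := hq
  obtain ⟨G', hG', hs'⟩ := isLimitingPopularity_progeny hp h0 h1 hμ0 hμ
  refine powerSeries_coeff_unique (F := fun x => popularityPGF p lam x (G x))
    (fun x hx => hs x (Ioo_subset_Icc_self hx)) fun x hx => ?_
  have hx' := Ioo_subset_Icc_self hx
  rw [drift_zero_unique hp h0 h1 hμ0 hμ hx' (hG x hx').1 (hG' x hx').1 (hG x hx').2 (hG' x hx').2]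
  exact hs' x hx'

lemma progeny_nonneg (n : ℕ) : 0 ≤ progeny p lam μ n :=
  firstPassage_nonneg (coeff_childSeries_nonneg hp h0 h1 hμ0 hμ) n 1

/-- At `x = 1` the only root of the drift is `G = 1`, so the tree is almost surely finite and no
mass is lost. -/
lemma hasSum_progeny : HasSum (progeny p lam μ) 1 := by
  obtain ⟨G, hG, hs⟩ := isLimitingPopularity_progeny hp h0 h1 hμ0 hμ
  have hx : (1 : ℝ) ∈ Icc (0 : ℝ) 1 := ⟨zero_le_one, le_rfl⟩
  have := hs 1 hx
  rw [drift_zero_unique hp h0 h1 hμ0 hμ hx (hG 1 hx).1 hx (hG 1 hx).2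
    (by rw [drift_one hp]; ring)] at this
  simpa [popularityPGF, degreePGF_one hp] using this

omit hp h0 h1 hμ0 hμ in
-- The Otter-Dwass formula `n P(T = n) = P(S_n = n - 1)`, the only route from the popularity to sums
-- of independent variables.
lemma mul_progeny (p : ℕ → ℝ) (lam μ : ℝ) {n : ℕ} (hn : 1 ≤ n) :
    (n : ℝ) * progeny p lam μ n = PowerSeries.coeff (n - 1) (childSeries p lam μ ^ n) := by
  have := mul_firstPassage (childSeries p lam μ) n 1 hn
  simpa [progeny] using this

end Popularity

/-! ### Fourier inversion and the general local limit theorem. -/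

lemma norm_cexp_ofReal_mul_I' (t : ℝ) : ‖Complex.exp (t * Complex.I)‖ = 1 :=
  Complex.norm_exp_ofReal_mul_I t

lemma integral_cexp_int (k : ℤ) :
    ∫ t in (-Real.pi)..Real.pi, Complex.exp (k * t * Complex.I) =
      if k = 0 then 2 * (Real.pi : ℂ) else 0 := by
  split_ifs with hk
  · simp [hk]; ring
  · have hc : (k : ℂ) * Complex.I ≠ 0 := by simp [hk]
    have h := integral_exp_mul_complex (a := -Real.pi) (b := Real.pi) hc
    rw [show (fun t : ℝ => Complex.exp (k * t * Complex.I)) =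
      fun t : ℝ => Complex.exp (k * Complex.I * t) by ext t; ring_nf, h]
    have e : Complex.exp (k * Complex.I * (Real.pi : ℝ)) =
        Complex.exp (k * Complex.I * ((-Real.pi : ℝ) : ℂ)) := by
      rw [Complex.exp_eq_exp_iff_exists_int]
      exact ⟨k, by push_cast; ring⟩
    rw [e, sub_self, zero_div]

lemma SumsTo.summable_abs {P : PowerSeries ℝ} {w s : ℂ} (h : SumsTo P w s) (hw : ‖w‖ = 1) :
    Summable fun n => |PowerSeries.coeff n P| := by
  simpa [hw] using h.1

section Inversion

variable {P : PowerSeries ℝ} {χ : ℝ → ℂ}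
  (h : ∀ t : ℝ, SumsTo P (Complex.exp (t * Complex.I)) (χ t))
include h

lemma continuous_of_sumsTo : Continuous χ := by
  have hs := (h 0).summable_abs (norm_cexp_ofReal_mul_I' 0)
  have : χ = fun t : ℝ => ∑' n, ((PowerSeries.coeff n P : ℝ) : ℂ) *
      Complex.exp (t * Complex.I) ^ n := by
    ext t; exact (h t).2.symm
  rw [this]
  refine continuous_tsum (fun n => by fun_prop) hs fun n t => ?_
  rw [norm_mul, norm_pow, norm_cexp_ofReal_mul_I', one_pow, mul_one, Complex.norm_real]
  rfl

lemma coeff_eq_integral (m : ℕ) :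
    ((PowerSeries.coeff m P : ℝ) : ℂ) = (2 * (Real.pi : ℂ))⁻¹ *
      ∫ t in (-Real.pi)..Real.pi, χ t * Complex.exp (-(m * t * Complex.I)) := by
  have hs := (h 0).summable_abs (norm_cexp_ofReal_mul_I' 0)
  have h1 : HasSum (fun n : ℕ => ∫ t in (-Real.pi)..Real.pi,
      ((PowerSeries.coeff n P : ℝ) : ℂ) * Complex.exp (t * Complex.I) ^ n *
        Complex.exp (-(m * t * Complex.I)))
      (∫ t in (-Real.pi)..Real.pi, χ t * Complex.exp (-(m * t * Complex.I))) := by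
    refine intervalIntegral.hasSum_integral_of_dominated_convergence
      (fun n _ => |PowerSeries.coeff n P|) (fun n => Continuous.aestronglyMeasurable (by fun_prop))
      (fun n => ae_of_all _ fun t _ => ?_) (ae_of_all _ fun _ _ => hs)
      (intervalIntegrable_const) (ae_of_all _ fun t _ => (h t).hasSum.mul_right _)
    have : ‖Complex.exp (-(m * t * Complex.I))‖ = 1 := by
      rw [show -((m : ℂ) * t * Complex.I) = ((-(m * t) : ℝ) : ℂ) * Complex.I by push_cast; ring]
      exact norm_cexp_ofReal_mul_I' _
    rw [norm_mul, norm_mul, norm_pow, norm_cexp_ofReal_mul_I', one_pow, mul_one, this, mul_one,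
      Complex.norm_real]
    rfl
  have h2 : ∀ n : ℕ, ∫ t in (-Real.pi)..Real.pi,
      ((PowerSeries.coeff n P : ℝ) : ℂ) * Complex.exp (t * Complex.I) ^ n *
        Complex.exp (-(m * t * Complex.I)) =
      if n = m then ((PowerSeries.coeff m P : ℝ) : ℂ) * (2 * Real.pi) else 0 := by
    intro n
    have e : ∀ t : ℝ, ((PowerSeries.coeff n P : ℝ) : ℂ) * Complex.exp (t * Complex.I) ^ n *
        Complex.exp (-(m * t * Complex.I)) = ((PowerSeries.coeff n P : ℝ) : ℂ) *
          Complex.exp (((n - m : ℤ) : ℂ) * t * Complex.I) := by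
      intro t
      rw [← Complex.exp_nat_mul, mul_assoc, ← Complex.exp_add]
      congr 2
      push_cast
      ring
    simp_rw [e]
    rw [intervalIntegral.integral_const_mul, integral_cexp_int]
    by_cases hnm : n = m
    · subst hnm; simp
    · rw [if_neg hnm, if_neg (by omega), mul_zero]
  simp_rw [h2] at h1
  have h3 := h1.unique (hasSum_ite_eq m _)
  rw [h3]
  have : (Real.pi : ℂ) ≠ 0 := by exact_mod_cast Real.pi_ne_zero
  field_simp

/-- The substitution `u = tL`, with an indicator so that all the integrals live on the same line and
dominated convergence applies. -/
lemma mul_coeff_eq_integral (m : ℕ) {L : ℝ} (hL : 0 < L) :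
    (L : ℂ) * ((PowerSeries.coeff m P : ℝ) : ℂ) = (2 * (Real.pi : ℂ))⁻¹ *
      ∫ u, (Ioc (-(Real.pi * L)) (Real.pi * L)).indicator
        (fun u : ℝ => χ (u / L) * Complex.exp (-(m * (u / L : ℝ) * Complex.I))) u := by
  rw [integral_indicator measurableSet_Ioc,
    ← intervalIntegral.integral_of_le (by nlinarith [Real.pi_pos]),
    intervalIntegral.integral_comp_div (fun t : ℝ => χ t * Complex.exp (-(m * t * Complex.I)))
      hL.ne', coeff_eq_integral h m, neg_div, mul_div_cancel_right₀ _ hL.ne', Complex.real_smul]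
  ring

end Inversion

/-- The general filter serves limits in which `n → ∞` and `μ → 0` jointly. -/
lemma tendsto_one_add_pow_exp_filter {ι : Type*} {l : Filter ι} {n : ι → ℕ} (hn : Tendsto n l atTop)
    {g : ι → ℂ} {t : ℂ} (hg : Tendsto (fun i => (n i : ℂ) * g i) l (𝓝 t)) :
    Tendsto (fun i => (1 + g i) ^ n i) l (𝓝 (Complex.exp t)) := by
  have hninv : Tendsto (fun i => ((n i : ℂ))⁻¹) l (𝓝 0) := by
    have : Tendsto (fun i => ((n i : ℝ))⁻¹) l (𝓝 0) :=
      tendsto_inv_atTop_zero.comp (tendsto_natCast_atTop_atTop.comp hn)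
    have := (Complex.continuous_ofReal.tendsto 0).comp this
    simpa [Function.comp_def] using this
  have hne : ∀ᶠ i in l, (n i : ℂ) ≠ 0 := by
    filter_upwards [hn.eventually_ge_atTop 1] with i hi
    exact_mod_cast (by omega : n i ≠ 0)
  have hg0 : Tendsto g l (𝓝 0) := by
    have := hninv.mul hg
    rw [zero_mul] at this
    refine this.congr' ?_
    filter_upwards [hne] with i hi
    field_simp
  have hlog : Tendsto (fun i => (n i : ℂ) * Complex.log (1 + g i)) l (𝓝 t) := by
    have h1 : (fun i => Complex.log (1 + g i) - g i) =O[l] fun i => g i ^ 2 :=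
      Complex.log_sub_self_isBigO.comp_tendsto hg0
    have h2 : (fun i => (n i : ℂ) * (Complex.log (1 + g i) - g i)) =O[l]
        fun i => (n i : ℂ) * g i ^ 2 := (isBigO_refl _ _).mul h1
    have h3 : Tendsto (fun i => (n i : ℂ) * g i ^ 2) l (𝓝 0) := by
      have := hg.mul hg0
      rw [mul_zero] at this
      exact this.congr fun i => by ring
    have h4 := (h2.trans_tendsto h3).add hg
    rw [zero_add] at h4
    exact h4.congr fun i => by ring
  refine ((Complex.continuous_exp.tendsto _).comp hlog).congr' ?_
  filter_upwards [hg0.eventually_ne (show (0 : ℂ) ≠ -1 by simp)] with i hi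
  rw [Function.comp_apply, Complex.exp_nat_mul, Complex.exp_log]
  intro h0
  exact hi (by linear_combination h0)

/-- Local limit theorem from pointwise convergence of characteristic functions and domination.
The integrand carries the drift `θ i`, which need not converge. -/
lemma tendsto_scaled_coeff {ι : Type*} {l : Filter ι} [l.IsCountablyGenerated]
    {P : ι → PowerSeries ℝ} {χ : ι → ℝ → ℂ} {n : ι → ℕ} {L m : ι → ℝ} {ψ : ℝ → ℂ} {g : ℝ → ℝ}
    (hn : Tendsto n l atTop) (hL : Tendsto L l atTop)
    (hχ : ∀ᶠ i in l, ∀ t : ℝ, SumsTo (P i) (Complex.exp (t * Complex.I)) (χ i t))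
    (hg : Integrable g)
    (hbound : ∀ᶠ i in l, ∀ u : ℝ, |u| ≤ Real.pi * L i → ‖χ i (u / L i)‖ ^ n i ≤ g u)
    (hg0 : ∀ u, 0 ≤ g u) (hψ : Integrable ψ)
    (hlim : ∀ u : ℝ, Tendsto (fun i => (χ i (u / L i) *
      Complex.exp (-(m i * (u / L i : ℝ) * Complex.I))) ^ n i) l (𝓝 (ψ u))) :
    Tendsto (fun i => (L i : ℂ) * ((PowerSeries.coeff (n i - 1) (P i ^ n i) : ℝ) : ℂ) -
      (2 * (Real.pi : ℂ))⁻¹ * ∫ u : ℝ, ψ u *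
        Complex.exp (-((n i * (1 - m i) / L i : ℝ) * u * Complex.I))) l (𝓝 0) := by
  -- The distance from the mean `n m` to `n`, in units of `L`. It may diverge, so its phase is kept
  -- in the comparison integral `E` instead of being sent to a limit.
  set θ : ι → ℝ := fun i => n i * (1 - m i) / L i with hθ
  set S : ι → Set ℝ := fun i => Ioc (-(Real.pi * L i)) (Real.pi * L i) with hS
  set F : ι → ℝ → ℂ := fun i => (S i).indicator (fun u : ℝ => χ i (u / L i) ^ n i *
    Complex.exp (-(((n i - 1 : ℕ) : ℂ) * (u / L i : ℝ) * Complex.I))) with hF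
  set E : ι → ℝ → ℂ := fun i u => ψ u * Complex.exp (-(θ i * u * Complex.I)) with hE
  have hphase : ∀ y : ℝ, ‖Complex.exp (-(y * Complex.I))‖ = 1 := by
    intro y
    rw [← neg_mul, ← Complex.ofReal_neg]
    exact norm_cexp_ofReal_mul_I' _
  have hEn : ∀ i u, ‖E i u‖ = ‖ψ u‖ := by
    intro i u
    have := hphase (θ i * u)
    push_cast at this
    simp only [hE, norm_mul, this, mul_one]
  have hFm : ∀ᶠ i in l, AEStronglyMeasurable (F i) := by
    filter_upwards [hχ] with i hi
    refine AEStronglyMeasurable.indicator ?_ measurableSet_Ioc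
    have := continuous_of_sumsTo hi
    exact Continuous.aestronglyMeasurable (by fun_prop)
  have hEm : ∀ i, AEStronglyMeasurable (E i) := fun i =>
    hψ.aestronglyMeasurable.mul (Continuous.aestronglyMeasurable (by fun_prop))
  have hFb : ∀ᶠ i in l, ∀ u, ‖F i u‖ ≤ g u := by
    filter_upwards [hbound] with i hi u
    by_cases hu : u ∈ S i
    · have h2 := hphase (((n i - 1 : ℕ) : ℝ) * (u / L i))
      push_cast at h2
      simp only [hF, indicator_of_mem hu, norm_mul, norm_pow]
      push_cast
      rw [h2, mul_one]
      exact hi u (abs_le.mpr ⟨hu.1.le, hu.2⟩)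
    · simp only [hF, indicator_of_notMem hu, norm_zero]; exact hg0 u
  -- After a phase of modulus one is factored out, the difference compares the centred
  -- characteristic function with `ψ`. The target `n - 1` instead of `n` leaves a factor `e^{iu/L}`,
  -- which tends to `1`.
  have hlim0 : ∀ u, Tendsto (fun i => F i u - E i u) l (𝓝 0) := by
    intro u
    have hz : Tendsto (fun i => u / L i) l (𝓝 0) := hL.const_div_atTop u
    have h1 : Tendsto (fun i => Complex.exp ((u / L i : ℝ) * Complex.I)) l (𝓝 1) := by
      have : Continuous fun y : ℝ => Complex.exp (y * Complex.I) := by fun_prop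
      have := (this.tendsto 0).comp hz
      simpa [Function.comp_def] using this
    have h2 := ((hlim u).mul h1).sub_const (ψ u)
    rw [mul_one, sub_self] at h2
    rw [tendsto_zero_iff_norm_tendsto_zero] at h2 ⊢
    refine h2.congr' ?_
    filter_upwards [hn.eventually_ge_atTop 1, hL.eventually_gt_atTop 0,
      hL.eventually_gt_atTop (|u| / Real.pi)] with i hi hL0 hLu
    have hmem : u ∈ S i := by
      rw [div_lt_iff₀ Real.pi_pos, mul_comm] at hLu
      exact ⟨(abs_lt.mp hLu).1, (abs_lt.mp hLu).2.le⟩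
    have hne : (L i : ℂ) ≠ 0 := by exact_mod_cast hL0.ne'
    have e : F i u - E i u = Complex.exp (-(θ i * u * Complex.I)) * ((χ i (u / L i) *
        Complex.exp (-(m i * (u / L i : ℝ) * Complex.I))) ^ n i *
          Complex.exp ((u / L i : ℝ) * Complex.I) - ψ u) := by
      simp only [hF, hE, indicator_of_mem hmem]
      rw [mul_sub, mul_pow, ← Complex.exp_nat_mul]
      rw [show Complex.exp (-(θ i * u * Complex.I)) * (χ i (u / L i) ^ n i *
        Complex.exp (n i * -(m i * (u / L i : ℝ) * Complex.I)) *
          Complex.exp ((u / L i : ℝ) * Complex.I)) = χ i (u / L i) ^ n i *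
          (Complex.exp (-(θ i * u * Complex.I)) *
          Complex.exp (n i * -(m i * (u / L i : ℝ) * Complex.I)) *
          Complex.exp ((u / L i : ℝ) * Complex.I)) by ring, ← Complex.exp_add, ← Complex.exp_add]
      congr 1
      · congr 2
        rw [Nat.cast_sub hi]
        simp only [hθ]
        push_cast
        field_simp
        ring
      · ring
    have h3 := hphase (θ i * u)
    push_cast at h3
    rw [e, norm_mul, h3, one_mul]
  have hDCT : Tendsto (fun i => ∫ u, (F i u - E i u)) l (𝓝 (∫ _ : ℝ, (0 : ℂ))) := by
    refine tendsto_integral_filter_of_dominated_convergence (fun u => g u + ‖ψ u‖)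
      (hFm.mono fun i hi => hi.sub (hEm i)) ?_ (hg.add hψ.norm) (ae_of_all _ hlim0)
    filter_upwards [hFb] with i hi
    refine ae_of_all _ fun u => (norm_sub_le _ _).trans ?_
    rw [hEn]
    exact add_le_add_left (hi u) _
  rw [integral_zero] at hDCT
  have := hDCT.const_mul ((2 * (Real.pi : ℂ))⁻¹)
  rw [mul_zero] at this
  refine this.congr' ?_
  filter_upwards [hχ, hL.eventually_gt_atTop 0, hFm, hFb] with i hi hL0 hm hb
  have hFi : Integrable (F i) := hg.mono' hm (ae_of_all _ hb)
  have hEi : Integrable (E i) := hψ.norm.mono' (hEm i) (ae_of_all _ fun u => (hEn i u).le)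
  rw [integral_sub hFi hEi, mul_sub, mul_coeff_eq_integral (fun t => (hi t).pow (n i)) _ hL0]

/-! ### Second-order expansions and the Gaussian local limit theorem. -/

/-- The second divided difference of `w ↦ w ^ k` at the double point `1` and at `w`. -/
def powRemainder (k : ℕ) (w : ℂ) : ℂ := ∑ j ∈ Finset.range k, ∑ i ∈ Finset.range j, w ^ i

lemma pow_eq_add_powRemainder (k : ℕ) (w : ℂ) :
    w ^ k = 1 + k * (w - 1) + (w - 1) ^ 2 * powRemainder k w := by
  induction k with
  | zero => simp [powRemainder]
  | succ k ih =>
    have h := mul_geom_sum w k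
    rw [powRemainder, Finset.sum_range_succ, ← powRemainder]
    push_cast
    rw [pow_succ]
    linear_combination ih - (w - 1) * h

lemma norm_powRemainder_le (k : ℕ) {w : ℂ} (hw : ‖w‖ ≤ 1) :
    ‖powRemainder k w‖ ≤ k * (k - 1) / 2 := by
  induction k with
  | zero => simp [powRemainder]
  | succ k ih =>
    rw [powRemainder, Finset.sum_range_succ, ← powRemainder]
    have : ‖∑ i ∈ Finset.range k, w ^ i‖ ≤ k := by
      refine (norm_sum_le _ _).trans ?_
      refine (Finset.sum_le_card_nsmul _ _ 1 fun i _ => ?_).trans (by simp)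
      rw [norm_pow]; exact pow_le_one₀ (norm_nonneg _) hw
    push_cast
    linarith [norm_add_le (powRemainder k w) (∑ i ∈ Finset.range k, w ^ i)]

lemma powRemainder_one (k : ℕ) : powRemainder k 1 = k * (k - 1) / 2 := by
  induction k with
  | zero => simp [powRemainder]
  | succ k ih =>
    rw [powRemainder, Finset.sum_range_succ, ← powRemainder, ih]
    simp
    ring

/-- The second-order Taylor remainder of the generating function at `1`. -/
def pgfRemainder (p : ℕ → ℝ) (w : ℂ) : ℂ := ∑' k : ℕ, (p k : ℂ) * powRemainder k w

section Taylor

variable {p : ℕ → ℝ} (hp : IsOutDegreeDistribution p)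
include hp

lemma norm_complexPGF_le_one {w : ℂ} (hw : ‖w‖ ≤ 1) : ‖complexPGF p w‖ ≤ 1 := by
  have hb : ∀ k, ‖(p k : ℂ) * w ^ k‖ ≤ p k := fun k => by
    rw [norm_mul, norm_pow, Complex.norm_real, Real.norm_of_nonneg (hp.nonneg k)]
    exact mul_le_of_le_one_right (hp.nonneg k) (pow_le_one₀ (norm_nonneg _) hw)
  exact tsum_of_norm_bounded hp.hasSum_one hb

lemma complexPGF_eq (h2 : FiniteSecondMoment p) {w : ℂ} (hw : ‖w‖ ≤ 1) :
    complexPGF p w = 1 + meanDegree p * (w - 1) + (w - 1) ^ 2 * pgfRemainder p w := by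
  have s0 : HasSum (fun k => (p k : ℂ)) 1 := by
    have := Complex.hasSum_ofReal.mpr hp.hasSum_one
    simpa using this
  have s1 : HasSum (fun k : ℕ => (k : ℂ) * (p k : ℂ)) (meanDegree p : ℂ) := by
    have := hp.summable_mean.hasSum
    exact_mod_cast this
  have s2 : Summable fun k : ℕ => (p k : ℂ) * powRemainder k w := by
    refine Summable.of_norm_bounded h2 fun k => ?_
    rw [norm_mul, Complex.norm_real, Real.norm_of_nonneg (hp.nonneg k), mul_comm]
    refine mul_le_mul_of_nonneg_right ((norm_powRemainder_le k hw).trans ?_) (hp.nonneg k)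
    have : (0 : ℝ) ≤ k * (k - 1) := by
      rcases Nat.eq_zero_or_pos k with rfl | hk
      · simp
      · have : (1 : ℝ) ≤ k := by exact_mod_cast hk
        exact mul_nonneg (by positivity) (by linarith)
    linarith
  have := (s0.add (s1.mul_right (w - 1))).add (s2.hasSum.mul_left ((w - 1) ^ 2))
  rw [complexPGF, pgfRemainder, ← this.tsum_eq]
  refine tsum_congr fun k => ?_
  rw [pow_eq_add_powRemainder k w]
  ring

/-- The second factorial moment is the majorant in Weierstrass' test. It controls the closed disc
only, hence the later checks that arguments stay inside it. -/
lemma continuousOn_pgfRemainder (h2 : FiniteSecondMoment p) :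
    ContinuousOn (pgfRemainder p) (Metric.closedBall 0 1) := by
  refine continuousOn_tsum (fun k => ?_) h2 fun k w hw => ?_
  · unfold powRemainder; fun_prop
  · have hw' : ‖w‖ ≤ 1 := by simpa using hw
    rw [norm_mul, Complex.norm_real, Real.norm_of_nonneg (hp.nonneg k), mul_comm]
    refine mul_le_mul_of_nonneg_right ((norm_powRemainder_le k hw').trans ?_) (hp.nonneg k)
    have : (0 : ℝ) ≤ k * (k - 1) := by
      rcases Nat.eq_zero_or_pos k with rfl | hk
      · simp
      · have : (1 : ℝ) ≤ k := by exact_mod_cast hk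
        exact mul_nonneg (by positivity) (by linarith)
    linarith

omit hp in
lemma pgfRemainder_one (p : ℕ → ℝ) : pgfRemainder p 1 = secondFactorialMoment p / 2 := by
  rw [pgfRemainder, secondFactorialMoment, Complex.ofReal_tsum, div_eq_mul_inv, ← tsum_mul_right]
  refine tsum_congr fun k => ?_
  rw [powRemainder_one]
  push_cast
  ring

lemma secondFactorialMoment_nonneg : 0 ≤ secondFactorialMoment p := by
  refine tsum_nonneg fun k => mul_nonneg ?_ (hp.nonneg k)
  rcases Nat.eq_zero_or_pos k with rfl | hk
  · simp
  · have : (1 : ℝ) ≤ k := by exact_mod_cast hk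
    exact mul_nonneg (by positivity) (by linarith)

end Taylor

/-- The second-order Taylor remainder of the exponential. -/
def expRemainder (x : ℂ) : ℂ := if x = 0 then 1 / 2 else (Complex.exp x - 1 - x) / x ^ 2

lemma exp_eq_add_expRemainder (x : ℂ) : Complex.exp x = 1 + x + x ^ 2 * expRemainder x := by
  unfold expRemainder
  split_ifs with h
  · simp [h]
  · field_simp; ring

lemma tendsto_expRemainder : Tendsto expRemainder (𝓝 0) (𝓝 (1 / 2)) := by
  rw [tendsto_iff_norm_sub_tendsto_zero]
  have hlim : Tendsto (fun x : ℂ => ‖x‖) (𝓝 0) (𝓝 0) := by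
    simpa using (continuous_norm (E := ℂ)).tendsto 0
  refine squeeze_zero' (Eventually.of_forall fun x => norm_nonneg _) ?_ hlim
  filter_upwards [Metric.closedBall_mem_nhds (0 : ℂ) one_pos] with x hx
  have hx1 : ‖x‖ ≤ 1 := by simpa using hx
  by_cases h : x = 0
  · simp [expRemainder, h]
  · have hb := Complex.exp_bound hx1 (n := 3) (by norm_num)
    simp only [Finset.sum_range_succ, Finset.sum_range_zero, Nat.factorial] at hb
    norm_num at hb
    have e : expRemainder x - 1 / 2 = (Complex.exp x - (1 + x + x ^ 2 / 2)) / x ^ 2 := by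
      rw [expRemainder, if_neg h]; field_simp; ring
    have hx0 : 0 < ‖x‖ := norm_pos_iff.mpr h
    rw [e, norm_div, norm_pow, div_le_iff₀ (by positivity)]
    nlinarith [pow_pos hx0 3]

/-- The squared modulus is `1 - 2ρ(1 - ρ)(1 - cos t)`, and `1 - cos t ≥ 2t²/π²`. The Bernoulli part
alone supplies decay on all of `[-π, π]`, so that no aperiodicity of `p` is needed. -/
lemma norm_bernoulli_le {ρ t : ℝ} (h0 : 0 ≤ ρ) (h1 : ρ ≤ 1) (ht : |t| ≤ Real.pi) :
    ‖1 - (ρ : ℂ) + ρ * Complex.exp (t * Complex.I)‖ ≤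
      Real.exp (-(2 * ρ * (1 - ρ) / Real.pi ^ 2 * t ^ 2)) := by
  have hsq : ‖1 - (ρ : ℂ) + ρ * Complex.exp (t * Complex.I)‖ ^ 2 =
      1 - 2 * ρ * (1 - ρ) * (1 - Real.cos t) := by
    rw [← Complex.normSq_eq_norm_sq, Complex.normSq_apply]
    simp only [Complex.add_re, Complex.sub_re, Complex.one_re, Complex.ofReal_re, Complex.mul_re,
      Complex.exp_ofReal_mul_I_re, Complex.ofReal_im, Complex.exp_ofReal_mul_I_im, Complex.add_im,
      Complex.sub_im, Complex.one_im, Complex.mul_im]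
    linear_combination ρ ^ 2 * Real.sin_sq_add_cos_sq t
  have hcos := Real.cos_le_one_sub_mul_cos_sq ht
  have hρ : 0 ≤ 2 * ρ * (1 - ρ) := mul_nonneg (by linarith) (by linarith)
  refine le_of_sq_le_sq ?_ (Real.exp_pos _).le
  rw [hsq, ← Real.exp_nat_mul]
  calc _ ≤ Real.exp (-(2 * ρ * (1 - ρ) * (1 - Real.cos t))) := by
        linarith [Real.add_one_le_exp (-(2 * ρ * (1 - ρ) * (1 - Real.cos t)))]
    _ ≤ _ := by
        refine Real.exp_le_exp.mpr ?_
        have := mul_le_mul_of_nonneg_left (show 2 / Real.pi ^ 2 * t ^ 2 ≤ 1 - Real.cos t by linarith)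
          hρ
        push_cast
        have e : 2 * -(2 * ρ * (1 - ρ) / Real.pi ^ 2 * t ^ 2) =
            -(2 * ρ * (1 - ρ) * (2 / Real.pi ^ 2 * t ^ 2)) := by ring
        rw [e]
        linarith

/-- The characteristic function of `Bernoulli(ρ) + thinning`. -/
def offspringChar (p : ℕ → ℝ) (ρ r t : ℝ) : ℂ :=
  (1 - ρ + ρ * Complex.exp (t * Complex.I)) *
    complexPGF p (1 - r + r * Complex.exp (t * Complex.I))

lemma norm_one_sub_add_mul_le {r : ℝ} (hr : r ∈ Icc (0 : ℝ) 1) {w : ℂ} (hw : ‖w‖ ≤ 1) :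
    ‖1 - (r : ℂ) + r * w‖ ≤ 1 := by
  have h1 : ‖1 - (r : ℂ)‖ = 1 - r := by
    rw [← Complex.ofReal_one, ← Complex.ofReal_sub, Complex.norm_real,
      Real.norm_of_nonneg (by linarith [hr.2])]
  have h2 : ‖(r : ℂ) * w‖ ≤ r := by
    rw [norm_mul, Complex.norm_real, Real.norm_of_nonneg hr.1]
    exact mul_le_of_le_one_right hr.1 hw
  linarith [norm_add_le (1 - (r : ℂ)) (r * w)]

lemma sumsTo_offspringChar {p : ℕ → ℝ} (hp : IsOutDegreeDistribution p) (ρ : ℝ) {r : ℝ}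
    (hr : r ∈ Icc (0 : ℝ) 1) (t : ℝ) :
    SumsTo (offspringSeries p ρ r) (Complex.exp (t * Complex.I)) (offspringChar p ρ r t) :=
  sumsTo_offspringSeries ρ hr.1 hr.2 (s := 1) (by simpa using hp.summable_abs)
    (norm_cexp_ofReal_mul_I' t).le

lemma norm_offspringChar_le {p : ℕ → ℝ} (hp : IsOutDegreeDistribution p) {ρ r t : ℝ}
    (hρ : ρ ∈ Icc (0 : ℝ) 1) (hr : r ∈ Icc (0 : ℝ) 1) (ht : |t| ≤ Real.pi) :
    ‖offspringChar p ρ r t‖ ≤ Real.exp (-(2 * ρ * (1 - ρ) / Real.pi ^ 2 * t ^ 2)) := by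
  rw [offspringChar, norm_mul]
  exact (mul_le_of_le_one_right (norm_nonneg _) (norm_complexPGF_le_one hp
    (norm_one_sub_add_mul_le hr (norm_cexp_ofReal_mul_I' t).le))).trans
    (norm_bernoulli_le hρ.1 hρ.2 ht)

section Gaussian

variable {p : ℕ → ℝ} (hp : IsOutDegreeDistribution p) (h2 : FiniteSecondMoment p)
  {ι : Type*} {l : Filter ι} {n : ι → ℕ} (hn : Tendsto n l atTop) {ρ r : ι → ℝ} {ρ₀ r₀ : ℝ}
  (hρ : Tendsto ρ l (𝓝 ρ₀)) (hr : Tendsto r l (𝓝 r₀)) (hr01 : ∀ᶠ i in l, r i ∈ Icc (0 : ℝ) 1)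
  (hm : ρ₀ + r₀ * meanDegree p = 1)
include hp h2 hn hρ hr hr01 hm

/-- Expansion to second order in `x = iu/√n`, with parameters that move with the index. Centring at
the exact mean `ρ + rz` removes the first order. When `ρ₀ + r₀z = 1`, the variance of the limiting
offspring law is `2ρ₀r₀z + r₀² f''(1)`. -/
lemma tendsto_mul_offspringChar_sub_one (u : ℝ) :
    Tendsto (fun i => (n i : ℂ) * (offspringChar p (ρ i) (r i) (u / √(n i)) *
      Complex.exp (-((ρ i + r i * meanDegree p : ℝ) * (u / √(n i) : ℝ) * Complex.I)) - 1)) l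
      (𝓝 (-((2 * ρ₀ * r₀ * meanDegree p + r₀ ^ 2 * secondFactorialMoment p : ℝ) / 2 * u ^ 2))) := by
  set z := meanDegree p with hz
  have hsqrt : Tendsto (fun i => √(n i : ℝ)) l atTop :=
    Real.tendsto_sqrt_atTop.comp (tendsto_natCast_atTop_atTop.comp hn)
  set x : ι → ℂ := fun i => (u / √(n i) : ℝ) * Complex.I with hx
  have hx0 : Tendsto x l (𝓝 0) := by
    have h1 : Tendsto (fun i => u / √(n i : ℝ)) l (𝓝 0) := hsqrt.const_div_atTop u
    have := ((Complex.continuous_ofReal.tendsto 0).comp h1).mul_const Complex.I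
    simpa [hx] using this
  have cast : ∀ {f : ι → ℝ} {a : ℝ}, Tendsto f l (𝓝 a) →
      Tendsto (fun i => (f i : ℂ)) l (𝓝 (a : ℂ)) := fun {f a} h =>
    (Complex.continuous_ofReal.tendsto a).comp h
  have hρ' := cast hρ
  have hr' := cast hr
  set m : ι → ℂ := fun i => ρ i + r i * z with hmdef
  have hm' : Tendsto m l (𝓝 1) := by
    have := hρ'.add (hr'.mul_const (z : ℂ))
    have e : (ρ₀ : ℂ) + r₀ * z = 1 := by exact_mod_cast hm
    rwa [e] at this
  set E : ι → ℂ := fun i => expRemainder (x i) with hE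
  have hE' : Tendsto E l (𝓝 (1 / 2)) := tendsto_expRemainder.comp hx0
  set E' : ι → ℂ := fun i => expRemainder (-(m i * x i)) with hEd
  have hEd' : Tendsto E' l (𝓝 (1 / 2)) := by
    refine tendsto_expRemainder.comp ?_
    have := (hm'.mul hx0).neg
    simpa using this
  set w : ι → ℂ := fun i => 1 - r i + r i * Complex.exp (x i) with hw
  have hw1 : Tendsto w l (𝓝 1) := by
    have h3 : Tendsto (fun i => Complex.exp (x i)) l (𝓝 1) := by
      have := (Complex.continuous_exp.tendsto 0).comp hx0
      simpa [Function.comp_def] using this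
    have := (hr'.const_sub 1).add (hr'.mul h3)
    simpa using this
  have hwn : ∀ᶠ i in l, w i ∈ Metric.closedBall (0 : ℂ) 1 := by
    filter_upwards [hr01] with i hi
    have := norm_one_sub_add_mul_le hi (norm_cexp_ofReal_mul_I' (u / √(n i))).le
    simpa [hw, hx] using this
  set R : ι → ℂ := fun i => pgfRemainder p (w i) with hR
  have hR' : Tendsto R l (𝓝 (secondFactorialMoment p / 2)) := by
    rw [← pgfRemainder_one]
    have := (continuousOn_pgfRemainder hp h2) 1 (by simp)
    exact this.tendsto.comp (tendsto_nhdsWithin_iff.mpr ⟨hw1, hwn⟩)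
  set D : ι → ℂ := fun i => 1 + x i * E i with hD
  have hD' : Tendsto D l (𝓝 1) := by
    have := (hx0.mul hE').const_add 1
    simpa using this
  set A : ι → ℂ := fun i => ρ i * D i with hA
  have hA' : Tendsto A l (𝓝 ρ₀) := by simpa using hρ'.mul hD'
  set B : ι → ℂ := fun i => r i * z * D i with hB
  have hB' : Tendsto B l (𝓝 (r₀ * z)) := by simpa using (hr'.mul_const (z : ℂ)).mul hD'
  set C : ι → ℂ := fun i => r i ^ 2 * D i ^ 2 * R i with hC
  have hC' : Tendsto C l (𝓝 (r₀ ^ 2 * (secondFactorialMoment p / 2))) := by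
    simpa using ((hr'.pow 2).mul (hD'.pow 2)).mul hR'
  set M : ι → ℂ := fun i => m i ^ 2 * E' i with hM
  have hM' : Tendsto M l (𝓝 (1 / 2)) := by simpa using (hm'.pow 2).mul hEd'
  have hAB := hA'.mul hB'
  have hApB := hA'.add hB'
  -- These are the coefficients, by powers of `x`, of `((1 + xA)(1 + xB + x²C)(1 - mx + x²M) - 1) /
  -- x²`. The term `(A + B - m) / x` appears as `mE`, by `hAm` below.
  have hQ' := ((((hm'.mul hE').add (((hC'.add hM').add hAB).sub (hm'.mul hApB))).add
    (hx0.mul (((hA'.mul hC').add (hApB.mul hM')).sub (hm'.mul (hAB.add hC'))))).add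
    ((hx0.pow 2).mul (((hAB.add hC').mul hM').sub (hm'.mul (hA'.mul hC'))))).add
    ((hx0.pow 3).mul ((hA'.mul hC').mul hM'))
  have hfin := hQ'.const_mul (-(u : ℂ) ^ 2)
  have hme : (ρ₀ : ℂ) + r₀ * z = 1 := by exact_mod_cast hm
  refine (hfin.congr' ?_).trans (le_of_eq ?_)
  · filter_upwards [hn.eventually_ge_atTop 1, hwn] with i hi hwi
    have hnx : (n i : ℂ) * x i ^ 2 = -(u : ℂ) ^ 2 := by
      have hn0 : (0 : ℝ) < n i := by exact_mod_cast hi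
      have h5 : ((√(n i : ℝ) : ℝ) : ℂ) ^ 2 = n i := by
        rw [← Complex.ofReal_pow, Real.sq_sqrt hn0.le]; simp
      have h6 : ((√(n i : ℝ) : ℝ) : ℂ) ≠ 0 := by
        exact_mod_cast (Real.sqrt_pos.mpr hn0).ne'
      simp only [hx]
      push_cast
      rw [mul_pow, div_pow, h5, Complex.I_sq]
      have : (n i : ℂ) ≠ 0 := by exact_mod_cast hn0.ne'
      field_simp
    have hd : Complex.exp (x i) = 1 + x i * D i := by
      rw [exp_eq_add_expRemainder]; simp only [hD, hE]; ring
    have he : Complex.exp (-((ρ i + r i * z : ℝ) * (u / √(n i) : ℝ) * Complex.I)) =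
        1 - m i * x i + x i ^ 2 * M i := by
      have : -(((ρ i + r i * z : ℝ) : ℂ) * (u / √(n i) : ℝ) * Complex.I) = -(m i * x i) := by
        simp only [hmdef, hx]; push_cast; ring
      rw [this, exp_eq_add_expRemainder]
      simp only [hM, hEd]
      ring
    have hF : complexPGF p (w i) = 1 + x i * B i + x i ^ 2 * C i := by
      rw [complexPGF_eq hp h2 (by simpa using hwi)]
      simp only [hw, hd, hB, hC, hR]
      ring
    have hχ : offspringChar p (ρ i) (r i) (u / √(n i)) =
        (1 + x i * A i) * (1 + x i * B i + x i ^ 2 * C i) := by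
      rw [offspringChar, ← hF]
      change (1 - (ρ i : ℂ) + ρ i * Complex.exp (x i)) * complexPGF p (w i) = _
      rw [hd]
      simp only [hA]
      ring
    have hAm : A i + B i - m i = m i * x i * E i := by
      simp only [hA, hB, hmdef, hD]; ring
    rw [hχ, he, ← hnx]
    linear_combination (-(n i : ℂ) * x i) * hAm
  · congr 1
    push_cast
    linear_combination (-(u : ℂ) ^ 2) * (-1 : ℂ) * hme

end Gaussian

lemma integral_gaussian_mul_cexp {s : ℝ} (hs : 0 < s) (θ : ℝ) :
    (2 * (Real.pi : ℂ))⁻¹ * ∫ u : ℝ, Complex.exp (-(s / 2 * u ^ 2)) *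
      Complex.exp (-(θ * u * Complex.I)) =
      (((√(2 * Real.pi * s))⁻¹ * Real.exp (-(θ ^ 2 / (2 * s))) : ℝ) : ℂ) := by
  have hb : 0 < ((s / 2 : ℝ) : ℂ).re := by simpa using hs
  have h := fourierIntegral_gaussian hb (-θ)
  have e1 : (fun u : ℝ => Complex.exp (-(s / 2 * u ^ 2)) * Complex.exp (-(θ * u * Complex.I))) =
      fun u : ℝ => Complex.exp (Complex.I * -θ * u) * Complex.exp (-((s / 2 : ℝ) : ℂ) * u ^ 2) := by
    ext u
    rw [mul_comm]
    congr 2 <;> push_cast <;> ring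
  rw [e1, h]
  have e2 : ((Real.pi : ℂ) / ((s / 2 : ℝ) : ℂ)) ^ (1 / 2 : ℂ) = ((√(2 * Real.pi / s) : ℝ) : ℂ) := by
    rw [Real.sqrt_eq_rpow, Complex.ofReal_cpow (by positivity)]
    congr 1
    · push_cast; field_simp
    · simp
  have e3 : -(-(θ : ℂ)) ^ 2 / (4 * ((s / 2 : ℝ) : ℂ)) = ((-(θ ^ 2 / (2 * s)) : ℝ) : ℂ) := by
    have : (s : ℂ) ≠ 0 := by exact_mod_cast hs.ne'
    push_cast
    field_simp
    ring
  rw [e2, e3, ← Complex.ofReal_exp, ← mul_assoc, Complex.ofReal_mul]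
  congr 1
  rw [← Complex.ofReal_ofNat, ← Complex.ofReal_mul, ← Complex.ofReal_inv, ← Complex.ofReal_mul]
  congr 1
  have hπ := Real.pi_pos
  rw [show 2 * Real.pi / s = (2 * Real.pi) ^ 2 / (2 * Real.pi * s) by field_simp,
    Real.sqrt_div (by positivity), Real.sqrt_sq (by positivity)]
  field_simp

/-- Local limit theorem for sums of `Bernoulli(ρ) + thinning` variables with finite variance,
uniformly in the parameters. -/
theorem tendsto_sqrt_mul_coeff {p : ℕ → ℝ} (hp : IsOutDegreeDistribution p)
    (h2 : FiniteSecondMoment p) {ι : Type*} {l : Filter ι} [l.IsCountablyGenerated] {n : ι → ℕ}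
    (hn : Tendsto n l atTop) {ρ r : ι → ℝ} {ρ₀ r₀ : ℝ} (hρ : Tendsto ρ l (𝓝 ρ₀))
    (hr : Tendsto r l (𝓝 r₀)) (hρ0 : 0 < ρ₀) (hρ1 : ρ₀ < 1) (hr0 : 0 < r₀)
    (hr01 : ∀ᶠ i in l, r i ∈ Icc (0 : ℝ) 1) (hm : ρ₀ + r₀ * meanDegree p = 1) {s : ℝ}
    (hs : s = 2 * ρ₀ * r₀ * meanDegree p + r₀ ^ 2 * secondFactorialMoment p) :
    Tendsto (fun i => √(n i : ℝ) * PowerSeries.coeff (n i - 1)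
        (offspringSeries p (ρ i) (r i) ^ n i) -
      (√(2 * Real.pi * s))⁻¹ *
        Real.exp (-(n i * (1 - (ρ i + r i * meanDegree p)) ^ 2 / (2 * s)))) l (𝓝 0) := by
  have hs0 : 0 < s := by
    have := hp.meanDegree_pos
    have := secondFactorialMoment_nonneg hp
    rw [hs]; positivity
  -- Half of the limiting constant in `norm_offspringChar_le`, so that one Gaussian eventually
  -- dominates for all nearby parameters.
  set c : ℝ := ρ₀ * (1 - ρ₀) / Real.pi ^ 2 with hc
  have hc0 : 0 < c := by
    have : 0 < 1 - ρ₀ := by linarith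
    have := Real.pi_pos
    positivity
  have hci : ∀ᶠ i in l, c ≤ 2 * ρ i * (1 - ρ i) / Real.pi ^ 2 := by
    have h3 : Tendsto (fun i => 2 * ρ i * (1 - ρ i) / Real.pi ^ 2) l
        (𝓝 (2 * ρ₀ * (1 - ρ₀) / Real.pi ^ 2)) :=
      ((hρ.const_mul 2).mul (hρ.const_sub 1)).div_const _
    refine (h3.eventually (lt_mem_nhds (a := c) ?_)).mono fun i hi => hi.le
    have : 2 * ρ₀ * (1 - ρ₀) / Real.pi ^ 2 = 2 * c := by rw [hc]; ring
    rw [this]; linarith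
  have hρ01 : ∀ᶠ i in l, ρ i ∈ Icc (0 : ℝ) 1 :=
    hρ.eventually (Icc_mem_nhds hρ0 hρ1)
  have hsqrt : Tendsto (fun i => √(n i : ℝ)) l atTop :=
    Real.tendsto_sqrt_atTop.comp (tendsto_natCast_atTop_atTop.comp hn)
  have hψ : Integrable fun u : ℝ => Complex.exp (-(s / 2 * u ^ 2)) := by
    have := integrable_cexp_neg_mul_sq (b := ((s / 2 : ℝ) : ℂ)) (by simpa using hs0)
    refine this.congr (ae_of_all _ fun u => ?_)
    simp only
    congr 1
    push_cast
    ring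
  have main := tendsto_scaled_coeff (P := fun i => offspringSeries p (ρ i) (r i))
    (χ := fun i => offspringChar p (ρ i) (r i)) (L := fun i => √(n i : ℝ))
    (m := fun i => ρ i + r i * meanDegree p) (ψ := fun u => Complex.exp (-(s / 2 * u ^ 2)))
    (g := fun u => Real.exp (-c * u ^ 2)) hn hsqrt
    (hr01.mono fun i hi t => sumsTo_offspringChar hp (ρ i) hi t)
    (integrable_exp_neg_mul_sq hc0) ?_ (fun u => (Real.exp_pos _).le) hψ ?_
  · have hre := (Complex.continuous_re.tendsto 0).comp main
    refine hre.congr' ?_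
    filter_upwards [hn.eventually_ge_atTop 1] with i hi
    have hn0 : (0 : ℝ) < n i := by exact_mod_cast hi
    rw [Function.comp_apply, integral_gaussian_mul_cexp hs0]
    rw [← Complex.ofReal_mul, ← Complex.ofReal_sub, Complex.ofReal_re, div_pow,
      Real.sq_sqrt hn0.le]
    congr 4
    field_simp
  · filter_upwards [hci, hρ01, hr01, hn.eventually_ge_atTop 1] with i h3 h4 h5 h6 u hu
    have hn0 : (0 : ℝ) < n i := by exact_mod_cast h6
    have hsq : 0 < √(n i : ℝ) := Real.sqrt_pos.mpr hn0
    have ht : |u / √(n i : ℝ)| ≤ Real.pi := by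
      rw [abs_div, abs_of_pos hsq, div_le_iff₀ hsq]; exact hu
    calc _ ≤ Real.exp (-(2 * ρ i * (1 - ρ i) / Real.pi ^ 2 * (u / √(n i : ℝ)) ^ 2)) ^ n i :=
          pow_le_pow_left₀ (norm_nonneg _) (norm_offspringChar_le hp h4 h5 ht) _
      _ = Real.exp (-(2 * ρ i * (1 - ρ i) / Real.pi ^ 2 * u ^ 2)) := by
          rw [← Real.exp_nat_mul, div_pow, Real.sq_sqrt hn0.le]
          congr 1
          field_simp
      _ ≤ _ := by
          refine Real.exp_le_exp.mpr ?_
          nlinarith [mul_le_mul_of_nonneg_right h3 (sq_nonneg u)]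
  · intro u
    have h3 := tendsto_one_add_pow_exp_filter hn
      (tendsto_mul_offspringChar_sub_one hp h2 hn hρ hr hr01 hm u)
    rw [← hs] at h3
    simpa using h3

/-! ### Finite second moment: critical and near-critical asymptotics. -/

section FiniteVariance

variable {p : ℕ → ℝ} (hp : IsOutDegreeDistribution p) {lam : ℝ} (h0 : 0 < lam) (h1 : lam ≤ 1)
include hp h0

lemma second_combination_pos : 0 < lam * secondFactorialMoment p + 2 * meanDegree p := by
  have := hp.meanDegree_pos
  have := secondFactorialMoment_nonneg hp
  positivity

lemma prefactorA_pos : 0 < prefactorA p lam := by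
  have := second_combination_pos hp h0
  have := lam_mul_mean_pos hp h0
  have := Real.pi_pos
  unfold prefactorA
  positivity

/-- Here `s = λ(λf''(1) + 2z) / (λz + 1)²` is the offspring variance at `μ = 0`, and `A` is the
Gaussian density `1 / √(2πs)` at the mean. -/
lemma prefactorA_eq : prefactorA p lam = (√(2 * Real.pi * (lam *
    (lam * secondFactorialMoment p + 2 * meanDegree p) / (lam * meanDegree p + 1) ^ 2)))⁻¹ := by
  have h3 := second_combination_pos hp h0
  have h4 := lam_mul_mean_pos hp h0
  have h5 := Real.pi_pos
  rw [prefactorA, Real.rpow_neg (by positivity), ← Real.sqrt_eq_rpow]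
  rw [show 2 * Real.pi * (lam * (lam * secondFactorialMoment p + 2 * meanDegree p) /
    (lam * meanDegree p + 1) ^ 2) = 2 * Real.pi * lam * (lam * secondFactorialMoment p +
      2 * meanDegree p) / (lam * meanDegree p + 1) ^ 2 by ring,
    Real.sqrt_div (by positivity), Real.sqrt_sq (by positivity), inv_div, div_eq_mul_inv]

/-- For `x = n` this is `(nμ)² / (2ns)`, the Gaussian exponent at distance `nμ` from the mean: the
origin of the cutoff `κ`. -/
lemma div_cutoff (x μ : ℝ) : x / cutoff p lam μ = x * μ ^ 2 / (2 * (lam *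
    (lam * secondFactorialMoment p + 2 * meanDegree p) / (lam * meanDegree p + 1) ^ 2)) := by
  have h3 := second_combination_pos hp h0
  have h4 := lam_mul_mean_pos hp h0
  by_cases hμ : μ = 0
  · simp [hμ, cutoff]
  · rw [cutoff]
    field_simp

include h1

lemma tendsto_rpow_mul_progeny (h2 : FiniteSecondMoment p) {ι : Type*} {l : Filter ι}
    [l.IsCountablyGenerated] {n : ι → ℕ} (hn : Tendsto n l atTop) {μ : ι → ℝ}
    (hμ : Tendsto μ l (𝓝 0)) (hμ0 : ∀ᶠ i in l, 0 ≤ μ i) :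
    Tendsto (fun i => progeny p lam (μ i) (n i) * (n i : ℝ) ^ (3 / 2 : ℝ) -
      prefactorA p lam * Real.exp (-(n i / cutoff p lam (μ i)))) l (𝓝 0) := by
  have h4 := lam_mul_mean_pos hp h0
  have hρ : Tendsto (fun i => reshareProb p lam (μ i)) l (𝓝 (reshareProb p lam 0)) :=
    (hμ.const_sub 1).div_const _
  have hmem : ∀ᶠ i in l, lam * reshareProb p lam (μ i) ∈ Icc (0 : ℝ) 1 := by
    filter_upwards [hμ0, hμ.eventually (gt_mem_nhds zero_lt_one)] with i h5 h6
    exact Ioo_subset_Icc_self (lam_mul_reshareProb_mem hp h0 h1 h5 h6)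
  have hρ0 := reshareProb_pos hp h0 (μ := 0) zero_lt_one
  have key := tendsto_sqrt_mul_coeff hp h2 hn hρ (hρ.const_mul lam) hρ0
    (reshareProb_lt_one hp h0 le_rfl) (mul_pos h0 hρ0) hmem
    (by have := mul_reshareProb hp h0 (μ := 0); linear_combination this) (s := lam *
    (lam * secondFactorialMoment p + 2 * meanDegree p) / (lam * meanDegree p + 1) ^ 2)
    (by rw [reshareProb]; field_simp; ring)
  refine key.congr' ?_
  filter_upwards [hn.eventually_ge_atTop 1] with i hi
  rw [div_cutoff hp h0, prefactorA_eq hp h0]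
  have e : reshareProb p lam (μ i) + lam * reshareProb p lam (μ i) * meanDegree p = 1 - μ i := by
    have := mul_reshareProb hp h0 (μ := μ i); linear_combination this
  rw [e, sub_sub_cancel, ← childSeries, ← mul_progeny p lam (μ i) hi]
  have hn0 : (0 : ℝ) < n i := by exact_mod_cast hi
  rw [show (3 / 2 : ℝ) = 1 / 2 + 1 by norm_num, Real.rpow_add hn0, Real.rpow_one,
    ← Real.sqrt_eq_rpow]
  ring

theorem progeny_isEquivalent_of_finiteSecondMoment (h2 : FiniteSecondMoment p) :
    progeny p lam 0 ~[atTop] fun n : ℕ => prefactorA p lam * (n : ℝ) ^ (-(3 / 2) : ℝ) := by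
  have hA := prefactorA_pos hp h0
  have h3 := tendsto_rpow_mul_progeny hp h0 h1 h2 (l := atTop) (n := id) (μ := fun _ => 0)
    tendsto_id tendsto_const_nhds (Eventually.of_forall fun _ => le_rfl)
  refine isEquivalent_of_tendsto_one ?_
  have h4 := (h3.add_const (prefactorA p lam)).div_const (prefactorA p lam)
  rw [zero_add, div_self hA.ne'] at h4
  refine h4.congr' ?_
  filter_upwards [eventually_ge_atTop 1] with n hn
  have hn0 : (0 : ℝ) < n := by exact_mod_cast hn
  have e : (n : ℝ) ^ (-(3 / 2) : ℝ) = ((n : ℝ) ^ (3 / 2 : ℝ))⁻¹ := Real.rpow_neg hn0.le _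
  have : (n : ℝ) ^ (3 / 2 : ℝ) ≠ 0 := (Real.rpow_pos_of_pos hn0 _).ne'
  simp only [div_cutoff hp h0, Pi.div_apply, e, id]
  norm_num
  field_simp

theorem exists_abs_progeny_sub_le (h2 : FiniteSecondMoment p) {ε : ℝ} (hε : 0 < ε) :
    ∃ δ : ℝ, 0 < δ ∧ δ ≤ 1 ∧ ∃ N : ℕ, 1 ≤ N ∧ ∀ μ : ℝ, 0 < μ → μ < δ → ∀ n : ℕ, N ≤ n →
      |progeny p lam μ n * (n : ℝ) ^ (3 / 2 : ℝ) -
        prefactorA p lam * Real.exp (-((n : ℝ) / cutoff p lam μ))| ≤ ε := by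
  have h3 := tendsto_rpow_mul_progeny hp h0 h1 h2 (l := atTop ×ˢ 𝓝[>] (0 : ℝ))
    (n := fun i => i.1) (μ := fun i => i.2) tendsto_fst
    (tendsto_snd.mono_right nhdsWithin_le_nhds)
    ((tendsto_snd.eventually (self_mem_nhdsWithin (a := (0 : ℝ)) (s := Ioi 0))).mono
      fun i hi => le_of_lt hi)
  have h4 := h3.eventually (Metric.ball_mem_nhds 0 hε)
  rw [eventually_prod_iff] at h4
  obtain ⟨pa, hpa, pb, hpb, hab⟩ := h4
  obtain ⟨N, hN⟩ := eventually_atTop.mp hpa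
  obtain ⟨δ, hδ, hδ'⟩ := mem_nhdsGT_iff_exists_Ioo_subset.mp hpb
  refine ⟨min δ 1, lt_min hδ one_pos, min_le_right _ _, max N 1, le_max_right _ _,
    fun μ hμ hμδ n hn => ?_⟩
  have := hab (hN n (le_of_max_le_left hn)) (hδ' ⟨hμ, hμδ.trans_le (min_le_left _ _)⟩)
  rw [Real.dist_eq, sub_zero] at this
  exact this.le

/-- For `n ≤ Kκ` the main term is at least `A e^{-K}`, so a small absolute error is a small relative
one. -/
theorem exists_abs_progeny_div_sub_one_le (h2 : FiniteSecondMoment p) (K : ℝ) {ε : ℝ}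
    (hε : 0 < ε) :
    ∃ δ : ℝ, 0 < δ ∧ δ ≤ 1 ∧ ∃ N : ℕ, ∀ μ : ℝ, 0 < μ → μ < δ → ∀ n : ℕ, N ≤ n →
      (n : ℝ) ≤ K * cutoff p lam μ →
      |progeny p lam μ n / (prefactorA p lam * (n : ℝ) ^ (-(3 / 2) : ℝ) *
        Real.exp (-((n : ℝ) / cutoff p lam μ))) - 1| ≤ ε := by
  have hA := prefactorA_pos hp h0
  obtain ⟨δ, hδ, hδ1, N, hN1, hN⟩ := exists_abs_progeny_sub_le hp h0 h1 h2
    (show 0 < ε * (prefactorA p lam * Real.exp (-K)) by positivity)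
  refine ⟨δ, hδ, hδ1, N, fun μ hμ hμδ n hn hnK => ?_⟩
  have hb := hN μ hμ hμδ n hn
  have hn0 : (0 : ℝ) < n := by exact_mod_cast hN1.trans hn
  have hcut : 0 < cutoff p lam μ := by
    have := second_combination_pos hp h0
    have := lam_mul_mean_pos hp h0
    unfold cutoff
    positivity
  have hK : (n : ℝ) / cutoff p lam μ ≤ K := by rwa [div_le_iff₀ hcut]
  set T := prefactorA p lam * Real.exp (-((n : ℝ) / cutoff p lam μ)) with hT
  have hT0 : 0 < T := by positivity
  have hTK : prefactorA p lam * Real.exp (-K) ≤ T :=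
    mul_le_mul_of_nonneg_left (Real.exp_le_exp.mpr (by linarith)) hA.le
  have hpow : (0 : ℝ) < (n : ℝ) ^ (3 / 2 : ℝ) := Real.rpow_pos_of_pos hn0 _
  have e : progeny p lam μ n / (prefactorA p lam * (n : ℝ) ^ (-(3 / 2) : ℝ) *
      Real.exp (-((n : ℝ) / cutoff p lam μ))) - 1 =
      (progeny p lam μ n * (n : ℝ) ^ (3 / 2 : ℝ) - T) / T := by
    rw [Real.rpow_neg hn0.le, sub_div, div_self hT0.ne']
    congr 1
    rw [hT]
    have := (Real.exp_pos (-((n : ℝ) / cutoff p lam μ))).ne'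
    field_simp
  rw [e, abs_div, abs_of_pos hT0, div_le_iff₀ hT0]
  exact hb.trans (mul_le_mul_of_nonneg_left hTK hε.le)

end FiniteVariance

/-! ### Exponential tilting: analytic `f` at a fixed innovation rate. -/

/-- The coefficients of the derivative of the generating function of `p`. -/
def derivSeq (p : ℕ → ℝ) (k : ℕ) : ℝ := (k + 1) * p (k + 1)

lemma derivSeq_nonneg {p : ℕ → ℝ} (hp : ∀ k, 0 ≤ p k) (k : ℕ) : 0 ≤ derivSeq p k :=
  mul_nonneg (by positivity) (hp _)

lemma summable_derivSeq {p : ℕ → ℝ} (hp : ∀ k, 0 ≤ p k) {R R' : ℝ} (hR' : 0 ≤ R') (hR : R' < R)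
    (hs : Summable fun k => p k * R ^ k) : Summable fun k => derivSeq p k * R' ^ k := by
  have hR0 : 0 < R := hR'.trans_lt hR
  have hq0 : 0 ≤ R' / R := by positivity
  have hq1 : R' / R < 1 := (div_lt_one hR0).mpr hR
  have hlim : Tendsto (fun k : ℕ => ((k : ℝ) + 1) * (R' / R) ^ k) atTop (𝓝 0) := by
    have := (tendsto_self_mul_const_pow_of_lt_one hq0 hq1).add
      (tendsto_pow_atTop_nhds_zero_of_lt_one hq0 hq1)
    rw [add_zero] at this
    exact this.congr fun k => by ring
  obtain ⟨C, hC⟩ := hlim.bddAbove_range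
  have hs' := ((summable_nat_add_iff 1).mpr hs).mul_right (C / R)
  refine hs'.of_nonneg_of_le (fun k => mul_nonneg (derivSeq_nonneg hp k) (pow_nonneg hR' k))
    fun k => ?_
  have e : derivSeq p k * R' ^ k =
      p (k + 1) * R ^ (k + 1) * (((k : ℝ) + 1) * (R' / R) ^ k / R) := by
    rw [derivSeq, div_pow, pow_succ]; field_simp
  rw [e]
  refine mul_le_mul_of_nonneg_left ?_ (mul_nonneg (hp _) (by positivity))
  exact div_le_div_of_nonneg_right (hC ⟨k, rfl⟩) hR0.le

lemma tsum_mul_pow_sub_one (p : ℕ → ℝ) (x : ℝ) :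
    ∑' k : ℕ, p k * (k * x ^ (k - 1)) = degreePGF (derivSeq p) x := by
  have h : Function.support (fun k : ℕ => p k * (k * x ^ (k - 1))) ⊆ Set.range Nat.succ := by
    intro k hk
    cases k with
    | zero => simp at hk
    | succ k => exact ⟨k, rfl⟩
  rw [degreePGF, ← Function.Injective.tsum_eq Nat.succ_injective h]
  refine tsum_congr fun k => ?_
  simp only [derivSeq, Nat.succ_eq_add_one, Nat.add_sub_cancel]
  push_cast
  ring

lemma hasDerivAt_degreePGF {p : ℕ → ℝ} (hp : ∀ k, 0 ≤ p k) {R x : ℝ}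
    (hs : Summable fun k => p k * R ^ k) (hx : |x| < R) :
    HasDerivAt (degreePGF p) (degreePGF (derivSeq p) x) x := by
  obtain ⟨R', hxR, hR⟩ := exists_between hx
  have hR'0 : 0 < R' := (abs_nonneg x).trans_lt hxR
  have hd := summable_derivSeq hp hR'0.le hR hs
  have hu : Summable fun k : ℕ => p k * (k * R' ^ (k - 1)) := by
    rw [← summable_nat_add_iff 1]
    refine hd.congr fun k => ?_
    simp only [derivSeq, Nat.add_sub_cancel]
    push_cast
    ring
  rw [← tsum_mul_pow_sub_one]
  have h0 : (0 : ℝ) ∈ Ioo (-R') R' := ⟨by linarith, hR'0⟩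
  refine hasDerivAt_tsum_of_isPreconnected (t := Ioo (-R') R') hu isOpen_Ioo isPreconnected_Ioo
    (fun k y _ => (hasDerivAt_pow k y).const_mul (p k)) (fun k y hy => ?_) h0 ?_
    ⟨(abs_lt.mp hxR).1, (abs_lt.mp hxR).2⟩
  · rw [Real.norm_eq_abs, abs_mul, abs_mul, abs_pow, abs_of_nonneg (hp k), Nat.abs_cast]
    have : |y| ≤ R' := (abs_lt.mpr hy).le
    gcongr
    exact hp k
  · refine summable_of_ne_finset_zero (s := {0}) fun k hk => ?_
    rw [zero_pow (by simpa using hk), mul_zero]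

/-- The exponentially tilted law with parameter `y`. -/
def tilt (p : ℕ → ℝ) (y : ℝ) (k : ℕ) : ℝ := p k * y ^ k / degreePGF p y

section Tilt

variable {p : ℕ → ℝ} {y : ℝ}

lemma meanDegree_tilt :
    meanDegree (tilt p y) = y * degreePGF (derivSeq p) y / degreePGF p y := by
  rw [← tsum_mul_pow_sub_one, ← tsum_mul_left, ← tsum_div_const, meanDegree]
  refine tsum_congr fun k => ?_
  cases k with
  | zero => simp
  | succ k => simp only [tilt, Nat.add_sub_cancel, pow_succ]; ring

lemma mul_pow_eq_derivSeq_derivSeq (p : ℕ → ℝ) (y : ℝ) :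
    degreePGF (derivSeq (derivSeq p)) y * y ^ 2 =
      ∑' k : ℕ, (k : ℝ) * ((k : ℝ) - 1) * (p k * y ^ k) := by
  have h : Function.support (fun k : ℕ => (k : ℝ) * ((k : ℝ) - 1) * (p k * y ^ k)) ⊆
      Set.range fun k => k + 2 := by
    intro k hk
    rcases k with _ | _ | k
    · simp at hk
    · simp at hk
    · exact ⟨k, rfl⟩
  rw [degreePGF, ← tsum_mul_right, ← Function.Injective.tsum_eq (add_left_injective 2) h]
  refine tsum_congr fun k => ?_
  simp only [derivSeq]
  push_cast
  ring

lemma secondFactorialMoment_tilt : secondFactorialMoment (tilt p y) =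
    y ^ 2 * degreePGF (derivSeq (derivSeq p)) y / degreePGF p y := by
  rw [mul_comm, mul_pow_eq_derivSeq_derivSeq p y, secondFactorialMoment, ← tsum_div_const]
  exact tsum_congr fun k => by rw [tilt]; ring

lemma meanDegree_eq_degreePGF (p : ℕ → ℝ) : meanDegree p = degreePGF (derivSeq p) 1 := by
  rw [← tsum_mul_pow_sub_one, meanDegree]
  exact tsum_congr fun k => by ring

lemma secondFactorialMoment_eq_degreePGF (p : ℕ → ℝ) :
    secondFactorialMoment p = degreePGF (derivSeq (derivSeq p)) 1 := by
  have := mul_pow_eq_derivSeq_derivSeq p 1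
  simp only [one_pow, mul_one] at this
  rw [this, secondFactorialMoment]

lemma degreePGF_pos (hp : IsOutDegreeDistribution p) {R : ℝ} (hs : Summable fun k => p k * R ^ k)
    (hy0 : 0 < y) (hyR : y ≤ R) : 0 < degreePGF p y := by
  have hsum : Summable fun k => p k * y ^ k :=
    hs.of_nonneg_of_le (fun k => mul_nonneg (hp.nonneg k) (by positivity))
      fun k => mul_le_mul_of_nonneg_left (pow_le_pow_left₀ hy0.le hyR k) (hp.nonneg k)
  obtain ⟨k, hk⟩ : ∃ k, 0 < p k := by
    by_contra! h
    have h0 : p = 0 := funext fun k => le_antisymm (h k) (hp.nonneg k)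
    have := hp.hasSum_one
    rw [h0] at this
    exact zero_ne_one (hasSum_zero.unique this)
  exact hsum.tsum_pos (fun k => mul_nonneg (hp.nonneg k) (by positivity)) k (by positivity)

lemma summable_mul_of_derivSeq {u : ℕ → ℝ}
    (hs : Summable fun k => derivSeq p k * y ^ k) (hu : ∀ k, u (k + 1) = derivSeq p k * y ^ k * y) :
    Summable u := by
  rw [← summable_nat_add_iff 1]
  exact (hs.mul_right y).congr fun k => (hu k).symm

lemma isOutDegreeDistribution_tilt (hp : IsOutDegreeDistribution p) {R : ℝ}
    (hs : Summable fun k => p k * R ^ k) (hy0 : 0 < y) (hyR : y < R) :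
    IsOutDegreeDistribution (tilt p y) := by
  have hf := degreePGF_pos hp hs hy0 hyR.le
  have hsum : Summable fun k => p k * y ^ k :=
    hs.of_nonneg_of_le (fun k => mul_nonneg (hp.nonneg k) (by positivity))
      fun k => mul_le_mul_of_nonneg_left (pow_le_pow_left₀ hy0.le hyR.le k) (hp.nonneg k)
  have hd := summable_derivSeq hp.nonneg hy0.le hyR hs
  have hnn : ∀ k, 0 ≤ tilt p y k := fun k =>
    div_nonneg (mul_nonneg (hp.nonneg k) (by positivity)) hf.le
  have hmean : Summable fun k : ℕ => (k : ℝ) * tilt p y k := by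
    have : Summable fun k : ℕ => (k : ℝ) * (p k * y ^ k) :=
      summable_mul_of_derivSeq hd fun k => by rw [derivSeq]; push_cast; ring
    refine (this.div_const (degreePGF p y)).congr fun k => ?_
    rw [tilt]; ring
  refine ⟨hnn, ?_, hmean, ?_⟩
  · have := hsum.hasSum.div_const (degreePGF p y)
    rwa [← degreePGF, div_self hf.ne'] at this
  · obtain ⟨k, hk⟩ : ∃ k : ℕ, 0 < (k : ℝ) * p k := by
      by_contra! h
      have h0 : (fun k : ℕ => (k : ℝ) * p k) = 0 :=
        funext fun k => le_antisymm (h k) (mul_nonneg (by positivity) (hp.nonneg k))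
      have := hp.mean_pos
      rw [tsum_congr fun k => congrFun h0 k] at this
      simp at this
    refine hmean.tsum_pos (fun k => mul_nonneg (by positivity) (hnn k)) k ?_
    rw [tilt, ← mul_div_assoc, ← mul_assoc]
    positivity

lemma finiteSecondMoment_tilt (hp : IsOutDegreeDistribution p) {R : ℝ}
    (hs : Summable fun k => p k * R ^ k) (hy0 : 0 < y) (hyR : y < R) :
    FiniteSecondMoment (tilt p y) := by
  obtain ⟨R', hy', hR'⟩ := exists_between hyR
  have hd := summable_derivSeq hp.nonneg (hy0.trans hy').le hR' hs
  have hdd := summable_derivSeq (derivSeq_nonneg hp.nonneg) hy0.le hy' hd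
  have h1 : Summable fun k : ℕ => (k : ℝ) * (derivSeq p k * y ^ k) :=
    summable_mul_of_derivSeq hdd fun k => by simp only [derivSeq]; push_cast; ring
  have h2 : Summable fun k : ℕ => (k : ℝ) * ((k : ℝ) - 1) * (p k * y ^ k) := by
    rw [← summable_nat_add_iff 1]
    refine (h1.mul_right y).congr fun k => ?_
    rw [derivSeq]; push_cast; ring
  refine (h2.div_const (degreePGF p y)).congr fun k => ?_
  rw [tilt]; ring

/-- In generating functions: `f(1 - r + rsw) = f(y(1 - r' + r'w))` with `r' = rs/y`, so a tilt of
the thinned law is a thinning of the tilted law. -/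
lemma thinning_tilt {r s : ℝ} (hy : y ≠ 0) (h : 1 - r + r * s = y) (k : ℕ) :
    thinning (tilt p y) (r * s / y) k = s ^ k * thinning p r k / degreePGF p y := by
  rw [thinning, thinning, ← tsum_mul_left, ← tsum_div_const]
  refine tsum_congr fun j => ?_
  rcases lt_or_ge j k with hjk | hjk
  · simp [Nat.choose_eq_zero_of_lt hjk]
  · obtain ⟨i, rfl⟩ := Nat.exists_eq_add_of_le hjk
    have e : 1 - r * s / y = (1 - r) / y := by field_simp; linarith
    rw [e, Nat.add_sub_cancel_left, tilt, div_pow, div_pow, mul_pow, pow_add]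
    field_simp

/-- Tilting preserves the family Bernoulli plus thinning, so the Gaussian local limit theorem covers
the tilted offspring law as well. -/
lemma rescale_offspringSeries {ρ r s : ℝ} (hy : y ≠ 0) (h : 1 - r + r * s = y)
    {G : ℝ} (hG : G ≠ 0) (hf : degreePGF p y ≠ 0) (hρ : 1 - ρ + ρ * s = G) :
    PowerSeries.rescale s (offspringSeries p ρ r) = PowerSeries.C (G * degreePGF p y) *
      offspringSeries (tilt p y) (ρ * s / G) (r * s / y) := by
  have e : 1 - ρ * s / G = (1 - ρ) / G := by field_simp; linarith
  ext k
  rw [PowerSeries.coeff_rescale, PowerSeries.coeff_C_mul]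
  cases k with
  | zero =>
    rw [coeff_offspringSeries_zero, coeff_offspringSeries_zero, thinning_tilt hy h, e]
    field_simp
  | succ k =>
    rw [coeff_offspringSeries_succ, coeff_offspringSeries_succ, thinning_tilt hy h,
      thinning_tilt hy h, e, pow_succ]
    field_simp

end Tilt

/-- `g(v) = (1 + v) f(1 + λv)`, the offspring generating function in the variable `G = 1 + v`. -/
def shiftedPGF (p : ℕ → ℝ) (lam v : ℝ) : ℝ := (1 + v) * degreePGF p (1 + lam * v)

/-- The first derivative of `shiftedPGF`. -/
def shiftedPGF₁ (p : ℕ → ℝ) (lam v : ℝ) : ℝ :=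
  degreePGF p (1 + lam * v) + lam * (1 + v) * degreePGF (derivSeq p) (1 + lam * v)

/-- The second derivative of `shiftedPGF`. -/
def shiftedPGF₂ (p : ℕ → ℝ) (lam v : ℝ) : ℝ :=
  2 * lam * degreePGF (derivSeq p) (1 + lam * v) +
    lam ^ 2 * (1 + v) * degreePGF (derivSeq (derivSeq p)) (1 + lam * v)

section Analytic

variable {p : ℕ → ℝ} (hp : IsOutDegreeDistribution p) {lam : ℝ} (h0 : 0 < lam) (h1 : lam ≤ 1)
  {R : ℝ} (hs : Summable fun k => p k * R ^ k)
include hp hs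

lemma degreePGF_derivSeq_pos {y : ℝ} (hy0 : 0 < y) (hyR : y < R) :
    0 < degreePGF (derivSeq p) y := by
  have h3 := (isOutDegreeDistribution_tilt hp hs hy0 hyR).meanDegree_pos
  have hf := degreePGF_pos hp hs hy0 hyR.le
  rw [meanDegree_tilt, lt_div_iff₀ hf, zero_mul] at h3
  exact pos_of_mul_pos_right h3 hy0.le

omit hs in
lemma degreePGF_derivSeq_derivSeq_nonneg {y : ℝ} (hy0 : 0 ≤ y) :
    0 ≤ degreePGF (derivSeq (derivSeq p)) y :=
  tsum_nonneg fun k => mul_nonneg (derivSeq_nonneg (derivSeq_nonneg hp.nonneg) k) (by positivity)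

include h0 h1

/-- Asymptotics at a fixed innovation rate, from the exponential tilt that makes the offspring law
critical. -/
lemma progeny_isEquivalent_of_tilt {μ v : ℝ} (hμ0 : 0 ≤ μ) (hμ : μ < 1) (hv0 : 0 ≤ v)
    (hvR : 1 + lam * v < R)
    (hcrit : reshareProb p lam μ + v = shiftedPGF p lam v / shiftedPGF₁ p lam v) :
    progeny p lam μ ~[atTop] fun n : ℕ => (1 + v / reshareProb p lam μ) *
      (√(2 * Real.pi * (shiftedPGF p lam v * shiftedPGF₂ p lam v / shiftedPGF₁ p lam v ^ 2)))⁻¹ *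
      (n : ℝ) ^ (-(3 / 2) : ℝ) *
      Real.exp (-((n : ℝ) / (-Real.log (shiftedPGF p lam v - v * shiftedPGF₁ p lam v))⁻¹)) := by
  set ρ := reshareProb p lam μ with hρ
  have hρ0 : 0 < ρ := reshareProb_pos hp h0 hμ
  have hρ1 : ρ < 1 := reshareProb_lt_one hp h0 hμ0
  have hr := lam_mul_reshareProb_mem hp h0 h1 hμ0 hμ
  rw [← hρ] at hr
  set y := 1 + lam * v with hy
  have hy0 : 0 < y := by positivity
  -- The tilt point, at which `1 - ρ + ρs = 1 + v`. As `Φ(w) = g(ρ(w - 1))`, the hypothesis `hcrit`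
  -- is the saddle-point equation `s Φ'(s) = Φ(s)`: the tilted offspring law has mean one.
  set s := 1 + v / ρ with hsd
  have hs0 : 0 < s := by positivity
  have hf := degreePGF_pos hp hs hy0 hvR.le
  have hf1 := degreePGF_derivSeq_pos hp hs hy0 hvR
  have hf2 := degreePGF_derivSeq_derivSeq_nonneg hp hy0.le
  set f := degreePGF p y with hfd
  set f1 := degreePGF (derivSeq p) y with hf1d
  set f2 := degreePGF (derivSeq (derivSeq p)) y with hf2d
  set g := shiftedPGF p lam v with hg
  set g1 := shiftedPGF₁ p lam v with hg1
  set g2 := shiftedPGF₂ p lam v with hg2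
  have hge : g = (1 + v) * f := rfl
  have hg1e : g1 = f + lam * (1 + v) * f1 := rfl
  have hg2e : g2 = 2 * lam * f1 + lam ^ 2 * (1 + v) * f2 := rfl
  have hg0 : 0 < g := by rw [hge]; positivity
  have hg10 : 0 < g1 := by rw [hg1e]; positivity
  have hg20 : 0 < g2 := by rw [hg2e]; positivity
  have hG0 : 0 < 1 + v := by positivity
  have hρs : ρ * s = g / g1 := by rw [← hcrit, hsd]; field_simp
  have hG : 1 - ρ + ρ * s = 1 + v := by rw [hρs, ← hcrit]; ring
  have hys : 1 - lam * ρ + lam * ρ * s = y := by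
    rw [mul_assoc lam ρ s, hρs, ← hcrit, hy]; ring
  -- This is `Φ(s) / s`, the base of the exponential decay.
  have hk : g - v * g1 = ρ * g1 := by
    have : (ρ + v) * g1 = g := by rw [hcrit]; field_simp
    linarith
  have hgs : g = s * (ρ * g1) := by
    have : ρ * s * g1 = g := by rw [hρs]; field_simp
    linarith
  have hpt := isOutDegreeDistribution_tilt hp hs hy0 hvR
  have h2t := finiteSecondMoment_tilt hp hs hy0 hvR
  have hrt0 : 0 < lam * ρ * s / y := by positivity
  have hrt1 : lam * ρ * s / y ≤ 1 := by
    rw [div_le_one hy0]; linarith [hr.2]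
  have hρt1 : ρ * s / (1 + v) < 1 := by
    rw [div_lt_one hG0]; linarith
  have hmt : meanDegree (tilt p y) = y * f1 / f := meanDegree_tilt
  have h2e : secondFactorialMoment (tilt p y) = y ^ 2 * f2 / f := secondFactorialMoment_tilt
  have hmean : ρ * s / (1 + v) + lam * ρ * s / y * meanDegree (tilt p y) = 1 := by
    rw [hmt, mul_assoc lam ρ s, hρs, hge]
    field_simp
    linarith
  have hvar : g * g2 / g1 ^ 2 = 2 * (ρ * s / (1 + v)) * (lam * ρ * s / y) *
      meanDegree (tilt p y) + (lam * ρ * s / y) ^ 2 * secondFactorialMoment (tilt p y) := by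
    rw [hmt, h2e, mul_assoc lam ρ s, hρs, hge, hg2e]
    field_simp
  have key := tendsto_sqrt_mul_coeff hpt h2t (l := atTop) (n := id) tendsto_id
    (ρ := fun _ => ρ * s / (1 + v)) (r := fun _ => lam * ρ * s / y) tendsto_const_nhds
    tendsto_const_nhds (by positivity) hρt1 hrt0
    (Eventually.of_forall fun _ => ⟨hrt0.le, hrt1⟩) hmean hvar
  set σ := √(2 * Real.pi * (g * g2 / g1 ^ 2)) with hσ
  have hσ0 : 0 < σ := Real.sqrt_pos.mpr (by have := Real.pi_pos; positivity)
  simp only [hmean, sub_self, id] at key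
  refine isEquivalent_of_tendsto_one ?_
  have h4 := (key.add_const σ⁻¹).mul_const σ
  rw [zero_add, inv_mul_cancel₀ hσ0.ne'] at h4
  refine h4.congr' ?_
  filter_upwards [eventually_ge_atTop 1] with n hn
  have hn0 : (0 : ℝ) < n := by exact_mod_cast hn
  -- Only `n - 1` factors `s` stand against `n` factors `Φ(s)`; the missing one becomes the factor
  -- `1 + v/ρ` of the prefactor.
  have hcoef : s ^ (n - 1) * PowerSeries.coeff (n - 1) (childSeries p lam μ ^ n) =
      g ^ n * PowerSeries.coeff (n - 1) (offspringSeries (tilt p y) (ρ * s / (1 + v))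
        (lam * ρ * s / y) ^ n) := by
    rw [← PowerSeries.coeff_rescale, map_pow, childSeries, ← hρ,
      rescale_offspringSeries hy0.ne' hys hG0.ne' hf.ne' hG, mul_pow, ← map_pow,
      PowerSeries.coeff_C_mul]
    rfl
  set c := PowerSeries.coeff (n - 1) (offspringSeries (tilt p y) (ρ * s / (1 + v))
        (lam * ρ * s / y) ^ n) with hc
  have hprog : progeny p lam μ n = (n : ℝ)⁻¹ * (s * (ρ * g1) ^ n * c) := by
    rw [← mul_progeny p lam μ hn, hgs, mul_pow] at hcoef
    have hsn : s ^ n = s ^ (n - 1) * s := by rw [← pow_succ]; congr 1; omega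
    rw [hsn] at hcoef
    have hne : s ^ (n - 1) ≠ 0 := (pow_pos hs0 _).ne'
    have : (n : ℝ) * progeny p lam μ n = s * (ρ * g1) ^ n * c := by
      apply mul_left_cancel₀ hne
      rw [hcoef]; ring
    rw [← this]; field_simp
  have hexp : Real.exp (-((n : ℝ) / (-Real.log (g - v * g1))⁻¹)) = (ρ * g1) ^ n := by
    rw [hk, div_inv_eq_mul, mul_neg, neg_neg, Real.exp_nat_mul, Real.exp_log (by positivity)]
  have hnp : (n : ℝ) ^ (-(3 / 2) : ℝ) = (n : ℝ)⁻¹ * (√(n : ℝ))⁻¹ := by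
    rw [Real.sqrt_eq_rpow, ← Real.rpow_neg_one, ← Real.rpow_neg hn0.le, ← Real.rpow_add hn0]
    norm_num
  rw [Pi.div_apply, hexp, hprog, hnp]
  have hsq : √(n : ℝ) ≠ 0 := (Real.sqrt_pos.mpr hn0).ne'
  have hpw : (ρ * g1) ^ n ≠ 0 := (pow_pos (by positivity) n).ne'
  norm_num
  field_simp

omit h0 h1

lemma hasDerivAt_shiftedPGF {v : ℝ} (hv : |1 + lam * v| < R) :
    HasDerivAt (shiftedPGF p lam) (shiftedPGF₁ p lam v) v := by
  have e1 : HasDerivAt (fun v => 1 + lam * v) lam v := by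
    simpa using ((hasDerivAt_id v).const_mul lam).const_add 1
  have e2 : HasDerivAt (fun v => 1 + v) 1 v := (hasDerivAt_id v).const_add 1
  have e3 := (hasDerivAt_degreePGF hp.nonneg hs hv).comp v e1
  refine (e2.mul e3).congr_deriv ?_
  simp only [shiftedPGF₁, Function.comp_apply]
  ring

lemma hasDerivAt_shiftedPGF₁ {v : ℝ} (hv : |1 + lam * v| < R) :
    HasDerivAt (shiftedPGF₁ p lam) (shiftedPGF₂ p lam v) v := by
  obtain ⟨R', hv', hR'⟩ := exists_between hv
  have hR0 : 0 ≤ R' := (abs_nonneg _).trans hv'.le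
  have hd := summable_derivSeq hp.nonneg hR0 hR' hs
  have e1 : HasDerivAt (fun v => 1 + lam * v) lam v := by
    simpa using ((hasDerivAt_id v).const_mul lam).const_add 1
  have e2 : HasDerivAt (fun v => lam * (1 + v)) lam v := by
    simpa using ((hasDerivAt_id v).const_add 1).const_mul lam
  have e3 := (hasDerivAt_degreePGF hp.nonneg hs hv).comp v e1
  have e4 := (hasDerivAt_degreePGF (derivSeq_nonneg hp.nonneg) hd hv').comp v e1
  refine (e3.add (e2.mul e4)).congr_deriv ?_
  simp only [shiftedPGF₂, Function.comp_apply]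
  ring

lemma continuousAt_shiftedPGF₂ {v : ℝ} (hv : |1 + lam * v| < R) :
    ContinuousAt (shiftedPGF₂ p lam) v := by
  obtain ⟨R', hv', hR'⟩ := exists_between hv
  have hR0 : 0 ≤ R' := (abs_nonneg _).trans hv'.le
  obtain ⟨R'', hv'', hR''⟩ := exists_between hv'
  have hR0' : 0 ≤ R'' := (abs_nonneg _).trans hv''.le
  have hd := summable_derivSeq hp.nonneg hR0 hR' hs
  have hdd := summable_derivSeq (derivSeq_nonneg hp.nonneg) hR0' hR'' hd
  have c0 : ContinuousAt (fun v => 1 + lam * v) v := by fun_prop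
  have c1 : ContinuousAt (fun v => degreePGF (derivSeq p) (1 + lam * v)) v :=
    ContinuousAt.comp (f := fun v => 1 + lam * v)
      (hasDerivAt_degreePGF (derivSeq_nonneg hp.nonneg) hd hv').continuousAt c0
  have c2 : ContinuousAt (fun v => degreePGF (derivSeq (derivSeq p)) (1 + lam * v)) v :=
    ContinuousAt.comp (f := fun v => 1 + lam * v)
      (hasDerivAt_degreePGF (derivSeq_nonneg (derivSeq_nonneg hp.nonneg)) hdd hv'').continuousAt c0
  unfold shiftedPGF₂
  fun_prop

end Analytic

lemma shiftedPGF_zero {p : ℕ → ℝ} (hp : IsOutDegreeDistribution p) (lam : ℝ) :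
    shiftedPGF p lam 0 = 1 := by
  simp [shiftedPGF, degreePGF_one hp]

lemma shiftedPGF₁_zero {p : ℕ → ℝ} (hp : IsOutDegreeDistribution p) (lam : ℝ) :
    shiftedPGF₁ p lam 0 = lam * meanDegree p + 1 := by
  simp [shiftedPGF₁, degreePGF_one hp, ← meanDegree_eq_degreePGF]
  ring

lemma shiftedPGF₂_zero (p : ℕ → ℝ) (lam : ℝ) : shiftedPGF₂ p lam 0 =
    lam * (lam * secondFactorialMoment p + 2 * meanDegree p) := by
  rw [shiftedPGF₂, mul_zero, add_zero, ← meanDegree_eq_degreePGF,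
    ← secondFactorialMoment_eq_degreePGF]
  ring

/-- The saddle-point equation is solved for the tilt `v` near `0` by the inverse function theorem:
`v = V(μ) ~ (Z/b) μ`, because `M'(0) = b/Z ≠ 0`. As `(g - v g')' = -v g''`, the rate `-log(g - v
g')` is asymptotic to `b v²/2`, hence to `Z² μ² / (2b) = 1/κ`. -/
theorem exists_progeny_isEquivalent_of_analytic {p : ℕ → ℝ} (hp : IsOutDegreeDistribution p)
    {lam : ℝ} (h0 : 0 < lam) (h1 : lam ≤ 1) {R : ℝ} (hR : 1 < R)
    (hs : Summable fun k => p k * R ^ k) :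
    ∃ A' κ' : ℝ → ℝ,
      Tendsto A' (𝓝[>] 0) (𝓝 (prefactorA p lam)) ∧
      Tendsto (fun μ => κ' μ / cutoff p lam μ) (𝓝[>] 0) (𝓝 1) ∧
      ∀ᶠ μ in 𝓝[>] (0 : ℝ), progeny p lam μ ~[atTop] fun n : ℕ =>
        A' μ * (n : ℝ) ^ (-(3 / 2) : ℝ) * Real.exp (-((n : ℝ) / κ' μ)) := by
  set Z := lam * meanDegree p + 1 with hZ
  have hZ0 : 0 < Z := by have := lam_mul_mean_pos hp h0; linarith
  set g := shiftedPGF p lam with hg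
  set g1 := shiftedPGF₁ p lam with hg1
  set g2 := shiftedPGF₂ p lam with hg2
  have g0 : g 0 = 1 := shiftedPGF_zero hp lam
  have g10 : g1 0 = Z := shiftedPGF₁_zero hp lam
  set b := lam * (lam * secondFactorialMoment p + 2 * meanDegree p) with hb
  have g20 : g2 0 = b := shiftedPGF₂_zero p lam
  have hb0 : 0 < b := mul_pos h0 (second_combination_pos hp h0)
  have hnear : ∀ᶠ v in 𝓝 (0 : ℝ), |1 + lam * v| < R := by
    have : ContinuousAt (fun v : ℝ => |1 + lam * v|) 0 := by fun_prop
    exact this.eventually (gt_mem_nhds (by simpa using hR))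
  have hdg : ∀ᶠ v in 𝓝 (0 : ℝ), HasDerivAt g (g1 v) v :=
    hnear.mono fun v hv => hasDerivAt_shiftedPGF hp hs hv
  have hdg1 : ∀ᶠ v in 𝓝 (0 : ℝ), HasDerivAt g1 (g2 v) v :=
    hnear.mono fun v hv => hasDerivAt_shiftedPGF₁ hp hs hv
  have hcg : ContinuousAt g 0 := hdg.self_of_nhds.continuousAt
  have hcg1 : ContinuousAt g1 0 := hdg1.self_of_nhds.continuousAt
  have hcg2 : ContinuousAt g2 0 :=
    continuousAt_shiftedPGF₂ hp hs hnear.self_of_nhds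
  have hg1pos : ∀ᶠ v in 𝓝 (0 : ℝ), 0 < g1 v :=
    hcg1.eventually (lt_mem_nhds (by rw [g10]; exact hZ0))
  -- the innovation rate at which the tilt `v` is critical
  set M : ℝ → ℝ := fun v => 1 - Z * (g v / g1 v - v) with hM
  have hM0 : M 0 = 0 := by
    simp only [hM, g0, g10]; field_simp; ring
  have hdM : ∀ᶠ v in 𝓝 (0 : ℝ), HasDerivAt M (Z * (g v * g2 v / g1 v ^ 2)) v := by
    filter_upwards [hdg, hdg1, hg1pos] with v e1 e2 e3
    have := (((e1.div e2 e3.ne').sub (hasDerivAt_id v)).const_mul Z).const_sub 1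
    refine this.congr_deriv ?_
    field_simp
    ring
  have hstrict : HasStrictDerivAt M (Z * (g 0 * g2 0 / g1 0 ^ 2)) 0 := by
    refine hasStrictDerivAt_of_hasDerivAt_of_continuousAt hdM ?_
    have : g1 0 ^ 2 ≠ 0 := by rw [g10]; positivity
    exact continuousAt_const.mul ((hcg.mul hcg2).div (hcg1.pow 2) this)
  have hder : Z * (g 0 * g2 0 / g1 0 ^ 2) = b / Z := by rw [g0, g10, g20]; field_simp
  rw [hder] at hstrict
  have hbZ : b / Z ≠ 0 := (div_pos hb0 hZ0).ne'
  set V := hstrict.localInverse M (b / Z) 0 hbZ with hV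
  have hright : ∀ᶠ μ in 𝓝 (0 : ℝ), M (V μ) = μ := by
    have := hstrict.eventually_right_inverse hbZ
    rwa [hM0] at this
  have hVd : HasDerivAt V (Z / b) 0 := by
    have := (hstrict.to_localInverse hbZ).hasDerivAt
    rwa [hM0, inv_div] at this
  have hV0 : V 0 = 0 := by
    have := (hstrict.eventually_left_inverse hbZ).self_of_nhds
    rwa [hM0] at this
  have hVlim : Tendsto V (𝓝[>] 0) (𝓝 0) := by
    have := hVd.continuousAt.tendsto
    rw [hV0] at this
    exact this.mono_left nhdsWithin_le_nhds
  have hslope : Tendsto (fun μ => V μ / μ) (𝓝[>] 0) (𝓝 (Z / b)) := by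
    have h3 := (hasDerivAt_iff_tendsto_slope.mp hVd).mono_left
      (nhdsWithin_mono 0 (fun x (hx : 0 < x) => hx.ne' : Ioi (0 : ℝ) ⊆ {0}ᶜ))
    refine h3.congr fun μ => ?_
    rw [slope_def_field, hV0, sub_zero, sub_zero]
  have hVpos : ∀ᶠ μ in 𝓝[>] (0 : ℝ), 0 < V μ := by
    filter_upwards [hslope.eventually (lt_mem_nhds (div_pos hZ0 hb0)), self_mem_nhdsWithin]
      with μ h3 (h4 : 0 < μ)
    exact (div_pos_iff_of_pos_right h4).mp h3
  have hVgt : Tendsto V (𝓝[>] 0) (𝓝[>] 0) := tendsto_nhdsWithin_iff.mpr ⟨hVlim, hVpos⟩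
  have hkd : ∀ᶠ v in 𝓝 (0 : ℝ), HasDerivAt (fun v => g v - v * g1 v) (-(v * g2 v)) v := by
    filter_upwards [hdg, hdg1] with v e1 e2
    refine (e1.sub ((hasDerivAt_id v).mul e2)).congr_deriv ?_
    simp
  have hkc : ContinuousAt (fun v => g v - v * g1 v) 0 := hkd.self_of_nhds.continuousAt
  have hk0 : g 0 - 0 * g1 0 = 1 := by rw [g0]; ring
  have hkpos : ∀ᶠ v in 𝓝 (0 : ℝ), 0 < g v - v * g1 v :=
    hkc.eventually (lt_mem_nhds (by simp only [hk0]; exact one_pos))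
  -- the exponential rate is quadratic in the tilt
  have hrate : Tendsto (fun v => -Real.log (g v - v * g1 v) / v ^ 2) (𝓝[>] 0) (𝓝 (b / 2)) := by
    refine HasDerivAt.lhopital_zero_nhdsGT
      (f' := fun v => v * g2 v / (g v - v * g1 v)) (g' := fun v => 2 * v) ?_ ?_ ?_ ?_ ?_ ?_
    · filter_upwards [nhdsWithin_le_nhds hkd, nhdsWithin_le_nhds hkpos] with v e1 e2
      refine (e1.log e2.ne').neg.congr_deriv ?_
      ring
    · exact Eventually.of_forall fun v => by simpa using hasDerivAt_pow 2 v
    · filter_upwards [self_mem_nhdsWithin] with v (hv : 0 < v)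
      positivity
    · have : ContinuousAt (fun v => -Real.log (g v - v * g1 v)) 0 :=
        (hkc.log (by rw [hk0]; exact one_ne_zero)).neg
      have := this.tendsto.mono_left (nhdsWithin_le_nhds (s := Ioi 0))
      simpa only [hk0, Real.log_one, neg_zero] using this
    · have : Tendsto (fun v : ℝ => v ^ 2) (𝓝 0) (𝓝 (0 ^ 2)) := (continuous_pow 2).tendsto 0
      rw [zero_pow two_ne_zero] at this
      exact this.mono_left nhdsWithin_le_nhds
    · have : ContinuousAt (fun v => g2 v / (g v - v * g1 v) / 2) 0 :=
        (hcg2.div hkc (by rw [hk0]; exact one_ne_zero)).div_const 2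
      have h3 := this.tendsto.mono_left (nhdsWithin_le_nhds (s := Ioi 0))
      simp only [hk0, g20, div_one] at h3
      refine h3.congr' ?_
      filter_upwards [self_mem_nhdsWithin, nhdsWithin_le_nhds hkpos] with v (hv : 0 < v) h5
      field_simp
  refine ⟨fun μ => (1 + V μ / reshareProb p lam μ) *
      (√(2 * Real.pi * (g (V μ) * g2 (V μ) / g1 (V μ) ^ 2)))⁻¹,
    fun μ => (-Real.log (g (V μ) - V μ * g1 (V μ)))⁻¹, ?_, ?_, ?_⟩
  · have hgv : Tendsto (fun μ => g (V μ)) (𝓝[>] 0) (𝓝 1) := by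
      have := hcg.tendsto.comp hVlim
      rwa [g0] at this
    have hg1v : Tendsto (fun μ => g1 (V μ)) (𝓝[>] 0) (𝓝 Z) := by
      have := hcg1.tendsto.comp hVlim
      rwa [g10] at this
    have hg2v : Tendsto (fun μ => g2 (V μ)) (𝓝[>] 0) (𝓝 b) := by
      have := hcg2.tendsto.comp hVlim
      rwa [g20] at this
    have hid : Tendsto (fun μ : ℝ => μ) (𝓝[>] 0) (𝓝 0) := nhdsWithin_le_nhds
    have hρ : Tendsto (fun μ => reshareProb p lam μ) (𝓝[>] 0) (𝓝 (reshareProb p lam 0)) :=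
      (hid.const_sub 1).div_const _
    have hρ0 := reshareProb_pos hp h0 (μ := 0) zero_lt_one
    have e1 := (hVlim.div hρ hρ0.ne').const_add 1
    have e2 := (((hgv.mul hg2v).div (hg1v.pow 2) (by positivity)).const_mul (2 * Real.pi)).sqrt
    have e3 := e1.mul (e2.inv₀ (by have := Real.pi_pos; positivity))
    rw [prefactorA_eq hp h0]
    simpa using e3
  · have h3 := hrate.comp hVgt
    have h4 := (h3.mul (hslope.pow 2)).inv₀ (by positivity)
    have h5 := h4.div_const (2 * (b / Z ^ 2))
    have e : (b / 2 * (Z / b) ^ 2)⁻¹ / (2 * (b / Z ^ 2)) = 1 := by field_simp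
    rw [e] at h5
    refine h5.congr' ?_
    filter_upwards [hVpos, self_mem_nhdsWithin] with μ hv (hμ : 0 < μ)
    rw [div_cutoff hp h0, Function.comp_apply, div_pow, ← hb, ← hZ]
    field_simp
  · have hμ1 : ∀ᶠ μ in 𝓝[>] (0 : ℝ), μ < 1 := nhdsWithin_le_nhds (gt_mem_nhds one_pos)
    filter_upwards [hμ1, self_mem_nhdsWithin, hVpos, nhdsWithin_le_nhds hright,
      hVlim.eventually hnear, hVlim.eventually hg1pos] with μ h3 (h4 : 0 < μ) h5 h6 h7 h8
    refine progeny_isEquivalent_of_tilt hp h0 h1 hs h4.le h3 h5.le ((le_abs_self _).trans_lt h7) ?_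
    have h9 := mul_reshareProb hp h0 (μ := μ)
    rw [← hZ] at h9
    simp only [hM] at h6
    have : Z * reshareProb p lam μ = Z * (g (V μ) / g1 (V μ) - V μ) := by linarith
    have := mul_left_cancel₀ hZ0.ne' this
    linarith

/-! ### The binomial series as a model power tail, and the singular expansion of `f`. -/

/-- The coefficients of the binomial series `(1 - w) ^ β`. -/
def oneSubPowCoeff (β : ℝ) (k : ℕ) : ℝ := ∏ j ∈ Finset.range k, ((j : ℝ) - β) / (j + 1)

lemma oneSubPowCoeff_succ (β : ℝ) (k : ℕ) :
    oneSubPowCoeff β (k + 1) = oneSubPowCoeff β k * ((k - β) / (k + 1)) :=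
  Finset.prod_range_succ _ _

lemma neg_one_pow_mul_choose (β : ℝ) (k : ℕ) :
    (-1) ^ k * Ring.choose (β : ℂ) k = oneSubPowCoeff β k := by
  induction k with
  | zero => simp [oneSubPowCoeff]
  | succ k ih =>
    have h : Ring.choose (β : ℂ) (k + 1) = Ring.choose (β : ℂ) k * ((β - k) / (k + 1)) := by
      have hk : ((k : ℂ) + 1) ≠ 0 := by exact_mod_cast Nat.succ_ne_zero k
      have hf : (k.factorial : ℂ) ≠ 0 := by exact_mod_cast Nat.factorial_ne_zero k
      rw [Ring.choose_eq_smul, Ring.choose_eq_smul, descPochhammer_succ_right,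
        Polynomial.smeval_mul, Nat.factorial_succ]
      simp only [Polynomial.smeval_sub, Polynomial.smeval_X, pow_one, Polynomial.smeval_natCast,
        pow_zero, nsmul_eq_mul, mul_one, smul_eq_mul]
      push_cast
      field_simp
    rw [h, oneSubPowCoeff_succ, Complex.ofReal_mul, ← ih]
    push_cast
    ring

lemma hasSum_oneSubPowCoeff_of_lt (β : ℝ) {w : ℂ} (hw : ‖w‖ < 1) :
    HasSum (fun k => (oneSubPowCoeff β k : ℂ) * w ^ k) ((1 - w) ^ (β : ℂ)) := by
  have h := (Complex.one_add_cpow_hasFPowerSeriesOnBall_zero (a := (β : ℂ))).hasSum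
    (y := -w) (by simpa [← ENNReal.ofReal_one, Metric.eball_ofReal] using hw)
  simp only [binomialSeries_apply, zero_add, List.ofFn_const, List.prod_replicate, smul_eq_mul] at h
  rw [sub_eq_add_neg]
  convert! h using 2 with k
  rw [← neg_one_pow_mul_choose, neg_pow w]
  ring

lemma tendsto_add_one_div : Tendsto (fun n : ℕ => ((n : ℝ) + 1) / n) atTop (𝓝 1) := by
  have := (tendsto_one_div_atTop_nhds_zero_nat (𝕜 := ℝ)).const_add 1
  rw [add_zero] at this
  refine this.congr' ?_
  filter_upwards [eventually_gt_atTop 0] with n hn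
  have : (n : ℝ) ≠ 0 := by positivity
  field_simp

/-- Up to a shift and a factor tending to `1`, the product is the reciprocal of Euler's sequence for
`Γ(-β)`. Thus a sequence with a pure power tail has the closed generating function `(1 - w)^β`. -/
lemma tendsto_oneSubPowCoeff {β : ℝ} (hβ : ∀ m : ℕ, β ≠ m) :
    Tendsto (fun k : ℕ => oneSubPowCoeff β k * (k : ℝ) ^ (β + 1)) atTop
      (𝓝 (Real.Gamma (-β))⁻¹) := by
  rw [← tendsto_add_atTop_iff_nat 1]
  have hG : Tendsto (fun n => (Real.GammaSeq (-β) n)⁻¹) atTop (𝓝 (Real.Gamma (-β))⁻¹) :=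
    (Real.GammaSeq_tendsto_Gamma (-β)).inv₀ (Real.Gamma_ne_zero fun m h => hβ m (by linarith))
  have h1 : Tendsto (fun n : ℕ => (((n : ℝ) + 1) / n) ^ β) atTop (𝓝 1) := by
    simpa using tendsto_add_one_div.rpow_const (p := β) (Or.inl one_ne_zero)
  have h3 := hG.mul h1
  rw [mul_one] at h3
  refine h3.congr' ?_
  filter_upwards [eventually_gt_atTop 0] with n hn
  have hn' : (0 : ℝ) < n := by exact_mod_cast hn
  have hfac : ∏ j ∈ Finset.range (n + 1), ((j : ℝ) + 1) = ((n + 1).factorial : ℝ) := by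
    rw [← Finset.prod_range_add_one_eq_factorial]; push_cast; rfl
  rw [oneSubPowCoeff, Finset.prod_div_distrib, hfac, Real.GammaSeq, Nat.factorial_succ]
  have e1 : ∏ j ∈ Finset.range (n + 1), (-β + (j : ℝ)) = ∏ j ∈ Finset.range (n + 1), ((j : ℝ) - β) :=
    Finset.prod_congr rfl fun j _ => by ring
  rw [e1, Real.div_rpow (by positivity) hn'.le, Real.rpow_neg hn'.le]
  push_cast
  rw [Real.rpow_add (by positivity : (0 : ℝ) < n + 1), Real.rpow_one]
  have hf : (n.factorial : ℝ) ≠ 0 := by exact_mod_cast Nat.factorial_ne_zero n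
  have := (Real.rpow_pos_of_pos hn' β).ne'
  field_simp

lemma summable_abs_oneSubPowCoeff {β : ℝ} (hβ0 : 0 < β) (hβ : ∀ m : ℕ, β ≠ m) :
    Summable fun k => |oneSubPowCoeff β k| := by
  have h := (tendsto_oneSubPowCoeff hβ).isBigO_one ℝ
  have h2 : (fun k => |oneSubPowCoeff β k|) =O[atTop] fun k : ℕ => (k : ℝ) ^ (-(β + 1)) := by
    have h3 := (h.mul (isBigO_refl (fun k : ℕ => (k : ℝ) ^ (-(β + 1))) atTop)).norm_left
    simp only [one_mul] at h3
    refine h3.congr' ?_ EventuallyEq.rfl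
    filter_upwards [eventually_gt_atTop 0] with k hk
    have hk' : (0 : ℝ) < k := by exact_mod_cast hk
    rw [mul_assoc, ← Real.rpow_add hk']
    simp
  exact summable_of_isBigO_nat (Real.summable_nat_rpow.mpr (by linarith)) h2

/-- For `β > 0` the coefficients are absolutely summable, so both sides have radial limits on the
unit circle, equal by the identity inside the disc. -/
lemma hasSum_oneSubPowCoeff {β : ℝ} (hβ0 : 0 < β) (hβ : ∀ m : ℕ, β ≠ m) {w : ℂ} (hw : ‖w‖ ≤ 1) :
    HasSum (fun k => (oneSubPowCoeff β k : ℂ) * w ^ k) ((1 - w) ^ (β : ℂ)) := by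
  have hs := summable_abs_oneSubPowCoeff hβ0 hβ
  have hb : ∀ (k : ℕ) (v : ℂ), v ∈ Metric.closedBall (0 : ℂ) 1 →
      ‖(oneSubPowCoeff β k : ℂ) * v ^ k‖ ≤ |oneSubPowCoeff β k| := fun k v hv => by
    rw [norm_mul, norm_pow, Complex.norm_real, Real.norm_eq_abs]
    exact mul_le_of_le_one_right (abs_nonneg _) (pow_le_one₀ (norm_nonneg _) (by simpa using hv))
  have hw' : w ∈ Metric.closedBall (0 : ℂ) 1 := by simpa using hw
  have hsum : Summable fun k => (oneSubPowCoeff β k : ℂ) * w ^ k :=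
    Summable.of_norm_bounded hs fun k => hb k w hw'
  have hcont : ContinuousOn (fun v : ℂ => ∑' k, (oneSubPowCoeff β k : ℂ) * v ^ k)
      (Metric.closedBall 0 1) := continuousOn_tsum (fun k => by fun_prop) hs hb
  have hpath : Tendsto (fun r : ℝ => (r : ℂ) * w) (𝓝[<] 1) (𝓝[Metric.closedBall 0 1] w) := by
    refine tendsto_nhdsWithin_iff.mpr ⟨?_, ?_⟩
    · have : Continuous fun r : ℝ => (r : ℂ) * w := by fun_prop
      have h := this.tendsto 1
      simp only [Complex.ofReal_one, one_mul] at h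
      exact h.mono_left nhdsWithin_le_nhds
    · filter_upwards [Ioo_mem_nhdsLT (zero_lt_one' ℝ)] with r hr
      simp only [Metric.mem_closedBall, dist_zero_right, norm_mul, Complex.norm_real,
        Real.norm_of_nonneg hr.1.le]
      exact mul_le_one₀ hr.2.le (norm_nonneg _) hw
  have h1 := (hcont w hw').tendsto.comp hpath
  have h2 : Tendsto (fun r : ℝ => (1 - (r : ℂ) * w) ^ (β : ℂ)) (𝓝[<] 1) (𝓝 ((1 - w) ^ (β : ℂ))) := by
    have hre : w.re ≤ 1 := (Complex.re_le_norm w).trans hw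
    have hc : ContinuousAt (fun v : ℂ => v ^ (β : ℂ)) (1 - w) := by
      refine Complex.continuousAt_cpow_const_of_re_pos (Or.inl ?_) (by simpa using hβ0)
      simpa using hre
    exact (hc.tendsto.comp ((hpath.mono_right nhdsWithin_le_nhds).const_sub 1))
  have heq : (∑' k, (oneSubPowCoeff β k : ℂ) * w ^ k) = (1 - w) ^ (β : ℂ) := by
    refine tendsto_nhds_unique h1 (h2.congr' ?_)
    filter_upwards [Ioo_mem_nhdsLT (zero_lt_one' ℝ)] with r hr
    refine (hasSum_oneSubPowCoeff_of_lt β ?_).tsum_eq.symm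
    rw [norm_mul, Complex.norm_real, Real.norm_of_nonneg hr.1.le]
    exact (mul_le_of_le_one_right hr.1.le hw).trans_lt hr.2
  rw [← heq]
  exact hsum.hasSum

/-- Coefficientwise form of `((1 - w)^α)' = -α (1 - w)^{α - 1}`. -/
lemma succ_mul_oneSubPowCoeff (α : ℝ) (k : ℕ) :
    ((k : ℝ) + 1) * oneSubPowCoeff α (k + 1) = -α * oneSubPowCoeff (α - 1) k := by
  induction k with
  | zero => simp [oneSubPowCoeff]
  | succ k ih =>
    have h1 : ((k : ℝ) + 1) ≠ 0 := by positivity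
    have h2 : ((k : ℝ) + 1 + 1) ≠ 0 := by positivity
    rw [oneSubPowCoeff_succ, oneSubPowCoeff_succ (α - 1)]
    push_cast
    field_simp
    linear_combination (k + 1 - α) * ih

section OneTwo

variable {α : ℝ} (h1 : 1 < α) (h2 : α < 2)
include h1 h2

lemma ne_natCast_of_one_lt_of_lt_two (m : ℕ) : α ≠ m := by
  rintro rfl
  have : 1 < m := by exact_mod_cast h1
  have : m < 2 := by exact_mod_cast h2
  omega

lemma sub_one_ne_natCast (m : ℕ) : α - 1 ≠ m := fun h =>
  ne_natCast_of_one_lt_of_lt_two h1 h2 (m + 1) (by push_cast; linarith)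

lemma oneSubPowCoeff_pos (k : ℕ) : 0 < oneSubPowCoeff α (k + 2) := by
  induction k with
  | zero =>
    simp only [oneSubPowCoeff, Finset.prod_range_succ, Finset.prod_range_zero]
    norm_num
    nlinarith
  | succ k ih =>
    rw [oneSubPowCoeff_succ]
    refine mul_pos ih (div_pos ?_ (by positivity))
    push_cast
    have : (0 : ℝ) ≤ k := by positivity
    linarith

lemma gamma_neg_pos : 0 < Real.Gamma (-α) := by
  have e : -α + 1 ≠ 0 := by linarith
  have a := Real.Gamma_add_one (s := -α) (by linarith)
  have b := Real.Gamma_add_one e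
  have c : 0 < Real.Gamma (-α + 1 + 1) := Real.Gamma_pos_of_pos (by linarith)
  rw [b, a, ← mul_assoc] at c
  exact pos_of_mul_pos_right c (by nlinarith)

lemma hasSum_oneSubPowCoeff_one : HasSum (oneSubPowCoeff α) 0 := by
  have h := hasSum_oneSubPowCoeff (by linarith) (ne_natCast_of_one_lt_of_lt_two h1 h2)
    (w := 1) (by simp)
  have e : (1 - 1 : ℂ) ^ (α : ℂ) = 0 := by
    rw [sub_self, Complex.zero_cpow (by exact_mod_cast (by linarith : α ≠ 0))]
  rw [e] at h
  have h' : HasSum (fun k => ((oneSubPowCoeff α k : ℝ) : ℂ)) ((0 : ℝ) : ℂ) := by simpa using h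
  exact Complex.hasSum_ofReal.mp h'

lemma hasSum_natCast_mul_oneSubPowCoeff :
    HasSum (fun k : ℕ => (k : ℝ) * oneSubPowCoeff α k) 0 := by
  have h := hasSum_oneSubPowCoeff (β := α - 1) (by linarith) (sub_one_ne_natCast h1 h2)
    (w := 1) (by simp)
  have e : (1 - 1 : ℂ) ^ ((α - 1 : ℝ) : ℂ) = 0 := by
    rw [sub_self, Complex.zero_cpow (by exact_mod_cast (by linarith : α - 1 ≠ 0))]
  rw [e] at h
  have h' : HasSum (fun k => ((oneSubPowCoeff (α - 1) k : ℝ) : ℂ)) ((0 : ℝ) : ℂ) := by simpa using h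
  have h3 := (Complex.hasSum_ofReal.mp h').mul_left (-α)
  rw [← hasSum_nat_add_iff' 1]
  simp only [Finset.sum_range_one, Nat.cast_zero, zero_mul, sub_zero]
  rw [mul_zero] at h3
  convert! h3 using 2 with k
  rw [← succ_mul_oneSubPowCoeff]
  push_cast
  rfl

/-- For `1 < α < 2` the value and the first derivative of `(1 - w)^α` vanish at `1`, so only
second-order remainders survive, the same ones as in the expansion of `f`. -/
lemma hasSum_oneSubPowCoeff_mul_powRemainder {w : ℂ} (hw : ‖w‖ ≤ 1) :
    HasSum (fun k => (w - 1) ^ 2 * ((oneSubPowCoeff α k : ℂ) * powRemainder k w))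
      ((1 - w) ^ (α : ℂ)) := by
  have a := hasSum_oneSubPowCoeff (by linarith) (ne_natCast_of_one_lt_of_lt_two h1 h2) hw
  have b := Complex.hasSum_ofReal.mpr (hasSum_oneSubPowCoeff_one h1 h2)
  have c := (Complex.hasSum_ofReal.mpr (hasSum_natCast_mul_oneSubPowCoeff h1 h2)).mul_right (w - 1)
  have d := (a.sub b).sub c
  simp only [Complex.ofReal_zero, sub_zero, zero_mul] at d
  convert! d using 2 with k
  rw [pow_eq_add_powRemainder k w]
  push_cast
  ring

end OneTwo

lemma one_sub_pow_mul_le_one {δ : ℝ} (hδ1 : δ ≤ 1) (j : ℕ) :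
    (1 - δ) ^ j * (1 + j * δ) ≤ 1 := by
  induction j with
  | zero => simp
  | succ j ih =>
    have h0 : 0 ≤ (1 - δ) ^ j := pow_nonneg (by linarith) j
    have : (1 - δ) * (1 + (j + 1) * δ) ≤ 1 + j * δ := by
      nlinarith [mul_nonneg (Nat.cast_nonneg (α := ℝ) j) (sq_nonneg δ), sq_nonneg δ]
    push_cast
    rw [pow_succ, mul_assoc]
    exact (mul_le_mul_of_nonneg_left this h0).trans ih

/-- The complex sum is at most `min(j, 2/δ)`. The real sum at `1 - δ` is at least `j/2` when `jδ ≤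
1` and at least `1/(2δ)` otherwise; the second case costs the constant `4`. -/
lemma norm_geom_sum_le {w : ℂ} (hw : ‖w‖ ≤ 1) {δ : ℝ} (hδ : ‖w - 1‖ = δ) (hδ0 : 0 < δ) (hδ1 : δ ≤ 1)
    (j : ℕ) : ‖∑ i ∈ Finset.range j, w ^ i‖ ≤ 4 * ∑ i ∈ Finset.range j, (1 - δ) ^ i := by
  have a : ‖∑ i ∈ Finset.range j, w ^ i‖ ≤ j := by
    refine (norm_sum_le _ _).trans ?_
    refine (Finset.sum_le_card_nsmul _ _ 1 fun i _ => ?_).trans (by simp)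
    rw [norm_pow]; exact pow_le_one₀ (norm_nonneg _) hw
  have b : δ * ‖∑ i ∈ Finset.range j, w ^ i‖ ≤ 2 := by
    rw [← hδ, ← norm_mul, mul_geom_sum]
    have : ‖w ^ j‖ ≤ 1 := by rw [norm_pow]; exact pow_le_one₀ (norm_nonneg _) hw
    calc ‖w ^ j - 1‖ ≤ ‖w ^ j‖ + ‖(1 : ℂ)‖ := norm_sub_le _ _
      _ ≤ 2 := by rw [norm_one]; linarith
  have c : δ * ∑ i ∈ Finset.range j, (1 - δ) ^ i = 1 - (1 - δ) ^ j := by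
    have := mul_geom_sum (1 - δ) j
    linarith
  have d := one_sub_pow_mul_le_one hδ1 j
  set S := ∑ i ∈ Finset.range j, (1 - δ) ^ i
  set W := ‖∑ i ∈ Finset.range j, w ^ i‖
  have hW : 0 ≤ W := norm_nonneg _
  have h0 : 0 ≤ (1 - δ) ^ j := pow_nonneg (by linarith) j
  have hj : (0 : ℝ) ≤ j := Nat.cast_nonneg j
  have e : (j : ℝ) ≤ S * (1 + j * δ) := by
    have : δ * j ≤ δ * (S * (1 + j * δ)) := by
      rw [← mul_assoc, c]; nlinarith
    exact le_of_mul_le_mul_left this hδ0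
  rcases le_total (j * δ) 1 with h | h
  · have : 0 ≤ S := Finset.sum_nonneg fun i _ => pow_nonneg (by linarith) i
    nlinarith
  · have : 1 ≤ 2 * (δ * S) := by
      rw [c]; nlinarith
    have : δ * W ≤ δ * (4 * S) := by linarith
    exact le_of_mul_le_mul_left this hδ0

/-- Moves an estimate from a complex point to the real point at the same distance from `1`, where
the model series has the exact value `δ^α`. -/
lemma norm_powRemainder_le_mul {w : ℂ} (hw : ‖w‖ ≤ 1) {δ : ℝ} (hδ : ‖w - 1‖ = δ) (hδ0 : 0 < δ)
    (hδ1 : δ ≤ 1) (k : ℕ) :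
    ‖powRemainder k w‖ ≤ 4 * (powRemainder k ((1 - δ : ℝ) : ℂ)).re := by
  have e : (powRemainder k ((1 - δ : ℝ) : ℂ)).re =
      ∑ j ∈ Finset.range k, ∑ i ∈ Finset.range j, (1 - δ) ^ i := by
    rw [powRemainder]
    norm_cast
  rw [e, Finset.mul_sum, powRemainder]
  exact (norm_sum_le _ _).trans
    (Finset.sum_le_sum fun j _ => norm_geom_sum_le hw hδ hδ0 hδ1 j)

/-! ### The stretched exponential integral with complex coefficient. -/

section StretchedExponential

variable {α : ℝ} (hα : 0 < α)
include hα

lemma integrableOn_cexp_neg_mul_rpow {S : ℂ} (hS : 0 < S.re) :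
    IntegrableOn (fun u : ℝ => Complex.exp (-(S * (u ^ α : ℝ)))) (Ioi 0) := by
  have h := integrableOn_rpow_mul_exp_neg_mul_rpow (s := 0) (by norm_num) hα hS
  refine h.mono' (by
    have : Measurable fun u : ℝ => Complex.exp (-(S * (u ^ α : ℝ))) := by fun_prop
    exact this.aestronglyMeasurable) (ae_of_all _ fun u => ?_)
  rw [Complex.norm_exp, Real.rpow_zero, one_mul]
  simp

lemma differentiableAt_integral_cexp_neg_mul_rpow {S : ℂ} (hS : 0 < S.re) :
    DifferentiableAt ℂ (fun S : ℂ => ∫ u : ℝ in Ioi 0, Complex.exp (-(S * (u ^ α : ℝ)))) S := by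
  have hnhds : {T : ℂ | S.re / 2 < T.re} ∈ 𝓝 S :=
    (isOpen_lt continuous_const Complex.continuous_re).mem_nhds (by simp only [mem_ofPred_eq]; linarith)
  refine (hasDerivAt_integral_of_dominated_loc_of_deriv_le
    (μ := volume.restrict (Ioi (0 : ℝ)))
    (F := fun T (u : ℝ) => Complex.exp (-(T * (u ^ α : ℝ))))
    (F' := fun T u => Complex.exp (-(T * (u ^ α : ℝ))) * (-((u ^ α : ℝ) : ℂ)))
    (bound := fun u => u ^ α * Real.exp (-(S.re / 2) * u ^ α)) hnhds
    (Eventually.of_forall fun T => ?_) (integrableOn_cexp_neg_mul_rpow hα hS) ?_ ?_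
    (integrableOn_rpow_mul_exp_neg_mul_rpow (by linarith) hα (half_pos hS)) ?_).2.differentiableAt
  · have : Measurable fun u : ℝ => Complex.exp (-(T * (u ^ α : ℝ))) := by fun_prop
    exact this.aestronglyMeasurable
  · have : Measurable fun u : ℝ =>
      Complex.exp (-(S * (u ^ α : ℝ))) * (-((u ^ α : ℝ) : ℂ)) := by fun_prop
    exact this.aestronglyMeasurable
  · refine (ae_restrict_iff' measurableSet_Ioi).mpr (ae_of_all _ fun u (hu : 0 < u) T hT => ?_)
    have hu' : 0 ≤ u ^ α := Real.rpow_nonneg hu.le α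
    rw [norm_mul, norm_neg, Complex.norm_real, Real.norm_of_nonneg hu', mul_comm, Complex.norm_exp]
    refine mul_le_mul_of_nonneg_left (Real.exp_le_exp.mpr ?_) hu'
    simp only [mem_ofPred_eq] at hT
    simp only [Complex.neg_re, Complex.mul_re, Complex.ofReal_re, Complex.ofReal_im, mul_zero,
      sub_zero]
    nlinarith
  · refine ae_of_all _ fun u T _ => ?_
    have h := ((hasDerivAt_id T).mul_const ((u ^ α : ℝ) : ℂ)).neg.cexp
    simpa using h

/-- `∫₀^∞ exp (-S u ^ α) du = Γ(1 + 1/α) S ^ (-1/α)` for `Re S > 0`. -/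
lemma integral_cexp_neg_mul_rpow {S : ℂ} (hS : 0 < S.re) :
    ∫ u : ℝ in Ioi 0, Complex.exp (-(S * (u ^ α : ℝ))) =
      S ^ ((-1 / α : ℝ) : ℂ) * Real.Gamma (1 / α + 1) := by
  set U : Set ℂ := {T : ℂ | 0 < T.re} with hU
  have hUo : IsOpen U := isOpen_lt continuous_const Complex.continuous_re
  -- Both sides are analytic in the right half-plane and agree at the real points just above `1`;
  -- the identity theorem does the rest.
  have h1 : AnalyticOnNhd ℂ
      (fun S : ℂ => ∫ u : ℝ in Ioi 0, Complex.exp (-(S * (u ^ α : ℝ)))) U :=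
    DifferentiableOn.analyticOnNhd (fun T hT =>
      (differentiableAt_integral_cexp_neg_mul_rpow hα hT).differentiableWithinAt) hUo
  have h2 : AnalyticOnNhd ℂ
      (fun S : ℂ => S ^ ((-1 / α : ℝ) : ℂ) * Real.Gamma (1 / α + 1)) U := by
    refine DifferentiableOn.analyticOnNhd (fun T hT => DifferentiableAt.differentiableWithinAt ?_) hUo
    exact (differentiableAt_id.cpow (differentiableAt_const _) (Or.inl hT)).mul_const _
  have hpre : IsPreconnected U := (convex_halfSpace_re_gt 0).isPreconnected
  refine h1.eqOn_of_preconnected_of_frequently_eq h2 hpre (z₀ := 1) (by simp [hU]) ?_ hS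
  have hfreq : ∃ᶠ x : ℝ in 𝓝[>] (1 : ℝ), x ∈ Ioi (1 : ℝ) :=
    Eventually.frequently self_mem_nhdsWithin
  have hmap : Tendsto (fun x : ℝ => (x : ℂ)) (𝓝[>] (1 : ℝ)) (𝓝[≠] (1 : ℂ)) := by
    refine tendsto_nhdsWithin_iff.mpr ⟨?_, ?_⟩
    · have := Complex.continuous_ofReal.tendsto 1
      exact (this.mono_left nhdsWithin_le_nhds).trans (by simp)
    · filter_upwards [self_mem_nhdsWithin] with x (hx : 1 < x)
      simp only [mem_compl_iff, mem_singleton_iff]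
      exact_mod_cast hx.ne'
  refine hmap.frequently (hfreq.mono fun x (hx : 1 < x) => ?_)
  have hx0 : 0 < x := by linarith
  have h := integral_exp_neg_mul_rpow hα hx0
  rw [← Complex.ofReal_cpow hx0.le, ← Complex.ofReal_mul, ← h, ← integral_complex_ofReal]
  refine setIntegral_congr_fun measurableSet_Ioi fun u _ => ?_
  push_cast
  ring_nf

end StretchedExponential

/-! ### The singular expansion of the generating function for power-law out-degrees. -/

section PowerTail

variable {p : ℕ → ℝ} {α D : ℝ} (h1 : 1 < α) (h2 : α < 2)
  (hT : Tendsto (fun k : ℕ => p k * (k : ℝ) ^ (α + 1)) atTop (𝓝 D))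
include h1 h2 hT

lemma tendsto_div_oneSubPowCoeff :
    Tendsto (fun k => p k / oneSubPowCoeff α k) atTop (𝓝 (D * Real.Gamma (-α))) := by
  have h := hT.div (tendsto_oneSubPowCoeff (ne_natCast_of_one_lt_of_lt_two h1 h2))
    (inv_ne_zero (gamma_neg_pos h1 h2).ne')
  rw [div_inv_eq_mul] at h
  refine h.congr' ?_
  filter_upwards [eventually_gt_atTop 0] with k hk
  have : (0 : ℝ) < (k : ℝ) ^ (α + 1) := Real.rpow_pos_of_pos (by exact_mod_cast hk) _
  exact mul_div_mul_right _ _ this.ne'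

lemma exists_abs_sub_oneSubPowCoeff_le {ε : ℝ} (hε : 0 < ε) :
    ∃ N : ℕ, ∀ k ≥ N, |p k - D * Real.Gamma (-α) * oneSubPowCoeff α k| ≤ ε * oneSubPowCoeff α k := by
  obtain ⟨N, hN⟩ := Metric.tendsto_atTop.mp (tendsto_div_oneSubPowCoeff h1 h2 hT) ε hε
  refine ⟨max N 2, fun k hk => ?_⟩
  obtain ⟨j, rfl⟩ := Nat.exists_eq_add_of_le' (le_of_max_le_right hk)
  have hb := oneSubPowCoeff_pos h1 h2 j
  have h := (hN (j + 2) (le_of_max_le_left hk)).le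
  rw [Real.dist_eq] at h
  calc |p (j + 2) - D * Real.Gamma (-α) * oneSubPowCoeff α (j + 2)|
      = |p (j + 2) / oneSubPowCoeff α (j + 2) - D * Real.Gamma (-α)| * oneSubPowCoeff α (j + 2) := by
        rw [← abs_of_pos hb, ← abs_mul, abs_of_pos hb, sub_mul, div_mul_cancel₀ _ hb.ne']
    _ ≤ _ := mul_le_mul_of_nonneg_right h hb.le

variable (hp : IsOutDegreeDistribution p)
include hp

omit hT in
lemma hasSum_pgf_sub (C : ℝ) {w : ℂ} (hw : ‖w‖ ≤ 1) :
    HasSum (fun k => (w - 1) ^ 2 * (((p k - C * oneSubPowCoeff α k : ℝ) : ℂ) * powRemainder k w))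
      (complexPGF p w - 1 - meanDegree p * (w - 1) - C * (1 - w) ^ (α : ℂ)) := by
  have s : HasSum (fun k => (p k : ℂ) * w ^ k) (complexPGF p w) := by
    refine Summable.hasSum (Summable.of_norm_bounded hp.hasSum_one.summable fun k => ?_)
    rw [norm_mul, norm_pow, Complex.norm_real, Real.norm_of_nonneg (hp.nonneg k)]
    exact mul_le_of_le_one_right (hp.nonneg k) (pow_le_one₀ (norm_nonneg _) hw)
  have s0 : HasSum (fun k => (p k : ℂ)) 1 := by
    have := Complex.hasSum_ofReal.mpr hp.hasSum_one
    simpa using this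
  have s1 : HasSum (fun k : ℕ => (k : ℂ) * (p k : ℂ)) (meanDegree p : ℂ) := by
    have := hp.summable_mean.hasSum
    exact_mod_cast this
  have h := ((s.sub s0).sub (s1.mul_right (w - 1))).sub
    ((hasSum_oneSubPowCoeff_mul_powRemainder h1 h2 hw).mul_left (C : ℂ))
  convert! h using 2 with k
  rw [pow_eq_add_powRemainder k w]
  push_cast
  ring

/-- The singular expansion of the generating function at `1`, inside the closed unit disc. -/
lemma exists_norm_complexPGF_sub_le {ε : ℝ} (hε : 0 < ε) :
    ∃ δ₀ > 0, ∀ w : ℂ, ‖w‖ ≤ 1 → ‖w - 1‖ < δ₀ →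
      ‖complexPGF p w - 1 - meanDegree p * (w - 1) -
        (D * Real.Gamma (-α) : ℝ) * (1 - w) ^ (α : ℂ)‖ ≤ ε * ‖w - 1‖ ^ α := by
  -- The factor `4` of `norm_powRemainder_le_mul` turns `ε/8` into `ε/2`. The other half pays for
  -- the finitely many terms `k < N`, which contribute `O(δ²) = o(δ^α)`.
  obtain ⟨N, hN⟩ := exists_abs_sub_oneSubPowCoeff_le h1 h2 hT (ε := ε / 8) (by linarith)
  set C := D * Real.Gamma (-α) with hC
  set b := oneSubPowCoeff α with hb
  set M : ℝ := ∑ k ∈ Finset.range N, |p k - C * b k| * (k * (k - 1) / 2) with hM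
  have hlim : Tendsto (fun x : ℝ => M * x ^ (2 - α)) (𝓝 0) (𝓝 0) := by
    have := ((Real.continuous_rpow_const (q := 2 - α) (by linarith)).tendsto 0).const_mul M
    rwa [Real.zero_rpow (by linarith), mul_zero] at this
  obtain ⟨δ₁, hδ₁, h⟩ := Metric.tendsto_nhds_nhds.mp hlim (ε / 2) (by linarith)
  refine ⟨min δ₁ 1, by positivity, fun w hw hw1 => ?_⟩
  have hs := hasSum_pgf_sub h1 h2 hp C hw
  rcases eq_or_ne w 1 with rfl | hne
  · simp only [sub_self, ne_eq, OfNat.ofNat_ne_zero, not_false_eq_true, zero_pow, zero_mul] at hs ⊢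
    rw [hs.unique hasSum_zero]
    simp [Real.zero_rpow (by linarith : α ≠ 0)]
  set δ := ‖w - 1‖ with hδ
  have hδ0 : 0 < δ := norm_pos_iff.mpr (sub_ne_zero.mpr hne)
  have hδ1 : δ ≤ 1 := (hw1.trans_le (min_le_right _ _)).le
  set v : ℂ := ((1 - δ : ℝ) : ℂ) with hv
  have hvn : ‖v‖ ≤ 1 := by
    rw [hv, Complex.norm_real, Real.norm_of_nonneg (by linarith)]; linarith
  have hsv : HasSum (fun k => δ ^ 2 * (b k * (powRemainder k v).re)) (δ ^ α) := by
    have h' := Complex.hasSum_re (hasSum_oneSubPowCoeff_mul_powRemainder h1 h2 hvn)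
    have e1 : (1 : ℂ) - v = (δ : ℂ) := by rw [hv]; push_cast; ring
    have e2 : v - 1 = ((-δ : ℝ) : ℂ) := by rw [hv]; push_cast; ring
    rw [e1, ← Complex.ofReal_cpow hδ0.le, Complex.ofReal_re] at h'
    convert! h' using 2 with k
    rw [e2, ← Complex.ofReal_pow, Complex.re_ofReal_mul, Complex.re_ofReal_mul]
    ring
  have hfin : HasSum (fun k : ℕ => δ ^ 2 * (if k < N then |p k - C * b k| * (k * (k - 1) / 2) else 0))
      (δ ^ 2 * M) := by
    refine HasSum.mul_left _ ?_
    have := hasSum_sum_of_ne_finset_zero (L := .unconditional ℕ) (s := Finset.range N)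
      (f := fun k : ℕ => if k < N then |p k - C * b k| * (k * (k - 1) / 2) else 0)
      fun k hk => if_neg (by simpa using hk)
    rwa [Finset.sum_congr rfl fun k hk => if_pos (Finset.mem_range.mp hk)] at this
  have hbd := tsum_of_norm_bounded (hfin.add (hsv.mul_left (ε / 2)))
    (f := fun k => (w - 1) ^ 2 * (((p k - C * b k : ℝ) : ℂ) * powRemainder k w)) fun k => ?_
  · rw [hs.tsum_eq] at hbd
    refine hbd.trans ?_
    have hx := h (x := δ) (by
      rw [Real.dist_eq, sub_zero, abs_of_pos hδ0]; exact hw1.trans_le (min_le_left _ _))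
    rw [Real.dist_eq, sub_zero] at hx
    have hx' := (le_abs_self _).trans hx.le
    have e : δ ^ 2 = δ ^ α * δ ^ (2 - α) := by
      rw [← Real.rpow_add hδ0, ← Real.rpow_natCast]; norm_num
    have hpos : 0 < δ ^ α := Real.rpow_pos_of_pos hδ0 _
    rw [e]
    nlinarith
  · have hR := norm_powRemainder_le_mul hw hδ.symm hδ0 hδ1 k
    rw [norm_mul, norm_pow, ← hδ, norm_mul, Complex.norm_real, Real.norm_eq_abs,
      mul_left_comm (ε / 2), ← mul_add]
    refine mul_le_mul_of_nonneg_left ?_ (by positivity)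
    have hRe : 0 ≤ (powRemainder k v).re := by linarith [norm_nonneg (powRemainder k w)]
    split_ifs with hk
    · have hnn : 0 ≤ b k * (powRemainder k v).re := by
        match k with
        | 0 => simp [powRemainder]
        | 1 => simp [powRemainder]
        | k + 2 => exact mul_nonneg (oneSubPowCoeff_pos h1 h2 k).le hRe
      have := mul_le_mul_of_nonneg_left (norm_powRemainder_le k hw) (abs_nonneg (p k - C * b k))
      nlinarith
    · have := mul_le_mul (hN k (not_lt.mp hk)) hR (norm_nonneg _)
        ((abs_nonneg _).trans (hN k (not_lt.mp hk)))
      linarith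

end PowerTail

/-! ### The stable local limit theorem at criticality. -/

lemma offspringChar_neg (p : ℕ → ℝ) (ρ r t : ℝ) :
    offspringChar p ρ r (-t) = (starRingEnd ℂ) (offspringChar p ρ r t) := by
  have e : Complex.exp ((-t : ℝ) * Complex.I) = (starRingEnd ℂ) (Complex.exp (t * Complex.I)) := by
    rw [← Complex.exp_conj]; simp
  rw [offspringChar, offspringChar, e, map_mul]
  congr 1
  · simp
  · rw [complexPGF, complexPGF, Complex.conj_tsum]
    refine tsum_congr fun k => ?_
    simp

/-- The exponent `s e^{iπ(1 - α/2)}` of the one-sided stable law. -/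
def stableExponent (α s : ℝ) : ℂ := s * Complex.exp ((Real.pi * (1 - α / 2) : ℝ) * Complex.I)

section StableExponent

variable {α s : ℝ} (h1 : 1 < α) (h2 : α < 2) (hs : 0 < s)
include h1 h2 hs

lemma stableExponent_re_pos : 0 < (stableExponent α s).re := by
  rw [stableExponent, Complex.re_ofReal_mul, Complex.exp_ofReal_mul_I_re]
  refine mul_pos hs (Real.cos_pos_of_mem_Ioo ⟨?_, ?_⟩) <;> nlinarith [Real.pi_pos]

/-- The argument of the power is `-π(1 - α/2)/α = π/2 - π/α`, whose cosine is `sin(π/α)`. -/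
lemma re_stableExponent_cpow :
    (stableExponent α s ^ ((-1 / α : ℝ) : ℂ)).re = s ^ (-1 / α) * Real.sin (Real.pi / α) := by
  have hne : stableExponent α s ≠ 0 := fun h => by
    have := stableExponent_re_pos h1 h2 hs
    rw [h] at this
    simp at this
  have hα : α ≠ 0 := by linarith
  rw [Complex.cpow_def_of_ne_zero hne, stableExponent,
    Complex.log_ofReal_mul hs (Complex.exp_ne_zero _), Complex.log_exp]
  · rw [show ((Real.log s : ℂ) + (Real.pi * (1 - α / 2) : ℝ) * Complex.I) * ((-1 / α : ℝ) : ℂ) =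
      ((Real.log s * (-1 / α) : ℝ) : ℂ) + ((-(Real.pi * (1 - α / 2) / α) : ℝ) : ℂ) * Complex.I by
        push_cast; ring]
    rw [Complex.exp_add, ← Complex.ofReal_exp, Complex.re_ofReal_mul, Complex.exp_ofReal_mul_I_re,
      Real.rpow_def_of_pos hs, Real.cos_neg, ← Real.cos_pi_div_two_sub, ← Real.cos_neg]
    congr 2
    field_simp
    ring
  · simp only [Complex.mul_I_im, Complex.ofReal_re]
    nlinarith [Real.pi_pos]
  · simp only [Complex.mul_I_im, Complex.ofReal_re]
    nlinarith [Real.pi_pos]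

end StableExponent

lemma ofReal_mul_cpow {t : ℝ} (ht : 0 < t) {x : ℂ} (hx : x ≠ 0) (a : ℝ) :
    ((t : ℂ) * x) ^ (a : ℂ) = (t ^ a : ℝ) * x ^ (a : ℂ) := by
  have ht' : (t : ℂ) ≠ 0 := by exact_mod_cast ht.ne'
  rw [Complex.cpow_def_of_ne_zero (mul_ne_zero ht' hx), Complex.log_ofReal_mul ht hx, add_mul,
    Complex.exp_add, ← Complex.cpow_def_of_ne_zero hx, Real.rpow_def_of_pos ht]
  push_cast
  rfl

lemma neg_mul_I_cpow {r : ℝ} (hr : 0 < r) (α C : ℝ) :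
    (C : ℂ) * (-(r * Complex.I)) ^ (α : ℂ) = -stableExponent α (C * r ^ α) := by
  rw [← mul_neg, ofReal_mul_cpow hr (by simp), Complex.cpow_def_of_ne_zero (by simp),
    Complex.log_neg_I, stableExponent]
  have e : Complex.exp ((Real.pi * (1 - α / 2) : ℝ) * Complex.I) =
      -Complex.exp (-(Real.pi / 2 : ℂ) * Complex.I * α) := by
    rw [show (((Real.pi * (1 - α / 2) : ℝ) : ℂ) * Complex.I) =
      Real.pi * Complex.I + -(Real.pi / 2 : ℂ) * Complex.I * α by push_cast; ring,
      Complex.exp_add, Complex.exp_pi_mul_I]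
    ring
  rw [e]
  push_cast
  ring

lemma tendsto_cexp_sub_one_div :
    Tendsto (fun t : ℝ => (Complex.exp (t * Complex.I) - 1) / t) (𝓝[>] 0) (𝓝 Complex.I) := by
  have h : HasDerivAt (fun t : ℝ => Complex.exp (t * Complex.I)) Complex.I 0 := by
    have := ((Complex.ofRealCLM.hasDerivAt (x := 0)).mul_const Complex.I).cexp
    simpa using this
  have h' := (hasDerivAt_iff_tendsto_slope.mp h).mono_left
    (nhdsWithin_mono _ fun x (hx : x ∈ Ioi (0 : ℝ)) => (ne_of_gt hx : x ≠ 0))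
  refine h'.congr fun t => ?_
  simp [slope_def_module, div_eq_inv_mul]

section PowerTail

variable {p : ℕ → ℝ} {α D : ℝ} (h1 : 1 < α) (h2 : α < 2)
  (hT : Tendsto (fun k : ℕ => p k * (k : ℝ) ^ (α + 1)) atTop (𝓝 D))
  (hp : IsOutDegreeDistribution p) {ρ r : ℝ} (hρ : ρ ∈ Ioo (0 : ℝ) 1) (hr : r ∈ Ioo (0 : ℝ) 1)
  (hm : ρ + r * meanDegree p = 1)
include h1 h2 hT hp

include hr hm in
-- Mean one cancels the linear term against `e^{-it}`, and quadratic terms are `o(t^α)` since `α <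
-- 2`. What remains is `C (1 - w)^α` with `1 - w` asymptotic to `-irt`. Negative `t` follows by
-- conjugation.
lemma tendsto_offspringChar_sub_one_div :
    Tendsto (fun t : ℝ => (offspringChar p ρ r t * Complex.exp (-(t * Complex.I)) - 1) /
      (t ^ α : ℝ)) (𝓝[>] 0) (𝓝 (-stableExponent α (D * Real.Gamma (-α) * r ^ α))) := by
  rw [← neg_mul_I_cpow hr.1]
  set C := D * Real.Gamma (-α) with hC
  set z := meanDegree p with hz
  set d : ℝ → ℂ := fun t => Complex.exp (t * Complex.I) - 1 with hd
  set err : ℝ → ℂ := fun t => complexPGF p (1 + r * d t) - 1 - z * (1 + r * d t - 1) -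
    C * (1 - (1 + r * d t)) ^ (α : ℂ) with herr
  have hdt : ∀ t : ℝ, 0 < t → ‖(r : ℂ) * d t‖ ≤ t := by
    intro t ht
    have h := Real.norm_exp_I_mul_ofReal_sub_one_le (x := t)
    rw [mul_comm Complex.I, Real.norm_of_nonneg ht.le] at h
    rw [norm_mul, Complex.norm_real, Real.norm_of_nonneg hr.1.le]
    exact (mul_le_of_le_one_left (norm_nonneg _) hr.2.le).trans h
  have hwn : ∀ t : ℝ, ‖1 + (r : ℂ) * d t‖ ≤ 1 := by
    intro t
    have := norm_one_sub_add_mul_le ⟨hr.1.le, hr.2.le⟩ (norm_cexp_ofReal_mul_I' t).le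
    convert this using 2
    simp only [hd]; ring
  have herr0 : Tendsto (fun t => err t / (t ^ α : ℝ)) (𝓝[>] 0) (𝓝 0) := by
    rw [Metric.tendsto_nhds]
    intro ε hε
    obtain ⟨δ, hδ, h⟩ := exists_norm_complexPGF_sub_le h1 h2 hT hp (half_pos hε)
    filter_upwards [Ioo_mem_nhdsGT hδ] with t ht
    have hta : 0 < t ^ α := Real.rpow_pos_of_pos ht.1 _
    have h3 := h (1 + r * d t) (hwn t) (by
      rw [add_sub_cancel_left]; exact (hdt t ht.1).trans_lt ht.2)
    rw [dist_zero_right, norm_div, Complex.norm_real, Real.norm_of_nonneg hta.le, div_lt_iff₀ hta]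
    refine h3.trans_lt ?_
    have h4 : ‖1 + (r : ℂ) * d t - 1‖ ^ α ≤ t ^ α := by
      rw [add_sub_cancel_left]
      exact Real.rpow_le_rpow (norm_nonneg _) (hdt t ht.1) (by linarith)
    nlinarith
  have hq : Tendsto (fun t : ℝ => d t / t) (𝓝[>] 0) (𝓝 Complex.I) := tendsto_cexp_sub_one_div
  have hd0 : Tendsto d (𝓝[>] 0) (𝓝 0) := by
    have : Continuous d := by fun_prop
    have := this.tendsto 0
    simp only [hd, Complex.ofReal_zero, zero_mul, Complex.exp_zero, sub_self] at this
    exact this.mono_left nhdsWithin_le_nhds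
  have hpow : Tendsto (fun t : ℝ => ((t ^ (2 - α) : ℝ) : ℂ)) (𝓝[>] 0) (𝓝 0) := by
    have := (Real.continuous_rpow_const (q := 2 - α) (by linarith)).tendsto 0
    rw [Real.zero_rpow (by linarith)] at this
    have := (Complex.continuous_ofReal.tendsto 0).comp
      (this.mono_left (nhdsWithin_le_nhds (s := Ioi 0)))
    simpa [Function.comp_def] using this
  have hexp : Tendsto (fun t : ℝ => Complex.exp (-(t * Complex.I))) (𝓝[>] 0) (𝓝 1) := by
    have : Continuous fun t : ℝ => Complex.exp (-(t * Complex.I)) := by fun_prop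
    have := this.tendsto 0
    simp only [Complex.ofReal_zero, zero_mul, neg_zero, Complex.exp_zero] at this
    exact this.mono_left nhdsWithin_le_nhds
  have hqp : Tendsto (fun t : ℝ => (-((r : ℂ) * (d t / t))) ^ (α : ℂ)) (𝓝[>] 0)
      (𝓝 ((-((r : ℂ) * Complex.I)) ^ (α : ℂ))) := by
    refine ((hq.const_mul (r : ℂ)).neg).cpow tendsto_const_nhds (Or.inr ?_)
    simpa using hr.1.ne'
  have hlim := hexp.mul (((hq.pow 2).mul hpow).const_mul (ρ * z * r : ℂ) |>.add
    (((hd0.const_mul (ρ : ℂ)).const_add 1).mul ((hqp.const_mul (C : ℂ)).add herr0)))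
  have e : (1 : ℂ) * (ρ * z * r * (Complex.I ^ 2 * 0) + (1 + ρ * 0) *
      (C * (-((r : ℂ) * Complex.I)) ^ (α : ℂ) + 0)) = C * (-((r : ℂ) * Complex.I)) ^ (α : ℂ) := by
    ring
  rw [e] at hlim
  refine hlim.congr' ?_
  have hne : ∀ᶠ t : ℝ in 𝓝[>] 0, -((r : ℂ) * (d t / t)) ≠ 0 := by
    refine ((hq.const_mul (r : ℂ)).neg).eventually_ne ?_
    simpa using hr.1.ne'
  filter_upwards [hne, self_mem_nhdsWithin] with t hne (ht : 0 < t)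
  have hta : ((t ^ α : ℝ) : ℂ) ≠ 0 := by exact_mod_cast (Real.rpow_pos_of_pos ht α).ne'
  have htc : (t : ℂ) ≠ 0 := by exact_mod_cast ht.ne'
  have e1 : ((t ^ (2 - α) : ℝ) : ℂ) = (t : ℂ) ^ 2 / (t ^ α : ℝ) := by
    rw [Real.rpow_sub ht, Real.rpow_two]; push_cast; rfl
  have e2 : (-((r : ℂ) * (d t / t))) ^ (α : ℂ) =
      (1 - (1 + (r : ℂ) * d t)) ^ (α : ℂ) / (t ^ α : ℝ) := by
    rw [eq_div_iff hta, mul_comm, ← ofReal_mul_cpow ht hne]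
    congr 1
    field_simp
    ring
  have e3 : Complex.exp (-(t * Complex.I)) * (1 + d t) = 1 := by
    simp only [hd]
    rw [add_sub_cancel, ← Complex.exp_add]; simp
  have hm' : (ρ : ℂ) + r * z = 1 := by exact_mod_cast hm
  have e4 : offspringChar p ρ r t = 1 + d t + ρ * z * r * d t ^ 2 +
      (1 + ρ * d t) * (C * (1 - (1 + (r : ℂ) * d t)) ^ (α : ℂ) + err t) := by
    have e5 : complexPGF p (1 - r + r * Complex.exp (t * Complex.I)) = 1 + z * r * d t +
        (C * (1 - (1 + (r : ℂ) * d t)) ^ (α : ℂ) + err t) := by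
      have : (1 : ℂ) - r + r * Complex.exp (t * Complex.I) = 1 + r * d t := by
        simp only [hd]; ring
      rw [this, herr]
      ring
    rw [offspringChar, e5]
    have e6 : Complex.exp (t * Complex.I) = 1 + d t := by simp only [hd]; ring
    rw [e6]
    linear_combination d t * hm'
  have e7 : (d t / t) ^ 2 * ((t : ℂ) ^ 2 / (t ^ α : ℝ)) = d t ^ 2 / (t ^ α : ℝ) := by
    field_simp
  rw [e1, e2, e4, e7, eq_div_iff hta]
  field_simp
  linear_combination -e3

include hρ hr hm in
-- Near `0` the expansion gives `|χ|² ≤ 1 - t^α Re S`. From `δ` on, the Bernoulli bound suffices,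
-- because `t² ≥ δ^{2 - α} t^α` there.
lemma exists_norm_offspringChar_le_exp (hD : 0 < D) :
    ∃ c > 0, ∀ t : ℝ, |t| ≤ Real.pi → ‖offspringChar p ρ r t‖ ≤ Real.exp (-(c * |t| ^ α)) := by
  have hs : 0 < D * Real.Gamma (-α) * r ^ α :=
    mul_pos (mul_pos hD (gamma_neg_pos h1 h2)) (Real.rpow_pos_of_pos hr.1 _)
  have hS := stableExponent_re_pos h1 h2 hs
  have hlim := tendsto_offspringChar_sub_one_div h1 h2 hT hp hr hm
  set S := stableExponent α (D * Real.Gamma (-α) * r ^ α) with hSdef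
  set W : ℝ → ℂ := fun t => (offspringChar p ρ r t * Complex.exp (-(t * Complex.I)) - 1) /
      (t ^ α : ℝ) with hW
  have hta : Tendsto (fun t : ℝ => t ^ α) (𝓝[>] 0) (𝓝 0) := by
    have := (Real.continuous_rpow_const (q := α) (by linarith)).tendsto 0
    rw [Real.zero_rpow (by linarith)] at this
    exact this.mono_left nhdsWithin_le_nhds
  have hquad : Tendsto (fun t => 2 * (W t).re + t ^ α * ‖W t‖ ^ 2) (𝓝[>] 0)
      (𝓝 (2 * (-S).re + 0 * ‖-S‖ ^ 2)) :=
    (((Complex.continuous_re.tendsto _).comp hlim).const_mul 2).add (hta.mul (hlim.norm.pow 2))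
  have hev : ∀ᶠ t : ℝ in 𝓝[>] 0, 2 * (W t).re + t ^ α * ‖W t‖ ^ 2 < -S.re :=
    hquad.eventually_lt_const (by simp only [Complex.neg_re]; linarith)
  obtain ⟨δ, hδ, hsub⟩ := (mem_nhdsGT_iff_exists_Ioo_subset).mp hev
  have hδ0 : 0 < δ := hδ
  set c₀ := 2 * ρ * (1 - ρ) / Real.pi ^ 2 with hc₀
  have hc₀0 : 0 < c₀ := by
    have := hρ.1
    have : 0 < 1 - ρ := by linarith [hρ.2]
    positivity
  refine ⟨min (S.re / 2) (c₀ * δ ^ (2 - α)), lt_min (half_pos hS)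
    (mul_pos hc₀0 (Real.rpow_pos_of_pos hδ0 _)), ?_⟩
  have main : ∀ t : ℝ, 0 < t → t ≤ Real.pi → ‖offspringChar p ρ r t‖ ≤
      Real.exp (-(min (S.re / 2) (c₀ * δ ^ (2 - α)) * t ^ α)) := by
    intro t ht0 htπ
    have hpos : 0 < t ^ α := Real.rpow_pos_of_pos ht0 α
    rcases lt_or_ge t δ with ht | ht
    · have hquad' : 2 * (W t).re + t ^ α * ‖W t‖ ^ 2 < -S.re := hsub ⟨ht0, ht⟩
      have hta' : ((t ^ α : ℝ) : ℂ) ≠ 0 := by exact_mod_cast hpos.ne'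
      have e : offspringChar p ρ r t * Complex.exp (-(t * Complex.I)) = 1 + (t ^ α : ℝ) * W t := by
        simp only [hW]
        field_simp
        ring
      have hn : ‖offspringChar p ρ r t‖ ^ 2 = 1 + t ^ α * (2 * (W t).re + t ^ α * ‖W t‖ ^ 2) := by
        have h3 : ‖offspringChar p ρ r t‖ = ‖1 + (t ^ α : ℝ) * W t‖ := by
          rw [← e, norm_mul, ← neg_mul, ← Complex.ofReal_neg, norm_cexp_ofReal_mul_I', mul_one]
        rw [h3, ← Complex.normSq_eq_norm_sq, ← Complex.normSq_eq_norm_sq, Complex.normSq_apply,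
          Complex.normSq_apply]
        simp only [Complex.add_re, Complex.one_re, Complex.re_ofReal_mul, Complex.add_im,
          Complex.one_im, Complex.im_ofReal_mul]
        ring
      refine le_of_sq_le_sq ?_ (Real.exp_pos _).le
      rw [hn, ← Real.exp_nat_mul]
      have h4 := min_le_left (S.re / 2) (c₀ * δ ^ (2 - α))
      calc 1 + t ^ α * (2 * (W t).re + t ^ α * ‖W t‖ ^ 2) ≤ 1 + t ^ α * (-S.re) := by
            have := mul_le_mul_of_nonneg_left hquad'.le hpos.le
            linarith
        _ ≤ Real.exp (t ^ α * (-S.re)) := by linarith [Real.add_one_le_exp (t ^ α * (-S.re))]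
        _ ≤ _ := by
            refine Real.exp_le_exp.mpr ?_
            push_cast
            nlinarith
    · refine (norm_offspringChar_le hp ⟨hρ.1.le, hρ.2.le⟩ ⟨hr.1.le, hr.2.le⟩
        (by rwa [abs_of_pos ht0])).trans (Real.exp_le_exp.mpr ?_)
      have h4 := min_le_right (S.re / 2) (c₀ * δ ^ (2 - α))
      have h5 : t ^ 2 = t ^ (2 - α) * t ^ α := by
        rw [← Real.rpow_add ht0, ← Real.rpow_natCast]; norm_num
      have h6 : δ ^ (2 - α) ≤ t ^ (2 - α) := Real.rpow_le_rpow hδ0.le ht (by linarith)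
      rw [← hc₀, h5]
      have h7 := mul_le_mul_of_nonneg_right (h4.trans (mul_le_mul_of_nonneg_left h6 hc₀0.le)) hpos.le
      linarith
  intro t ht
  rcases lt_trichotomy t 0 with h | rfl | h
  · have := main (-t) (by linarith) (by rwa [abs_of_neg h] at ht)
    rw [offspringChar_neg, Complex.norm_conj] at this
    rwa [abs_of_neg h]
  · have := norm_offspringChar_le hp (t := 0) ⟨hρ.1.le, hρ.2.le⟩ ⟨hr.1.le, hr.2.le⟩ ht
    simpa [Real.zero_rpow (by linarith : α ≠ 0)] using this
  · have := main t h (by rwa [abs_of_pos h] at ht)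
    rwa [abs_of_pos h]

end PowerTail

lemma integrable_exp_neg_mul_abs_rpow {α c : ℝ} (hα : 0 < α) (hc : 0 < c) :
    Integrable fun u : ℝ => Real.exp (-(c * |u| ^ α)) := by
  have h := integral_comp_abs (f := fun u : ℝ => Real.exp (-(c * u ^ α)))
  -- A non-integrable function has integral `0` by convention, so a positive value of the integral
  -- proves integrability.
  refine Integrable.of_integral_ne_zero ?_
  rw [h]
  simp only [← neg_mul]
  rw [integral_exp_neg_mul_rpow hα hc]
  have : 0 < Real.Gamma (1 / α + 1) := Real.Gamma_pos_of_pos (by positivity)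
  positivity

/-- The characteristic function of the spectrally one-sided stable law with exponent `S`. -/
def stableChar (α : ℝ) (S : ℂ) (u : ℝ) : ℂ :=
  if 0 < u then Complex.exp (-(S * (u ^ α : ℝ)))
  else (starRingEnd ℂ) (Complex.exp (-(S * ((-u) ^ α : ℝ))))

lemma norm_stableChar (α : ℝ) (S : ℂ) (u : ℝ) :
    ‖stableChar α S u‖ = Real.exp (-(S.re * |u| ^ α)) := by
  unfold stableChar
  split_ifs with h
  · rw [Complex.norm_exp, abs_of_pos h]; simp
  · rw [Complex.norm_conj, Complex.norm_exp, abs_of_nonpos (not_lt.mp h)]; simp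

lemma integrable_stableChar {α : ℝ} (hα : 0 < α) {S : ℂ} (hS : 0 < S.re) :
    Integrable (stableChar α S) := by
  refine (integrable_exp_neg_mul_abs_rpow hα hS).mono' ?_
    (ae_of_all _ fun u => (norm_stableChar α S u).le)
  refine (Measurable.ite measurableSet_Ioi ?_ ?_).aestronglyMeasurable
  · fun_prop
  · exact Complex.continuous_conj.measurable.comp (by fun_prop)

lemma integral_stableChar {α : ℝ} (hα : 0 < α) {S : ℂ} (hS : 0 < S.re) :
    ∫ u, stableChar α S u =
      ((2 * ((S ^ ((-1 / α : ℝ) : ℂ)).re * Real.Gamma (1 / α + 1)) : ℝ) : ℂ) := by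
  have hi := integrable_stableChar hα hS
  rw [← intervalIntegral.integral_Iic_add_Ioi (b := 0) hi.integrableOn hi.integrableOn]
  have e1 : ∫ u in Ioi (0 : ℝ), stableChar α S u =
      S ^ ((-1 / α : ℝ) : ℂ) * Real.Gamma (1 / α + 1) := by
    rw [← integral_cexp_neg_mul_rpow hα hS]
    exact setIntegral_congr_fun measurableSet_Ioi fun u (hu : 0 < u) => if_pos hu
  have e2 : ∫ u in Iic (0 : ℝ), stableChar α S u =
      (starRingEnd ℂ) (S ^ ((-1 / α : ℝ) : ℂ) * Real.Gamma (1 / α + 1)) := by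
    rw [← integral_cexp_neg_mul_rpow hα hS, ← integral_conj]
    have := integral_comp_neg_Iic (0 : ℝ)
      fun u : ℝ => (starRingEnd ℂ) (Complex.exp (-(S * (u ^ α : ℝ))))
    rw [neg_zero] at this
    rw [← this]
    exact setIntegral_congr_fun measurableSet_Iic fun u (hu : u ≤ 0) => if_neg (not_lt.mpr hu)
  rw [e1, e2, add_comm, Complex.add_conj, Complex.re_mul_ofReal]

section PowerTail

variable {p : ℕ → ℝ} {α D : ℝ} (h1 : 1 < α) (h2 : α < 2)
  (hT : Tendsto (fun k : ℕ => p k * (k : ℝ) ^ (α + 1)) atTop (𝓝 D))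
  (hp : IsOutDegreeDistribution p)
include h1 h2 hT hp

lemma tendsto_offspringChar_pow {ρ r : ℝ} (hr : r ∈ Ioo (0 : ℝ) 1) (hm : ρ + r * meanDegree p = 1)
    (u : ℝ) :
    Tendsto (fun n : ℕ => (offspringChar p ρ r (u / (n : ℝ) ^ (1 / α)) *
      Complex.exp (-(((1 : ℝ) : ℂ) * (u / (n : ℝ) ^ (1 / α) : ℝ) * Complex.I))) ^ n) atTop
      (𝓝 (stableChar α (stableExponent α (D * Real.Gamma (-α) * r ^ α)) u)) := by
  have hα : 0 < α := by linarith
  set S := stableExponent α (D * Real.Gamma (-α) * r ^ α) with hS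
  have hL : Tendsto (fun n : ℕ => (n : ℝ) ^ (1 / α)) atTop atTop :=
    (tendsto_rpow_atTop (by positivity)).comp tendsto_natCast_atTop_atTop
  have main : ∀ u : ℝ, 0 < u → Tendsto (fun n : ℕ => (offspringChar p ρ r (u / (n : ℝ) ^ (1 / α)) *
      Complex.exp (-(((1 : ℝ) : ℂ) * (u / (n : ℝ) ^ (1 / α) : ℝ) * Complex.I))) ^ n) atTop
      (𝓝 (Complex.exp (-(S * (u ^ α : ℝ))))) := by
    intro u hu
    have ht : Tendsto (fun n : ℕ => u / (n : ℝ) ^ (1 / α)) atTop (𝓝[>] 0) := by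
      refine tendsto_nhdsWithin_iff.mpr ⟨hL.const_div_atTop u, ?_⟩
      filter_upwards [hL.eventually_gt_atTop 0] with n hn using div_pos hu hn
    have h3 := ((tendsto_offspringChar_sub_one_div h1 h2 hT hp hr hm).comp ht).const_mul
      ((u ^ α : ℝ) : ℂ)
    have h4 := tendsto_one_add_pow_exp_filter (n := fun n : ℕ => n) (l := atTop) tendsto_id
      (g := fun n : ℕ => offspringChar p ρ r (u / (n : ℝ) ^ (1 / α)) *
      Complex.exp (-(((1 : ℝ) : ℂ) * (u / (n : ℝ) ^ (1 / α) : ℝ) * Complex.I)) - 1)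
      (t := -(S * (u ^ α : ℝ))) ?_
    · simpa using h4
    · rw [show (-(S * (u ^ α : ℝ)) : ℂ) = (u ^ α : ℝ) * -S by ring]
      refine h3.congr' ?_
      filter_upwards [eventually_gt_atTop 0] with n hn
      have hn' : (0 : ℝ) < n := by exact_mod_cast hn
      have e : (u / (n : ℝ) ^ (1 / α)) ^ α = u ^ α / n := by
        rw [Real.div_rpow hu.le (by positivity), ← Real.rpow_mul hn'.le, one_div,
          inv_mul_cancel₀ hα.ne', Real.rpow_one]
      have hua : ((u ^ α : ℝ) : ℂ) ≠ 0 := by exact_mod_cast (Real.rpow_pos_of_pos hu α).ne'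
      have hnc : (n : ℂ) ≠ 0 := by exact_mod_cast hn.ne'
      simp only [Function.comp_apply]
      rw [e, Complex.ofReal_one, one_mul, show ((u ^ α / n : ℝ) : ℂ) = (u ^ α : ℝ) / (n : ℂ) by
        rw [Complex.ofReal_div, Complex.ofReal_natCast]]
      field_simp
  rcases lt_trichotomy u 0 with h | rfl | h
  · rw [stableChar, if_neg (by linarith)]
    have := (Complex.continuous_conj.tendsto _).comp (main (-u) (by linarith))
    refine this.congr fun n => ?_
    simp only [Function.comp_apply]
    rw [map_pow, map_mul, neg_div, offspringChar_neg, Complex.conj_conj, ← Complex.exp_conj]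
    simp
  · have e : stableChar α S 0 = 1 := by
      simp [stableChar, Real.zero_rpow hα.ne']
    have e0 : offspringChar p ρ r 0 = 1 := by
      have : complexPGF p 1 = 1 := by
        have := degreePGF_ofReal p 1
        rw [degreePGF_one hp] at this
        exact_mod_cast this.symm
      simp [offspringChar, this]
    rw [e]
    simp [e0]
  · rw [stableChar, if_pos h]
    exact main u h

/-- The local limit theorem at the mean for an offspring law in the domain of attraction of a
one-sided stable law. -/
lemma tendsto_coeff_offspringSeries_stable (hD : 0 < D) {ρ r : ℝ} (hρ : ρ ∈ Ioo (0 : ℝ) 1)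
    (hr : r ∈ Ioo (0 : ℝ) 1) (hm : ρ + r * meanDegree p = 1) :
    Tendsto (fun n : ℕ => (n : ℝ) ^ (1 / α) *
      PowerSeries.coeff (n - 1) (offspringSeries p ρ r ^ n)) atTop
      (𝓝 (-((D * Real.Gamma (-α) * r ^ α) ^ (-1 / α) / Real.Gamma (-1 / α)))) := by
  have hα : 0 < α := by linarith
  have hs : 0 < D * Real.Gamma (-α) * r ^ α :=
    mul_pos (mul_pos hD (gamma_neg_pos h1 h2)) (Real.rpow_pos_of_pos hr.1 _)
  have hSre := stableExponent_re_pos h1 h2 hs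
  have hlim := tendsto_offspringChar_pow h1 h2 hT hp hr hm
  have hcpow := re_stableExponent_cpow h1 h2 hs
  set s := D * Real.Gamma (-α) * r ^ α with hsdef
  set S := stableExponent α s with hS
  obtain ⟨c, hc, hbd⟩ := exists_norm_offspringChar_le_exp h1 h2 hT hp hρ hr hm hD
  have hL : Tendsto (fun n : ℕ => (n : ℝ) ^ (1 / α)) atTop atTop :=
    (tendsto_rpow_atTop (by positivity)).comp tendsto_natCast_atTop_atTop
  have main := tendsto_scaled_coeff (l := atTop) (P := fun _ : ℕ => offspringSeries p ρ r)
    (χ := fun _ => offspringChar p ρ r) (n := fun n => n) (L := fun n : ℕ => (n : ℝ) ^ (1 / α))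
    (m := fun _ => 1) (ψ := stableChar α S) (g := fun u => Real.exp (-(c * |u| ^ α))) tendsto_id hL
    (Eventually.of_forall fun _ t => sumsTo_offspringChar hp ρ ⟨hr.1.le, hr.2.le⟩ t)
    (integrable_exp_neg_mul_abs_rpow hα hc) ?_ (fun u => (Real.exp_pos _).le)
    (integrable_stableChar hα hSre) hlim
  · have hre := (Complex.continuous_re.tendsto 0).comp main
    have hconst : (2 * (Real.pi : ℂ))⁻¹ * ∫ u, stableChar α S u =
        ((-(s ^ (-1 / α) / Real.Gamma (-1 / α)) : ℝ) : ℂ) := by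
      rw [integral_stableChar hα hSre, hcpow]
      -- The reflection formula, `Γ(-1/α) Γ(1 + 1/α) = -π / sin(π/α)`, absorbs the sine and the `π`
      -- of the inversion and brings in the minus sign of `B`.
      have hG := Real.Gamma_mul_Gamma_one_sub (-1 / α)
      have hsin : 0 < Real.sin (Real.pi / α) := by
        refine Real.sin_pos_of_pos_of_lt_pi (by positivity) ?_
        rw [div_lt_iff₀ hα]
        nlinarith [Real.pi_pos]
      have e : Real.pi * (-1 / α) = -(Real.pi / α) := by ring
      rw [e, Real.sin_neg, show 1 - -1 / α = 1 / α + 1 by ring] at hG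
      have hG0 : Real.Gamma (-1 / α) ≠ 0 := by
        intro h0
        rw [h0, zero_mul, eq_comm, div_eq_zero_iff] at hG
        rcases hG with h | h
        · exact Real.pi_ne_zero h
        · linarith
      rw [show (2 * (Real.pi : ℂ))⁻¹ = (((2 * Real.pi)⁻¹ : ℝ) : ℂ) by push_cast; rfl,
        ← Complex.ofReal_mul]
      congr 1
      have hG' : Real.Gamma (-1 / α) * Real.Gamma (1 / α + 1) * Real.sin (Real.pi / α) =
          -Real.pi := by
        rw [hG]; field_simp
      have hpi := Real.pi_ne_zero
      rw [← neg_div, eq_div_iff hG0]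
      have hpi' : Real.pi⁻¹ * Real.pi = 1 := inv_mul_cancel₀ hpi
      rw [mul_inv]
      linear_combination Real.pi⁻¹ * s ^ (-1 / α) * hG' - s ^ (-1 / α) * hpi'
    rw [← tendsto_sub_nhds_zero_iff]
    refine hre.congr fun n => ?_
    simp only [Function.comp_apply, sub_self, mul_zero, zero_div, Complex.ofReal_zero, zero_mul,
      neg_zero, Complex.exp_zero, mul_one]
    rw [hconst, ← Complex.ofReal_mul, ← Complex.ofReal_sub, Complex.ofReal_re]
  · filter_upwards [eventually_gt_atTop 0] with n hn u hu
    have hn' : (0 : ℝ) < n := by exact_mod_cast hn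
    have hLn : 0 < (n : ℝ) ^ (1 / α) := Real.rpow_pos_of_pos hn' _
    have ht : |u / (n : ℝ) ^ (1 / α)| ≤ Real.pi := by
      rw [abs_div, abs_of_pos hLn, div_le_iff₀ hLn]; exact hu
    refine (pow_le_pow_left₀ (norm_nonneg _) (hbd _ ht) n).trans_eq ?_
    rw [← Real.exp_nat_mul, abs_div, abs_of_pos hLn, Real.div_rpow (abs_nonneg u) hLn.le,
      ← Real.rpow_mul hn'.le, one_div, inv_mul_cancel₀ hα.ne', Real.rpow_one]
    congr 1
    field_simp

end PowerTail

/-! ### Power-law out-degrees without innovation. -/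

lemma HasPowerTail.tendsto {p : ℕ → ℝ} {D γ : ℝ} (h : HasPowerTail p D γ) (hD : D ≠ 0) :
    Tendsto (fun k : ℕ => p k * (k : ℝ) ^ γ) atTop (𝓝 D) := by
  have hne : ∀ᶠ k : ℕ in atTop, D * (k : ℝ) ^ (-γ) ≠ 0 := by
    filter_upwards [eventually_gt_atTop 0] with k hk
    exact mul_ne_zero hD (Real.rpow_pos_of_pos (by exact_mod_cast hk) _).ne'
  have h' := ((isEquivalent_iff_tendsto_one hne).mp h).const_mul D
  rw [mul_one] at h'
  refine h'.congr' ?_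
  filter_upwards [eventually_gt_atTop 0] with k hk
  have hk' : (0 : ℝ) < k := by exact_mod_cast hk
  have := (Real.rpow_pos_of_pos hk' γ).ne'
  rw [Pi.div_apply, Real.rpow_neg hk'.le]
  field_simp

lemma isEquivalent_mul_rpow_of_tendsto {q : ℕ → ℝ} {B β : ℝ} (hB : B ≠ 0)
    (h : Tendsto (fun n : ℕ => q n * (n : ℝ) ^ β) atTop (𝓝 B)) :
    q ~[atTop] fun n : ℕ => B * (n : ℝ) ^ (-β) := by
  refine isEquivalent_of_tendsto_one ?_
  have h' := h.div_const B
  rw [div_self hB] at h'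
  refine h'.congr' ?_
  filter_upwards [eventually_gt_atTop 0] with k hk
  have hk' : (0 : ℝ) < k := by exact_mod_cast hk
  have := (Real.rpow_pos_of_pos hk' β).ne'
  rw [Pi.div_apply, Real.rpow_neg hk'.le]
  field_simp

/-- Critical case, power-law out-degrees. -/
lemma progeny_isEquivalent_of_hasPowerTail {p : ℕ → ℝ} (hp : IsOutDegreeDistribution p) {lam : ℝ}
    (h0 : 0 < lam) (h1 : lam ≤ 1) {D γ : ℝ} (hD : 0 < D) (hγ2 : 2 < γ) (hγ3 : γ < 3)
    (htail : HasPowerTail p D γ) :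
    progeny p lam 0 ~[atTop] fun n : ℕ => prefactorB p lam D γ * (n : ℝ) ^ (-(γ / (γ - 1))) := by
  have hα1 : 1 < γ - 1 := by linarith
  have hα2 : γ - 1 < 2 := by linarith
  have hα : 0 < γ - 1 := by linarith
  have hT : Tendsto (fun k : ℕ => p k * (k : ℝ) ^ (γ - 1 + 1)) atTop (𝓝 D) := by
    simpa using htail.tendsto hD.ne'
  have hz := lam_mul_mean_pos hp h0
  have hr := lam_mul_reshareProb_mem hp h0 h1 le_rfl one_pos
  have hρ := mul_reshareProb (μ := 0) hp h0
  have h := tendsto_coeff_offspringSeries_stable hα1 hα2 hT hp hD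
    ⟨reshareProb_pos hp h0 one_pos, reshareProb_lt_one hp h0 le_rfl⟩ hr (by linear_combination hρ)
  have hr' : lam * reshareProb p lam 0 = lam / (lam * meanDegree p + 1) := by
    rw [reshareProb]; ring
  have hs : 0 < D * Real.Gamma (-(γ - 1)) := mul_pos hD (gamma_neg_pos hα1 hα2)
  -- The argument lies strictly between `-1` and `0`, so it is no pole.
  have hGne : Real.Gamma (-1 / (γ - 1)) ≠ 0 := by
    refine Real.Gamma_ne_zero fun m hm => ?_
    have h3 : (0 : ℝ) < 1 / (γ - 1) := by positivity
    have h4 : 1 / (γ - 1) < 1 := by rw [div_lt_one hα]; exact hα1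
    have h5 : 1 / (γ - 1) = m := by rw [neg_div] at hm; linarith
    rw [h5] at h3 h4
    have h6 : 0 < m := by exact_mod_cast h3
    have h7 : m < 1 := by exact_mod_cast h4
    omega
  have hB : -((D * Real.Gamma (-(γ - 1)) * (lam * reshareProb p lam 0) ^ (γ - 1)) ^
      (-1 / (γ - 1)) / Real.Gamma (-1 / (γ - 1))) = prefactorB p lam D γ := by
    rw [prefactorB, Real.mul_rpow hs.le (Real.rpow_nonneg hr.1.le _), ← Real.rpow_mul hr.1.le,
      show (γ - 1) * (-1 / (γ - 1)) = -1 by field_simp, Real.rpow_neg_one, hr', inv_div,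
      show -(γ - 1) = 1 - γ by ring, show 1 / (1 - γ) = -1 / (γ - 1) by
        rw [← neg_sub γ 1, div_neg, neg_div], show -(1 / (γ - 1)) = -1 / (γ - 1) by ring]
    field_simp
  rw [hB] at h
  have hB0 : prefactorB p lam D γ ≠ 0 := by
    rw [← hB]
    exact neg_ne_zero.mpr (div_ne_zero (Real.rpow_pos_of_pos
      (mul_pos hs (Real.rpow_pos_of_pos hr.1 _)) _).ne' hGne)
  refine isEquivalent_mul_rpow_of_tendsto hB0 (h.congr' ?_)
  filter_upwards [eventually_ge_atTop 1] with n hn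
  have hn' : (0 : ℝ) < n := by exact_mod_cast hn
  have e := mul_progeny p lam 0 hn
  rw [childSeries] at e
  rw [← e, show γ / (γ - 1) = 1 / (γ - 1) + 1 by field_simp; ring, Real.rpow_add hn', Real.rpow_one]
  ring

/-! ### Tail and mean of the offspring law for power-law out-degrees. -/

lemma summable_rpow_mul_of_tendsto {a : ℕ → ℝ} {γ c τ : ℝ} (hτ : τ + 1 < γ)
    (ha : Tendsto (fun k : ℕ => a k * (k : ℝ) ^ γ) atTop (𝓝 c)) :
    Summable fun k : ℕ => (k : ℝ) ^ τ * a k := by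
  have h2 := (ha.isBigO_one ℝ).mul (isBigO_refl (fun k : ℕ => (k : ℝ) ^ (-γ + τ)) atTop)
  refine summable_of_isBigO_nat (Real.summable_nat_rpow (p := -γ + τ).mpr (by linarith)) ?_
  refine h2.congr' ?_ (Eventually.of_forall fun k => one_mul _)
  filter_upwards [eventually_gt_atTop 0] with k hk
  have hk' : (0 : ℝ) < k := by exact_mod_cast hk
  rw [mul_assoc, ← Real.rpow_add hk', mul_comm]
  congr 2
  ring

/-- The mean is the left derivative of the generating function at `1`. The difference quotients are
geometric sums, dominated by `k a_k`. -/
lemma tendsto_tsum_sub_div_one_sub {a : ℕ → ℝ} (ha0 : ∀ k, 0 ≤ a k) (ha : Summable a)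
    (ha1 : Summable fun k : ℕ => (k : ℝ) * a k) :
    Tendsto (fun x : ℝ => (∑' k, a k - ∑' k, a k * x ^ k) / (1 - x)) (𝓝[<] 1)
      (𝓝 (∑' k : ℕ, (k : ℝ) * a k)) := by
  have h := tendsto_tsum_of_dominated_convergence (𝓕 := 𝓝[<] (1 : ℝ))
    (f := fun (x : ℝ) (k : ℕ) => a k * ∑ i ∈ Finset.range k, x ^ i)
    (g := fun k : ℕ => (k : ℝ) * a k) ha1 (fun k => ?_) ?_
  · refine h.congr' ?_
    filter_upwards [Ioo_mem_nhdsLT (zero_lt_one' ℝ)] with x hx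
    have hx1 : 1 - x ≠ 0 := by linarith [hx.2]
    have hs : Summable fun k => a k * x ^ k := ha.of_nonneg_of_le
      (fun k => mul_nonneg (ha0 k) (pow_nonneg hx.1.le k))
      fun k => mul_le_of_le_one_right (ha0 k) (pow_le_one₀ hx.1.le hx.2.le)
    rw [← ha.tsum_sub hs, ← tsum_div_const]
    refine tsum_congr fun k => ?_
    have := mul_geom_sum x k
    rw [eq_div_iff hx1]
    linear_combination -(a k) * this
  · have hc : Continuous fun x : ℝ => a k * ∑ i ∈ Finset.range k, x ^ i := by fun_prop
    have := (hc.tendsto 1).mono_left (nhdsWithin_le_nhds (s := Iio 1))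
    simpa [mul_comm] using this
  · filter_upwards [Ioo_mem_nhdsLT (zero_lt_one' ℝ)] with x hx k
    rw [Real.norm_of_nonneg (mul_nonneg (ha0 k) (Finset.sum_nonneg fun i _ =>
      pow_nonneg hx.1.le i)), mul_comm]
    refine mul_le_mul_of_nonneg_right ?_ (ha0 k)
    exact (Finset.sum_le_card_nsmul _ _ 1 fun i _ => pow_le_one₀ hx.1.le hx.2.le).trans (by simp)

section Thinning

variable {α r : ℝ} (h1 : 1 < α) (h2 : α < 2) (hr : r ∈ Ioo (0 : ℝ) 1)
include h1 h2 hr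

/-- Since `1 - (1 - r + rw) = r(1 - w)`, the function `(1 - w)^α` is an eigenfunction of thinning
with eigenvalue `r^α`. -/
lemma thinning_oneSubPowCoeff (k : ℕ) :
    thinning (oneSubPowCoeff α) r k = r ^ α * oneSubPowCoeff α k := by
  have hα : 0 < α := by linarith
  have hne := ne_natCast_of_one_lt_of_lt_two h1 h2
  have hF : ∀ v : ℝ, v ∈ Icc (0 : ℝ) 1 → HasSum (fun k => oneSubPowCoeff α k * v ^ k)
      ((1 - v) ^ α) := by
    intro v hv
    have h := hasSum_oneSubPowCoeff hα hne (w := v)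
      (by rw [Complex.norm_real, Real.norm_of_nonneg hv.1]; exact hv.2)
    rw [← Complex.ofReal_one, ← Complex.ofReal_sub, ← Complex.ofReal_cpow (by linarith [hv.2])] at h
    exact_mod_cast h
  have h := powerSeries_coeff_unique (u := thinning (oneSubPowCoeff α) r)
    (v := fun k => r ^ α * oneSubPowCoeff α k) (F := fun w => r ^ α * (1 - w) ^ α) ?_ ?_
  · exact congrFun h k
  · intro w hw
    have hv : 1 - r + r * w ∈ Icc (0 : ℝ) 1 := by
      constructor
      · nlinarith [hw.1, hr.1, hr.2]
      · nlinarith [hw.2, hr.1]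
    have hs := (sumsTo_thinning (p := oneSubPowCoeff α) hr.1.le hr.2.le (s := 1)
      (by simpa using summable_abs_oneSubPowCoeff hα hne) (w := w)
      (by rw [Complex.norm_real, Real.norm_of_nonneg hw.1.le]; exact hw.2.le)).hasSum
    have e : (1 - (r : ℂ) + r * w) = ((1 - r + r * w : ℝ) : ℂ) := by push_cast; ring
    rw [e, ← degreePGF_ofReal, degreePGF, (hF _ hv).tsum_eq] at hs
    rw [show 1 - (1 - r + r * w) = r * (1 - w) by ring,
      Real.mul_rpow hr.1.le (by linarith [hw.2])] at hs
    simp only [PowerSeries.coeff_mk] at hs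
    exact_mod_cast hs
  · intro w hw
    have := (hF w ⟨hw.1.le, hw.2.le⟩).mul_left (r ^ α)
    simpa only [mul_assoc] using this

variable {p : ℕ → ℝ} {D : ℝ} (hp : IsOutDegreeDistribution p)
  (hT : Tendsto (fun k : ℕ => p k * (k : ℝ) ^ (α + 1)) atTop (𝓝 D))
include hp hT

/-- The thinning kernel is non-negative and lives on `j ≥ k`, so for `k ≥ N` the comparison `|p_j -
C b_j| ≤ ε b_j` passes to the thinned sequences, and thinning acts on `b` as a scalar. -/
lemma tendsto_thinning_mul_rpow :
    Tendsto (fun k : ℕ => thinning p r k * (k : ℝ) ^ (α + 1)) atTop (𝓝 (D * r ^ α)) := by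
  have hα : 0 < α := by linarith
  have hne := ne_natCast_of_one_lt_of_lt_two h1 h2
  have hΓ := gamma_neg_pos h1 h2
  have hra : 0 < r ^ α := Real.rpow_pos_of_pos hr.1 _
  set b := oneSubPowCoeff α with hb
  set C := D * Real.Gamma (-α) with hC
  set K : ℕ → ℕ → ℝ := fun j k => (j.choose k : ℝ) * r ^ k * (1 - r) ^ (j - k) with hK
  have h1r : 0 ≤ 1 - r := by linarith [hr.2]
  have hr0 := hr.1.le
  have hK0 : ∀ j k, 0 ≤ K j k := fun j k => by positivity
  have hK1 : ∀ j k, K j k ≤ 1 := by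
    intro j k
    have h := tsum_binomial_real j r (1 - r)
    rw [add_sub_cancel, one_pow] at h
    exact le_hasSum h k fun i _ => hK0 j i
  have hsum : ∀ {q : ℕ → ℝ}, (Summable fun j => |q j|) → ∀ k, Summable fun j => q j * K j k := by
    intro q hq k
    refine Summable.of_norm_bounded hq fun j => ?_
    rw [norm_mul, Real.norm_eq_abs, Real.norm_of_nonneg (hK0 j k)]
    exact mul_le_of_le_one_right (abs_nonneg _) (hK1 j k)
  have hsb := hsum (summable_abs_oneSubPowCoeff hα hne)
  have hsp := hsum hp.summable_abs
  have hth : ∀ k, ∑' j, b j * K j k = r ^ α * b k := fun k => thinning_oneSubPowCoeff h1 h2 hr k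
  have hratio : Tendsto (fun k => thinning p r k / b k) atTop (𝓝 (C * r ^ α)) := by
    rw [Metric.tendsto_atTop]
    intro ε hε
    obtain ⟨N, hN⟩ := exists_abs_sub_oneSubPowCoeff_le h1 h2 hT (ε := ε / 2 / r ^ α) (by positivity)
    refine ⟨max N 2, fun k hk => ?_⟩
    have hbk : 0 < b k := by
      obtain ⟨i, rfl⟩ := Nat.exists_eq_add_of_le' (le_of_max_le_right hk)
      exact oneSubPowCoeff_pos h1 h2 i
    have hdiff : ‖thinning p r k - C * (r ^ α * b k)‖ ≤ ε / 2 / r ^ α * (r ^ α * b k) := by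
      rw [← hth, thinning, ← tsum_mul_left, ← (hsp k).tsum_sub ((hsb k).mul_left C)]
      refine tsum_of_norm_bounded ((hsb k).hasSum.mul_left _) fun j => ?_
      rcases lt_or_ge j k with hjk | hjk
      · have : K j k = 0 := by simp [hK, Nat.choose_eq_zero_of_lt hjk]
        simp [this]
      · have := hN j ((le_of_max_le_left hk).trans hjk)
        rw [← mul_assoc C, ← sub_mul, norm_mul, Real.norm_eq_abs, Real.norm_of_nonneg (hK0 j k),
          ← mul_assoc (ε / 2 / r ^ α)]
        exact mul_le_mul_of_nonneg_right this (hK0 j k)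
    rw [Real.dist_eq, div_sub' hbk.ne', abs_div, abs_of_pos hbk, div_lt_iff₀ hbk]
    rw [Real.norm_eq_abs] at hdiff
    have e1 : thinning p r k - b k * (C * r ^ α) = thinning p r k - C * (r ^ α * b k) := by ring
    have e2 : ε / 2 / r ^ α * (r ^ α * b k) = ε / 2 * b k := by field_simp
    rw [e1]
    rw [e2] at hdiff
    nlinarith
  have h3 := hratio.mul (tendsto_oneSubPowCoeff hne)
  have e : C * r ^ α * (Real.Gamma (-α))⁻¹ = D * r ^ α := by
    rw [hC]; field_simp
  rw [e] at h3
  refine h3.congr' ?_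
  filter_upwards [eventually_ge_atTop 2] with k hk
  obtain ⟨i, rfl⟩ := Nat.exists_eq_add_of_le' hk
  have : 0 < b (i + 2) := oneSubPowCoeff_pos h1 h2 i
  rw [← mul_assoc, div_mul_cancel₀ _ this.ne']

lemma tendsto_coeff_offspringSeries_mul_rpow (ρ : ℝ) :
    Tendsto (fun k : ℕ => PowerSeries.coeff k (offspringSeries p ρ r) * (k : ℝ) ^ (α + 1)) atTop
      (𝓝 (D * r ^ α)) := by
  have h := tendsto_thinning_mul_rpow h1 h2 hr hp hT
  rw [← tendsto_add_atTop_iff_nat 1]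
  have hq : Tendsto (fun n : ℕ => (((n : ℝ) + 1) / n) ^ (α + 1)) atTop (𝓝 1) := by
    simpa using tendsto_add_one_div.rpow_const (p := α + 1) (Or.inl one_ne_zero)
  have h3 := (((tendsto_add_atTop_iff_nat 1).mpr h).const_mul (1 - ρ)).add
    ((h.mul hq).const_mul ρ)
  rw [show (1 - ρ) * (D * r ^ α) + ρ * (D * r ^ α * 1) = D * r ^ α by ring] at h3
  refine h3.congr' ?_
  filter_upwards [eventually_gt_atTop 0] with k hk
  have hk' : (0 : ℝ) < k := by exact_mod_cast hk
  have := (Real.rpow_pos_of_pos hk' (α + 1)).ne'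
  rw [coeff_offspringSeries_succ, Real.div_rpow (by positivity) hk'.le]
  push_cast
  field_simp

end Thinning

section Mean

variable {p : ℕ → ℝ} (hp : IsOutDegreeDistribution p) {lam μ : ℝ} (h0 : 0 < lam) (h1 : lam ≤ 1)
include hp h0 h1

/-- The left derivative at `1` of the product `(1 - ρ + ρw) f(1 - r + rw)` is `ρ + rz`. -/
lemma hasSum_natCast_mul_coeff_childSeries (hμ0 : 0 ≤ μ) (hμ : μ < 1)
    (hs : Summable fun k : ℕ => (k : ℝ) * PowerSeries.coeff k (childSeries p lam μ)) :
    HasSum (fun k : ℕ => (k : ℝ) * PowerSeries.coeff k (childSeries p lam μ)) (1 - μ) := by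
  set ρ := reshareProb p lam μ with hρ
  set r := lam * ρ with hr
  have hrm : r ∈ Ioo (0 : ℝ) 1 := lam_mul_reshareProb_mem hp h0 h1 hμ0 hμ
  have hsum1 := hasSum_coeff_childSeries hp h0 h1 hμ0 hμ
  have hΦ := tendsto_tsum_sub_div_one_sub (coeff_childSeries_nonneg hp h0 h1 hμ0 hμ)
    hsum1.summable hs
  rw [hsum1.tsum_eq] at hΦ
  have hf := tendsto_tsum_sub_div_one_sub hp.nonneg hp.hasSum_one.summable hp.summable_mean
  rw [hp.hasSum_one.tsum_eq] at hf
  have hv : Tendsto (fun w : ℝ => 1 - r + r * w) (𝓝[<] 1) (𝓝[<] 1) := by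
    refine tendsto_nhdsWithin_iff.mpr ⟨?_, ?_⟩
    · have hc : Continuous fun w : ℝ => 1 - r + r * w := by fun_prop
      have := (hc.tendsto 1).mono_left (nhdsWithin_le_nhds (s := Iio 1))
      simpa using this
    · filter_upwards [self_mem_nhdsWithin] with w (hw : w < 1)
      simp only [mem_Iio]
      nlinarith [hrm.1]
  have hf1 : Tendsto (fun w : ℝ => degreePGF p (1 - r + r * w)) (𝓝[<] 1) (𝓝 1) := by
    have hc := (degreePGF_continuousOn hp) 1 ⟨zero_le_one, le_rfl⟩
    have hc' := hc.tendsto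
    rw [degreePGF_one hp] at hc'
    refine hc'.comp (tendsto_nhdsWithin_iff.mpr ⟨hv.mono_right nhdsWithin_le_nhds, ?_⟩)
    filter_upwards [Ioo_mem_nhdsLT (zero_lt_one' ℝ)] with w hw
    constructor
    · nlinarith [hrm.1, hrm.2, hw.1]
    · nlinarith [hrm.1, hw.2]
  have hlim := (hf1.const_mul ρ).add ((hf.comp hv).const_mul r)
  have heq : (∑' k : ℕ, (k : ℝ) * PowerSeries.coeff k (childSeries p lam μ)) =
      ρ * 1 + r * meanDegree p := by
    refine tendsto_nhds_unique hΦ (hlim.congr' ?_)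
    filter_upwards [Ioo_mem_nhdsLT (zero_lt_one' ℝ)] with w hw
    rw [(hasSum_childSeries hp h0 h1 hμ0 hμ ⟨hw.1.le, hw.2.le⟩).tsum_eq, ← hρ, ← hr]
    simp only [Function.comp_apply]
    rw [← degreePGF]
    have hw1 : 1 - w ≠ 0 := by linarith [hw.2]
    have hr0 : r ≠ 0 := hrm.1.ne'
    rw [show 1 - (1 - r + r * w) = r * (1 - w) by ring]
    field_simp
    ring
  have e : ρ * 1 + r * meanDegree p = 1 - μ := by
    rw [← mul_reshareProb (μ := μ) hp h0, hr]; ring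
  rw [e] at heq
  rw [← heq]
  exact hs.hasSum

end Mean

/-! ### The local one-big-jump principle. -/

/-- The power series `P` has non-negative coefficients and converges at `x`, with value `v`. -/
def NonnegEval (P : PowerSeries ℝ) (x v : ℝ) : Prop :=
  (∀ k, 0 ≤ PowerSeries.coeff k P) ∧ HasSum (fun k => PowerSeries.coeff k P * x ^ k) v

namespace NonnegEval

variable {P Q : PowerSeries ℝ} {x v v' : ℝ}

lemma sumsTo (h : NonnegEval P x v) : SumsTo P x v := by
  have e : ∀ k, ((PowerSeries.coeff k P : ℝ) : ℂ) * (x : ℂ) ^ k =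
      ((PowerSeries.coeff k P * x ^ k : ℝ) : ℂ) := fun k => by push_cast; ring
  unfold SumsTo
  simp_rw [e, Complex.norm_real]
  exact ⟨h.2.summable.norm, (Complex.hasSum_ofReal.mpr h.2).tsum_eq⟩

lemma of_sumsTo (h0 : ∀ k, 0 ≤ PowerSeries.coeff k P) (h : SumsTo P x v) : NonnegEval P x v := by
  refine ⟨h0, ?_⟩
  have := h.hasSum
  exact_mod_cast this

lemma value_nonneg (h : NonnegEval P x v) (hx : 0 ≤ x) : 0 ≤ v :=
  h.2.nonneg fun k => mul_nonneg (h.1 k) (pow_nonneg hx k)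

lemma coeff_mul_pow_le (h : NonnegEval P x v) (hx : 0 ≤ x) (k : ℕ) :
    PowerSeries.coeff k P * x ^ k ≤ v :=
  le_hasSum h.2 k fun i _ => mul_nonneg (h.1 i) (pow_nonneg hx i)

lemma add (hP : NonnegEval P x v) (hQ : NonnegEval Q x v') : NonnegEval (P + Q) x (v + v') := by
  refine ⟨fun k => ?_, ?_⟩
  · rw [map_add]; exact add_nonneg (hP.1 k) (hQ.1 k)
  · simpa only [map_add, add_mul] using hP.2.add hQ.2

lemma nsmul (hP : NonnegEval P x v) (n : ℕ) : NonnegEval (n • P) x (n * v) := by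
  refine ⟨fun k => ?_, ?_⟩
  · rw [map_nsmul]; exact nsmul_nonneg (hP.1 k) n
  · have e : ∀ k, PowerSeries.coeff k (n • P) * x ^ k = n * (PowerSeries.coeff k P * x ^ k) :=
      fun k => by rw [map_nsmul, nsmul_eq_mul, mul_assoc]
    simp_rw [e]
    exact hP.2.mul_left (n : ℝ)

lemma mul (hP : NonnegEval P x v) (hQ : NonnegEval Q x v') :
    NonnegEval (P * Q) x (v * v') := by
  refine of_sumsTo (fun k => ?_) ?_
  · rw [PowerSeries.coeff_mul]
    exact Finset.sum_nonneg fun i _ => mul_nonneg (hP.1 _) (hQ.1 _)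
  · have := hP.sumsTo.mul hQ.sumsTo
    exact_mod_cast this

lemma pow (hP : NonnegEval P x v) (n : ℕ) : NonnegEval (P ^ n) x (v ^ n) := by
  induction n with
  | zero =>
    refine of_sumsTo (fun k => ?_) ?_
    · rw [pow_zero, PowerSeries.coeff_one]; split_ifs <;> norm_num
    · simpa using SumsTo.one (x : ℂ)
  | succ n ih => rw [pow_succ, pow_succ]; exact ih.mul hP

lemma zero (x : ℝ) : NonnegEval 0 x 0 := ⟨fun k => by simp, by simp⟩

/-- The largest atom of a sum is at most that of one summand. It is used with a single large jump as
`P` and everything else as `Q`. -/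
lemma coeff_mul_le {b : ℝ} (hb : 0 ≤ b) (hP : ∀ k, PowerSeries.coeff k P ≤ b)
    (hQ : NonnegEval Q 1 v) (N : ℕ) : PowerSeries.coeff N (P * Q) ≤ b * v := by
  rw [PowerSeries.coeff_mul, Finset.Nat.sum_antidiagonal_eq_sum_range_succ_mk]
  have hs := hQ.2
  simp only [one_pow, mul_one] at hs
  calc ∑ i ∈ Finset.range N.succ, PowerSeries.coeff i P * PowerSeries.coeff (N - i) Q
      ≤ ∑ i ∈ Finset.range (N + 1), b * PowerSeries.coeff (N - i) Q :=
        Finset.sum_le_sum fun i _ => mul_le_mul_of_nonneg_right (hP i) (hQ.1 _)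
    _ = b * ∑ i ∈ Finset.range (N + 1), PowerSeries.coeff i Q := by
        have := Finset.sum_range_reflect (fun i => PowerSeries.coeff i Q) (N + 1)
        simp only [Nat.add_sub_cancel] at this
        rw [← Finset.mul_sum, this]
    _ ≤ b * v := mul_le_mul_of_nonneg_left (sum_le_hasSum _ (fun i _ => hQ.1 i) hs) hb

end NonnegEval

/-- The expansion of `(A + B) ^ (n + 1)` to first order in `B`. -/
lemma exists_add_pow_succ_eq {A B : PowerSeries ℝ} {vA vB : ℝ} (hA : NonnegEval A 1 vA)
    (hB : NonnegEval B 1 vB) (hv : vA + vB ≤ 1) (n : ℕ) :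
    ∃ (Q : PowerSeries ℝ) (v : ℝ), NonnegEval Q 1 v ∧ v ≤ (n : ℝ) ^ 2 ∧
      (A + B) ^ (n + 1) = A ^ (n + 1) + (n + 1) • (B * A ^ n) + B * (B * Q) := by
  have hvA0 := hA.value_nonneg zero_le_one
  have hvB0 := hB.value_nonneg zero_le_one
  induction n with
  | zero => exact ⟨0, 0, .zero 1, by simp, by simp⟩
  | succ n ih =>
    obtain ⟨Q, v, hQ, hvn, he⟩ := ih
    have hv0 := hQ.value_nonneg zero_le_one
    -- Multiplication by `A + B` turns one of the `n + 1` first-order terms into a second-order one.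
    -- Values grow as `v + (n + 1) ≤ n² + n + 1 ≤ (n + 1)²`.
    refine ⟨(n + 1) • A ^ n + (A + B) * Q, _,
      ((hA.pow n).nsmul (n + 1)).add ((hA.add hB).mul hQ), ?_, ?_⟩
    · have h1 : vA ^ n ≤ 1 := pow_le_one₀ hvA0 (by linarith)
      have h2 : (vA + vB) * v ≤ v := mul_le_of_le_one_left hv0 hv
      have h3 : (0 : ℝ) ≤ n := Nat.cast_nonneg n
      push_cast
      nlinarith
    · rw [pow_succ', he]
      simp only [nsmul_eq_mul]
      push_cast
      ring

/-- Weights that concentrate at `m`, tested against a bounded function. -/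
lemma tendsto_tsum_mul_of_concentration {w : ℕ → ℕ → ℝ} {W₀ W₁ W₂ : ℕ → ℝ} {m L C : ℝ}
    {h : ℕ → ℕ → ℝ} (hw : ∀ n j, 0 ≤ w n j) (hW₀ : ∀ n, HasSum (w n) (W₀ n))
    (hW₁ : ∀ n, HasSum (fun j : ℕ => w n j * Real.exp (-(1 / n)) ^ j) (W₁ n))
    (hW₂ : ∀ n, HasSum (fun j : ℕ => w n j * Real.exp (-(2 / n)) ^ j) (W₂ n))
    (h₀ : Tendsto W₀ atTop (𝓝 1)) (h₁ : Tendsto W₁ atTop (𝓝 (Real.exp (-m))))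
    (h₂ : Tendsto W₂ atTop (𝓝 (Real.exp (-(2 * m))))) (hC : ∀ n j, |h n j| ≤ C)
    (hloc : ∀ δ > 0, ∃ η > 0, ∀ᶠ n : ℕ in atTop, ∀ j : ℕ,
      |Real.exp (-(1 / n)) ^ j - Real.exp (-m)| < η → |h n j - L| ≤ δ) :
    Tendsto (fun n => ∑' j, w n j * h n j) atTop (𝓝 L) := by
  have hC0 : 0 ≤ C := (abs_nonneg _).trans (hC 0 0)
  have hsum : ∀ n, Summable fun j => w n j * h n j := fun n => by
    refine Summable.of_norm_bounded ((hW₀ n).summable.mul_right C) fun j => ?_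
    rw [norm_mul, Real.norm_of_nonneg (hw n j)]
    exact mul_le_mul_of_nonneg_left (hC n j) (hw n j)
  have hdiff : Tendsto (fun n => ∑' j, w n j * h n j - L * W₀ n) atTop (𝓝 0) := by
    rw [Metric.tendsto_nhds]
    intro ε hε
    obtain ⟨η, hη, hev⟩ := hloc (ε / 2) (half_pos hε)
    -- Chebyshev's inequality in the variable `y = e^{-j/n}`: its second moment about `e^{-m}` is a
    -- combination of `W₀`, `W₁`, `W₂` that tends to `0`. The exponential scale needs Laplace
    -- transforms only, no second moment of `j`.
    set M := (C + |L|) / η ^ 2 with hM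
    have hlim : Tendsto (fun n => ε / 2 * W₀ n + M * (W₂ n + (-2 * Real.exp (-m)) * W₁ n +
        Real.exp (-m) ^ 2 * W₀ n)) atTop (𝓝 (ε / 2)) := by
      have := (h₀.const_mul (ε / 2)).add (((h₂.add (h₁.const_mul (-2 * Real.exp (-m)))).add
        (h₀.const_mul (Real.exp (-m) ^ 2))).const_mul M)
      convert! this using 2
      rw [show -(2 * m) = -m + -m by ring, Real.exp_add]
      ring
    filter_upwards [hlim.eventually_lt_const (by linarith : ε / 2 < ε), hev] with n hn hloc'
    rw [dist_zero_right]
    refine lt_of_le_of_lt ?_ hn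
    have hs := (hsum n).hasSum.sub ((hW₀ n).mul_left L)
    rw [← hs.tsum_eq]
    refine tsum_of_norm_bounded (((hW₀ n).mul_left (ε / 2)).add (((hW₂ n).add
      ((hW₁ n).mul_left (-2 * Real.exp (-m)))).add ((hW₀ n).mul_left (Real.exp (-m) ^ 2))
        |>.mul_left M)) fun j => ?_
    have e2 : Real.exp (-(2 / n)) ^ j = (Real.exp (-(1 / n)) ^ j) ^ 2 := by
      rw [← Real.exp_nat_mul, ← Real.exp_nat_mul, ← Real.exp_nat_mul]
      congr 1
      push_cast
      ring
    set y := Real.exp (-(1 / (n : ℝ))) ^ j with hy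
    have e : w n j * h n j - L * w n j = w n j * (h n j - L) := by ring
    have key : |h n j - L| ≤ ε / 2 + M * (y - Real.exp (-m)) ^ 2 := by
      rcases lt_or_ge |y - Real.exp (-m)| η with hlt | hge
      · have := hloc' j hlt
        have hM0 : 0 ≤ M := by positivity
        nlinarith [sq_nonneg (y - Real.exp (-m))]
      · have h3 : η ^ 2 ≤ (y - Real.exp (-m)) ^ 2 := by
          rw [← sq_abs (y - Real.exp (-m))]
          exact pow_le_pow_left₀ hη.le hge 2
        have h4 : C + |L| ≤ M * (y - Real.exp (-m)) ^ 2 := by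
          rw [hM, div_mul_eq_mul_div, le_div_iff₀ (by positivity)]
          exact mul_le_mul_of_nonneg_left h3 (by positivity)
        have h5 : |h n j - L| ≤ |h n j| + |L| := abs_sub _ _
        linarith [hC n j]
    rw [e, norm_mul, Real.norm_of_nonneg (hw n j), Real.norm_eq_abs, e2]
    nlinarith [mul_le_mul_of_nonneg_left key (hw n j)]
  have := hdiff.add (h₀.const_mul L)
  rw [zero_add, mul_one] at this
  exact this.congr fun n => by ring

/-- The terms of degree at most `x` of the power series with coefficients `a`. -/
def truncSeries (a : ℕ → ℝ) (x : ℝ) : PowerSeries ℝ :=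
  PowerSeries.mk fun k => if (k : ℝ) ≤ x then a k else 0

/-- The terms of degree more than `x` of the power series with coefficients `a`. -/
def tailSeries (a : ℕ → ℝ) (x : ℝ) : PowerSeries ℝ :=
  PowerSeries.mk fun k => if (k : ℝ) ≤ x then 0 else a k

lemma truncSeries_add_tailSeries (a : ℕ → ℝ) (x : ℝ) :
    truncSeries a x + tailSeries a x = PowerSeries.mk a := by
  ext k
  simp only [truncSeries, tailSeries, map_add, PowerSeries.coeff_mk]
  split_ifs <;> simp

section Nonneg

variable {a : ℕ → ℝ} (ha0 : ∀ k, 0 ≤ a k)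
include ha0

lemma nonnegEval_truncSeries (x y : ℝ) :
    NonnegEval (truncSeries a x) y (∑' k : ℕ, (if (k : ℝ) ≤ x then a k else 0) * y ^ k) := by
  refine ⟨fun k => ?_, ?_⟩
  · rw [truncSeries, PowerSeries.coeff_mk]; split_ifs <;> simp [ha0]
  · simp only [truncSeries, PowerSeries.coeff_mk]
    refine (summable_of_ne_finset_zero (s := Finset.range (⌊x⌋₊ + 1)) fun k hk => ?_).hasSum
    have hk' : ⌊x⌋₊ < k := by simpa [Nat.lt_succ_iff] using hk
    rw [if_neg (not_le.mpr (Nat.lt_of_floor_lt hk')), zero_mul]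

lemma nonnegEval_tailSeries (hs : Summable a) (x : ℝ) :
    NonnegEval (tailSeries a x) 1 (∑' k : ℕ, if (k : ℝ) ≤ x then 0 else a k) := by
  refine ⟨fun k => ?_, ?_⟩
  · rw [tailSeries, PowerSeries.coeff_mk]; split_ifs <;> simp [ha0]
  · simp only [tailSeries, PowerSeries.coeff_mk, one_pow, mul_one]
    refine (hs.of_nonneg_of_le (fun k => ?_) fun k => ?_).hasSum
    · split_ifs <;> simp [ha0]
    · split_ifs <;> simp [ha0]

lemma trunc_add_tail_value (hs : HasSum a 1) (x : ℝ) :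
    (∑' k : ℕ, (if (k : ℝ) ≤ x then a k else 0) * 1 ^ k) +
      (∑' k : ℕ, if (k : ℝ) ≤ x then 0 else a k) ≤ 1 := by
  have h := (nonnegEval_truncSeries ha0 x 1).add (nonnegEval_tailSeries ha0 hs.summable x)
  rw [truncSeries_add_tailSeries] at h
  have h2 := h.2
  simp only [PowerSeries.coeff_mk, one_pow, mul_one] at h2
  have := h2.unique hs
  simpa using this.le

end Nonneg

section BigJump

variable {a : ℕ → ℝ} (ha0 : ∀ k, 0 ≤ a k) {m : ℝ} (hm : HasSum (fun k : ℕ => (k : ℝ) * a k) m)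
  {ε : ℝ} (hε : 0 < ε)
include ha0 hm hε

/-- Since `n ≤ k/ε` on the tail, the finite mean dominates; so the expected number of big jumps
tends to zero. -/
lemma tendsto_mul_tail :
    Tendsto (fun n : ℕ => (n : ℝ) * ∑' k : ℕ, if (k : ℝ) ≤ ε * n then 0 else a k) atTop (𝓝 0) := by
  have h := tendsto_tsum_of_dominated_convergence (𝓕 := atTop)
    (f := fun (n : ℕ) (k : ℕ) => (n : ℝ) * if (k : ℝ) ≤ ε * n then 0 else a k)
    (g := fun _ => (0 : ℝ)) (hm.summable.mul_left (1 / ε)) (fun k => ?_)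
    (Eventually.of_forall fun n k => ?_)
  · simpa only [tsum_mul_left, tsum_zero] using h
  · have hlim : Tendsto (fun n : ℕ => ε * (n : ℝ)) atTop atTop :=
      tendsto_natCast_atTop_atTop.const_mul_atTop hε
    refine tendsto_const_nhds.congr' ?_
    filter_upwards [hlim.eventually_ge_atTop (k : ℝ)] with n hn
    rw [if_pos hn, mul_zero]
  · have hk := ha0 k
    split_ifs with h
    · rw [mul_zero, norm_zero]; positivity
    · rw [Real.norm_of_nonneg (by positivity), ← mul_assoc, one_div_mul_eq_div]
      refine mul_le_mul_of_nonneg_right ?_ hk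
      rw [le_div_iff₀ hε]
      linarith [not_le.mp h]

/-- The law of large numbers for the truncated walk, as convergence of Laplace transforms. -/
lemma tendsto_trunc_pow (hs : HasSum a 1) {t : ℝ} (ht : 0 ≤ t) :
    Tendsto (fun n : ℕ => (∑' k : ℕ, (if (k : ℝ) ≤ ε * n then a k else 0) *
      Real.exp (-(t / n)) ^ k) ^ n) atTop (𝓝 (Real.exp (-(t * m)))) := by
  have hexp : ∀ (n k : ℕ), Real.exp (-(t / n)) ^ k = Real.exp (-(t * k / n)) := fun n k => by
    rw [← Real.exp_nat_mul]; congr 1; ring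
  set V : ℕ → ℝ := fun n => ∑' k : ℕ, (if (k : ℝ) ≤ ε * n then a k else 0) *
      Real.exp (-(t / n)) ^ k with hV
  have h := tendsto_tsum_of_dominated_convergence (𝓕 := atTop)
    (f := fun (n : ℕ) (k : ℕ) => (n : ℝ) * ((if (k : ℝ) ≤ ε * n then a k else 0) *
      Real.exp (-(t / n)) ^ k - a k))
    (g := fun k : ℕ => -t * ((k : ℝ) * a k)) (hm.summable.mul_left (t + 1 / ε)) (fun k => ?_)
    ?_
  · rw [tsum_mul_left, hm.tsum_eq] at h
    have h2 : Tendsto (fun n : ℕ => (n : ℝ) * (V n - 1)) atTop (𝓝 (-(t * m))) := by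
      rw [← neg_mul]
      refine h.congr fun n => ?_
      have hs' := (nonnegEval_truncSeries ha0 (ε * n) (Real.exp (-(t / n)))).2
      simp only [truncSeries, PowerSeries.coeff_mk] at hs'
      rw [tsum_mul_left, hs'.summable.tsum_sub hs.summable, hs.tsum_eq]
    have h3 := Real.tendsto_one_add_pow_exp_of_tendsto h2
    simp only [add_sub_cancel] at h3
    exact h3
  · have hlim : Tendsto (fun n : ℕ => ε * (n : ℝ)) atTop atTop :=
      tendsto_natCast_atTop_atTop.const_mul_atTop hε
    have hd : HasDerivAt (fun y : ℝ => Real.exp (-(t * k) * y)) (-(t * k)) 0 := by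
      have := ((hasDerivAt_id (0 : ℝ)).const_mul (-(t * k))).exp
      simpa using this
    have hsl := (hasDerivAt_iff_tendsto_slope.mp hd).comp
      (tendsto_nhdsWithin_iff.mpr ⟨tendsto_inv_atTop_nhds_zero_nat (𝕜 := ℝ), by
        filter_upwards [eventually_gt_atTop 0] with n hn
        have : (n : ℝ) ≠ 0 := by positivity
        simpa using hn.ne'⟩)
    have hsl' := hsl.const_mul (a k)
    rw [show a k * -(t * k) = -t * (k * a k) by ring] at hsl'
    refine hsl'.congr' ?_
    filter_upwards [hlim.eventually_ge_atTop (k : ℝ), eventually_gt_atTop 0] with n hn hn0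
    have hn0' : (n : ℝ) ≠ 0 := by positivity
    rw [if_pos hn, hexp]
    simp only [Function.comp_apply, slope_def_field, mul_zero, Real.exp_zero, sub_zero]
    rw [div_inv_eq_mul, show -(t * k) * (n : ℝ)⁻¹ = -(t * k / n) by ring]
    ring
  · filter_upwards [eventually_gt_atTop 0] with n hn k
    have hn' : (0 : ℝ) < n := by exact_mod_cast hn
    have hk := ha0 k
    have hk0 : (0 : ℝ) ≤ k := Nat.cast_nonneg k
    split_ifs with h
    · rw [hexp]
      have h3 : Real.exp (-(t * k / n)) ≤ 1 := Real.exp_le_one_iff.mpr (by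
        have : 0 ≤ t * k / n := by positivity
        linarith)
      have h4 := Real.add_one_le_exp (-(t * k / n))
      have e : (n : ℝ) * (a k * Real.exp (-(t * k / n)) - a k) =
          -(a k * (n * (1 - Real.exp (-(t * k / n))))) := by ring
      have h5 : n * (1 - Real.exp (-(t * k / n))) ≤ t * k := by
        have h6 : 1 - Real.exp (-(t * k / n)) ≤ t * k / n := by linarith
        calc n * (1 - Real.exp (-(t * k / n))) ≤ n * (t * k / n) :=
              mul_le_mul_of_nonneg_left h6 hn'.le
          _ = t * k := by field_simp
      rw [e, norm_neg, Real.norm_of_nonneg (mul_nonneg hk (mul_nonneg hn'.le (by linarith)))]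
      have h7 : 0 ≤ 1 / ε * (k * a k) := by positivity
      nlinarith [mul_le_mul_of_nonneg_left h5 hk]
    · rw [zero_mul, zero_sub, mul_neg, norm_neg, Real.norm_of_nonneg (by positivity)]
      have h3 : (n : ℝ) ≤ 1 / ε * k := by
        rw [one_div_mul_eq_div, le_div_iff₀ hε]; linarith [not_le.mp h]
      have h4 : 0 ≤ t * (k * a k) := by positivity
      nlinarith [mul_le_mul_of_nonneg_right h3 hk]

/-- Chernoff's bound: without a jump of size `ε n`, the walk is far below its target. -/
lemma tendsto_coeff_trunc_pow (hs : HasSum a 1) (hm1 : m < 1) {γ τ : ℝ} (hγ : 0 < γ) (hτ0 : 0 ≤ τ)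
    (hτ2 : τ ≤ 2) (hM : Summable fun k : ℕ => (k : ℝ) ^ τ * a k) (hε1 : ε ≤ 1)
    (hετ : γ / (1 - m) * ε < τ - 1) :
    Tendsto (fun n : ℕ => (n : ℝ) ^ (γ - 1) *
      PowerSeries.coeff n (truncSeries a (ε * n) ^ (n + 1))) atTop (𝓝 0) := by
  set κ := γ / (1 - m) with hκ
  have h1m : 0 < 1 - m := by linarith
  have hκ0 : 0 < κ := by positivity
  set M := ∑' k : ℕ, (k : ℝ) ^ τ * a k with hMdef
  -- With this Chernoff parameter `e^{sn} = n^κ`, while the `n`-th power of the truncated transform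
  -- is about `n^{κm}`. The choice `κ(1 - m) = γ` gains `n^{-γ}`, one power more than required.
  set s : ℕ → ℝ := fun n => κ * Real.log n / n with hsdef
  -- The first term comes from the exponent `n + 1` instead of `n`, the second from `e^x ≤ 1 + x +
  -- x² e^x` with `e^x ≤ n^{κε}`. It is of order `(log n)² n^{κε + 1 - τ}`, which vanishes by `hετ`.
  set E : ℕ → ℝ := fun n => s n * m + (n + 1) * (s n ^ 2 * ((n : ℝ) ^ (κ * ε) *
    (n : ℝ) ^ (2 - τ)) * M) with hE
  have hlog : ∀ {δ : ℝ}, 0 < δ → Tendsto (fun n : ℕ => Real.log n / (n : ℝ) ^ δ) atTop (𝓝 0) :=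
    fun hδ => ((isLittleO_log_rpow_atTop hδ).tendsto_div_nhds_zero).comp
      tendsto_natCast_atTop_atTop
  have hs0 : Tendsto s atTop (𝓝 0) := by
    have := (hlog one_pos).const_mul κ
    rw [mul_zero] at this
    refine this.congr fun n => ?_
    rw [Real.rpow_one, hsdef]; ring
  have hE0 : Tendsto E atTop (𝓝 0) := by
    set δ := (τ - 1 - κ * ε) / 2 with hδ
    have hδ0 : 0 < δ := by rw [hδ]; linarith
    have h1 : Tendsto (fun n : ℕ => 1 + 1 / (n : ℝ)) atTop (𝓝 (1 + 0)) :=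
      (tendsto_one_div_atTop_nhds_zero_nat (𝕜 := ℝ)).const_add 1
    have h2 := (hs0.mul_const m).add ((h1.mul ((hlog hδ0).pow 2)).mul_const (κ ^ 2 * M))
    rw [show (0 : ℝ) * m + (1 + 0) * 0 ^ 2 * (κ ^ 2 * M) = 0 by ring] at h2
    refine h2.congr' ?_
    filter_upwards [eventually_gt_atTop 0] with n hn
    have hn' : (0 : ℝ) < n := by exact_mod_cast hn
    have e : ((n : ℝ) ^ (κ * ε) * (n : ℝ) ^ (2 - τ)) = n / ((n : ℝ) ^ δ) ^ 2 := by
      rw [eq_div_iff (by positivity), ← Real.rpow_natCast, ← Real.rpow_mul hn'.le,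
        ← Real.rpow_add hn', ← Real.rpow_add hn']
      have : κ * ε + (2 - τ) + δ * (2 : ℕ) = 1 := by rw [hδ]; push_cast; ring
      rw [this, Real.rpow_one]
    have := (Real.rpow_pos_of_pos hn' δ).ne'
    simp only [hE, e, hsdef]
    field_simp
  have hbound : Tendsto (fun n : ℕ => (n : ℝ)⁻¹ * Real.exp (E n)) atTop (𝓝 0) := by
    have := (tendsto_inv_atTop_nhds_zero_nat (𝕜 := ℝ)).mul
      ((Real.continuous_exp.tendsto 0).comp hE0)
    simpa [Function.comp_def] using this
  refine squeeze_zero' (Eventually.of_forall fun n => ?_) ?_ hbound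
  · exact mul_nonneg (by positivity) (((nonnegEval_truncSeries ha0 _ 1).pow _).1 n)
  filter_upwards [eventually_gt_atTop 0] with n hn
  have hn' : (0 : ℝ) < n := by exact_mod_cast hn
  have hn1 : (1 : ℝ) ≤ n := by exact_mod_cast hn
  have hsn : 0 ≤ s n := by
    have := Real.log_nonneg hn1
    simp only [hsdef]; positivity
  have hev := nonnegEval_truncSeries ha0 (ε * n) (Real.exp (s n))
  set V := ∑' k : ℕ, (if (k : ℝ) ≤ ε * n then a k else 0) * Real.exp (s n) ^ k with hV
  set Z := s n ^ 2 * ((n : ℝ) ^ (κ * ε) * (n : ℝ) ^ (2 - τ)) with hZ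
  have hVle : V ≤ 1 + s n * m + Z * M := by
    have h2 := hev.2
    simp only [truncSeries, PowerSeries.coeff_mk] at h2
    refine hasSum_le (fun k => ?_) h2 ((hs.add (hm.mul_left (s n))).add (hM.hasSum.mul_left Z))
    have hk := ha0 k
    have hk0 : (0 : ℝ) ≤ k := Nat.cast_nonneg k
    split_ifs with hkn
    · rw [← Real.exp_nat_mul]
      set x := (k : ℝ) * s n with hx
      have hx0 : 0 ≤ x := by positivity
      have h3 : Real.exp x ≤ 1 + x + x ^ 2 * Real.exp x := by
        have h4 : (1 - x) * Real.exp x ≤ 1 := by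
          have h5 := Real.add_one_le_exp (-x)
          calc (1 - x) * Real.exp x ≤ Real.exp (-x) * Real.exp x :=
                mul_le_mul_of_nonneg_right (by linarith) (Real.exp_pos _).le
            _ = 1 := by rw [← Real.exp_add]; simp
        nlinarith [mul_le_mul_of_nonneg_left h4 (by linarith : 0 ≤ 1 + x)]
      have h6 : Real.exp x ≤ (n : ℝ) ^ (κ * ε) := by
        rw [Real.rpow_def_of_pos hn']
        refine Real.exp_le_exp.mpr ?_
        calc x ≤ ε * n * s n := mul_le_mul_of_nonneg_right hkn hsn
          _ = Real.log n * (κ * ε) := by simp only [hsdef]; field_simp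
      have h7 : (k : ℝ) ^ 2 ≤ (k : ℝ) ^ τ * (n : ℝ) ^ (2 - τ) := by
        have hkn' : (k : ℝ) ≤ n := hkn.trans (mul_le_of_le_one_left hn'.le hε1)
        calc (k : ℝ) ^ 2 = (k : ℝ) ^ τ * (k : ℝ) ^ (2 - τ) := by
              rw [← Real.rpow_add_of_nonneg hk0 hτ0 (by linarith), ← Real.rpow_natCast]
              norm_num
          _ ≤ _ := mul_le_mul_of_nonneg_left (Real.rpow_le_rpow hk0 hkn' (by linarith))
              (by positivity)
      have h8 : x ^ 2 * Real.exp x ≤ Z * (k : ℝ) ^ τ := by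
        calc x ^ 2 * Real.exp x = s n ^ 2 * ((k : ℝ) ^ 2 * Real.exp x) := by rw [hx]; ring
          _ ≤ s n ^ 2 * (((k : ℝ) ^ τ * (n : ℝ) ^ (2 - τ)) * (n : ℝ) ^ (κ * ε)) := by
              gcongr
          _ = Z * (k : ℝ) ^ τ := by rw [hZ]; ring
      calc a k * Real.exp x ≤ a k * (1 + x + Z * (k : ℝ) ^ τ) :=
            mul_le_mul_of_nonneg_left (by linarith) hk
        _ = _ := by rw [hx]; ring
    · rw [zero_mul]
      positivity
  have hV0 : 0 ≤ V := hev.value_nonneg (Real.exp_pos _).le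
  have hco := (hev.pow (n + 1)).coeff_mul_pow_le (Real.exp_pos _).le n
  have hes : Real.exp (s n) ^ n = (n : ℝ) ^ κ := by
    rw [← Real.exp_nat_mul, Real.rpow_def_of_pos hn']
    congr 1
    simp only [hsdef]; field_simp
  have hVpow : V ^ (n + 1) ≤ (n : ℝ) ^ (κ * m) * Real.exp (E n) := by
    calc V ^ (n + 1) ≤ Real.exp (s n * m + Z * M) ^ (n + 1) := by
          refine pow_le_pow_left₀ hV0 (hVle.trans ?_) _
          linarith [Real.add_one_le_exp (s n * m + Z * M)]
      _ = _ := by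
          rw [← Real.exp_nat_mul, Real.rpow_def_of_pos hn', ← Real.exp_add]
          congr 1
          have : s n * n = κ * Real.log n := by simp only [hsdef]; field_simp
          simp only [hE, ← hZ]
          push_cast
          linear_combination m * this
  rw [hes] at hco
  set q := PowerSeries.coeff n (truncSeries a (ε * n) ^ (n + 1)) with hq
  have hκm : (n : ℝ) ^ κ = (n : ℝ) ^ (κ * m) * ((n : ℝ) ^ (γ - 1) * n) := by
    rw [← Real.rpow_add_one hn'.ne', ← Real.rpow_add hn']
    congr 1
    rw [hκ]; field_simp; ring
  have hfin : (n : ℝ) ^ (κ * m) * ((n : ℝ) ^ (γ - 1) * q * n) ≤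
      (n : ℝ) ^ (κ * m) * Real.exp (E n) := by
    refine le_trans (le_of_eq ?_) (hco.trans hVpow)
    rw [hκm]; ring
  have := le_of_mul_le_mul_left hfin (Real.rpow_pos_of_pos hn' _)
  rw [inv_mul_eq_div, le_div_iff₀ hn']
  exact this

end BigJump

section BigJump

variable {a : ℕ → ℝ} (ha0 : ∀ k, 0 ≤ a k) (hs : HasSum a 1) {m : ℝ}
  (hm : HasSum (fun k : ℕ => (k : ℝ) * a k) m) (hm1 : m < 1) {γ c : ℝ}
  (hT : Tendsto (fun k : ℕ => a k * (k : ℝ) ^ γ) atTop (𝓝 c)) {ε : ℝ} (hε : 0 < ε)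
include ha0 hT hε

lemma exists_mul_coeff_tailSeries_le (hγ : 0 ≤ γ) : ∃ C : ℝ, 0 ≤ C ∧ ∀ n k : ℕ,
    (n : ℝ) ^ γ * PowerSeries.coeff k (tailSeries a (ε * n)) ≤ C := by
  obtain ⟨C, hC⟩ := hT.bddAbove_range
  have hC' : ∀ k : ℕ, a k * (k : ℝ) ^ γ ≤ C := fun k => hC ⟨k, rfl⟩
  have hC0 : 0 ≤ C := (mul_nonneg (ha0 0) (by positivity)).trans (hC' 0)
  refine ⟨C / ε ^ γ, by positivity, fun n k => ?_⟩
  rw [tailSeries, PowerSeries.coeff_mk]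
  split_ifs with h
  · rw [mul_zero]; positivity
  · rw [le_div_iff₀ (by positivity)]
    have h1 : (ε * n) ^ γ ≤ (k : ℝ) ^ γ :=
      Real.rpow_le_rpow (by positivity) (not_le.mp h).le hγ
    rw [Real.mul_rpow hε.le (by positivity)] at h1
    have := mul_le_mul_of_nonneg_left h1 (ha0 k)
    linarith [hC' k]

include hs hm hm1

/-- One big jump into the window around the target. -/
lemma tendsto_coeff_tail_mul_trunc_pow (hγ : 0 ≤ γ) (hεm : ε ≤ (1 - m) / 2) :
    Tendsto (fun n : ℕ => (n : ℝ) ^ γ *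
      PowerSeries.coeff n (tailSeries a (ε * n) * truncSeries a (ε * n) ^ n)) atTop
      (𝓝 (c * (1 - m) ^ (-γ))) := by
  have h1m : 0 < 1 - m := by linarith
  obtain ⟨C, hC0, hC⟩ := exists_mul_coeff_tailSeries_le ha0 hT hε hγ
  have hev : ∀ (n : ℕ) (y : ℝ), NonnegEval (truncSeries a (ε * n) ^ n) y _ := fun n y =>
    (nonnegEval_truncSeries ha0 (ε * n) y).pow n
  have htail0 : ∀ n k : ℕ, 0 ≤ PowerSeries.coeff k (tailSeries a (ε * n)) := fun n k =>
    (nonnegEval_tailSeries ha0 hs.summable _).1 k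
  set w : ℕ → ℕ → ℝ := fun n j => PowerSeries.coeff j (truncSeries a (ε * n) ^ n) with hw
  -- If the truncated walk has reached `j`, the large jump must have size exactly `n - j`; `h` is
  -- its probability times `n^γ`.
  set h : ℕ → ℕ → ℝ := fun n j => if j ≤ n then
    (n : ℝ) ^ γ * PowerSeries.coeff (n - j) (tailSeries a (ε * n)) else 0 with hh
  have key := tendsto_tsum_mul_of_concentration (w := w) (h := h) (m := m)
    (L := c * (1 - m) ^ (-γ)) (C := C) (fun n j => (hev n 1).1 j)
    (fun n => by
      have := (hev n (Real.exp (-(0 / n)))).2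
      simp only [zero_div, neg_zero, Real.exp_zero, one_pow, mul_one] at this
      exact this)
    (fun n => (hev n (Real.exp (-(1 / n)))).2) (fun n => (hev n (Real.exp (-(2 / n)))).2) ?_ ?_ ?_
    (fun n j => ?_) fun δ hδ => ?_
  · refine key.congr fun n => ?_
    rw [mul_comm (tailSeries a (ε * n)), PowerSeries.coeff_mul,
      Finset.Nat.sum_antidiagonal_eq_sum_range_succ_mk, Finset.mul_sum,
      tsum_eq_sum (s := Finset.range (n + 1)) fun j hj => by
        rw [hh]
        simp only
        rw [if_neg (by simpa [Nat.lt_succ_iff] using hj), mul_zero]]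
    refine Finset.sum_congr rfl fun j hj => ?_
    have hjn : j ≤ n := Nat.lt_succ_iff.mp (Finset.mem_range.mp hj)
    simp only [hh, hw, if_pos hjn]
    ring
  · have := tendsto_trunc_pow ha0 hm hε hs le_rfl
    simpa using this
  · simpa using tendsto_trunc_pow ha0 hm hε hs zero_le_one
  · exact tendsto_trunc_pow ha0 hm hε hs zero_le_two
  · simp only [hh]
    split_ifs
    · rw [abs_of_nonneg (mul_nonneg (by positivity) (htail0 _ _))]
      exact hC n _
    · rwa [abs_zero]
  -- Where `e^{-j/n}` is close to `e^{-m}`, the gap `n - j` is close to `(1 - m) n`. Since `ε ≤ (1 -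
  -- m)/2` it exceeds `εn`, so the jump belongs to the tail part.
  · have hcont : ContinuousAt (fun q : ℝ × ℝ => q.1 * q.2 ^ (-γ)) (c, 1 - m) :=
      continuousAt_fst.mul (continuousAt_snd.rpow_const (Or.inl h1m.ne'))
    obtain ⟨θ, hθ, hclose⟩ := Metric.continuousAt_iff.mp hcont δ hδ
    have hlogc : ContinuousAt Real.log (Real.exp (-m)) :=
      Real.continuousAt_log (Real.exp_pos _).ne'
    obtain ⟨η, hη, hlog⟩ := Metric.continuousAt_iff.mp hlogc (min θ ((1 - m) / 2))
      (by positivity)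
    obtain ⟨N, hN⟩ := Metric.tendsto_atTop.mp hT θ hθ
    have hlim : Tendsto (fun n : ℕ => ε * (n : ℝ)) atTop atTop :=
      tendsto_natCast_atTop_atTop.const_mul_atTop hε
    refine ⟨η, hη, ?_⟩
    filter_upwards [hlim.eventually_ge_atTop (N : ℝ), eventually_gt_atTop 0] with n hn hn0 j hj
    have hn' : (0 : ℝ) < n := by exact_mod_cast hn0
    have hd := hlog (x := Real.exp (-(1 / n)) ^ j) (by rwa [Real.dist_eq])
    rw [← Real.exp_nat_mul, Real.log_exp, Real.log_exp, Real.dist_eq,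
      show (j : ℝ) * -(1 / n) - -m = m - j / n by ring] at hd
    have hdθ := hd.trans_le (min_le_left _ _)
    have hdm := abs_lt.mp (hd.trans_le (min_le_right _ _))
    have hjn' : (j : ℝ) / n < 1 := by linarith
    have hjn : j < n := by
      rw [div_lt_one hn'] at hjn'
      exact_mod_cast hjn'
    have hk : ((n - j : ℕ) : ℝ) = n - j := by rw [Nat.cast_sub hjn.le]
    have hkn : ((n - j : ℕ) : ℝ) / n = 1 - j / n := by rw [hk]; field_simp
    have hkε : ε * n < ((n - j : ℕ) : ℝ) := by
      rw [← lt_div_iff₀ hn', hkn]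
      linarith
    have hkN : N ≤ n - j := by
      have : (N : ℝ) < ((n - j : ℕ) : ℝ) := hn.trans_lt hkε
      exact_mod_cast this.le
    have hk0 : (0 : ℝ) < ((n - j : ℕ) : ℝ) := by
      have : 0 < ε * (n : ℝ) := by positivity
      linarith
    have hpair := hclose (x := (a (n - j) * ((n - j : ℕ) : ℝ) ^ γ, ((n - j : ℕ) : ℝ) / n)) (by
      rw [Prod.dist_eq]
      refine max_lt (hN _ hkN) ?_
      rw [Real.dist_eq, hkn, show 1 - (j : ℝ) / n - (1 - m) = m - j / n by ring]
      exact hdθ)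
    rw [Real.dist_eq] at hpair
    simp only at hpair
    simp only [hh, if_pos hjn.le, tailSeries, PowerSeries.coeff_mk, if_neg (not_le.mpr hkε)]
    refine le_of_eq_of_le ?_ hpair.le
    congr 2
    have := (Real.rpow_pos_of_pos hk0 γ).ne'
    rw [Real.rpow_neg (by positivity), Real.div_rpow hk0.le hn'.le]
    field_simp

end BigJump

/-- The local one-big-jump principle: if `a k ~ c k ^ (-γ)` has mean `m < 1`, then the sum of `n`
independent copies is `n - 1` with probability `~ n c ((1 - m) n) ^ (-γ)`. -/
lemma tendsto_coeff_pow_of_powerTail {a : ℕ → ℝ} (ha0 : ∀ k, 0 ≤ a k) (hs : HasSum a 1) {m : ℝ}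
    (hm : HasSum (fun k : ℕ => (k : ℝ) * a k) m) (hm1 : m < 1) {γ c : ℝ} (hγ2 : 2 < γ)
    (hγ4 : γ ≤ 4) (hT : Tendsto (fun k : ℕ => a k * (k : ℝ) ^ γ) atTop (𝓝 c)) :
    Tendsto (fun n : ℕ => (n : ℝ) ^ (γ - 1) *
      PowerSeries.coeff (n - 1) (PowerSeries.mk a ^ n)) atTop (𝓝 (c * (1 - m) ^ (-γ))) := by
  have h1m : 0 < 1 - m := by linarith
  have hm0 : 0 ≤ m := hm.nonneg fun k => mul_nonneg (Nat.cast_nonneg k) (ha0 k)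
  -- Any exponent with `1 < τ < γ - 1` and `τ ≤ 2` would do: the moment of order `τ` is finite and
  -- beats the mean.
  set τ := γ / 2 with hτ
  have hM : Summable fun k : ℕ => (k : ℝ) ^ τ * a k :=
    summable_rpow_mul_of_tendsto (by rw [hτ]; linarith) hT
  set κ := γ / (1 - m) with hκ
  have hκ0 : 0 < κ := by positivity
  set ε := min ((τ - 1) / (2 * κ)) ((1 - m) / 2) with hεdef
  have hτ1 : 0 < τ - 1 := by rw [hτ]; linarith
  have hε : 0 < ε := lt_min (by positivity) (by positivity)
  have hεm : ε ≤ (1 - m) / 2 := min_le_right _ _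
  have hε1 : ε ≤ 1 := by linarith
  have hετ : κ * ε < τ - 1 := by
    have h1 : ε ≤ (τ - 1) / (2 * κ) := min_le_left _ _
    calc κ * ε ≤ κ * ((τ - 1) / (2 * κ)) := mul_le_mul_of_nonneg_left h1 hκ0.le
      _ = (τ - 1) / 2 := by field_simp
      _ < τ - 1 := by linarith
  have hsmall := tendsto_coeff_trunc_pow ha0 hm hε hs hm1 (γ := γ) (τ := τ) (by linarith)
    (by linarith) (by rw [hτ]; linarith) hM hε1 hετ
  have hjump := tendsto_coeff_tail_mul_trunc_pow ha0 hs hm hm1 hT hε (by linarith) hεm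
  obtain ⟨C, hC0, hC⟩ := exists_mul_coeff_tailSeries_le ha0 hT hε (by linarith)
  have htail := tendsto_mul_tail ha0 hm hε
  -- Split by the number of jumps above `εn`: none, one, or at least two. In the last group one jump
  -- costs at most `C n^{-γ}` per value and another costs `vB`, with weight at most `n²`; after
  -- scaling by `n^{γ - 1}` this is `C n vB`, which vanishes by `tendsto_mul_tail`.
  have hdec : ∀ n : ℕ, ∃ E : ℝ, 0 ≤ E ∧
      (n : ℝ) ^ (γ - 1) * E ≤ C * ((n : ℝ) * ∑' k : ℕ, if (k : ℝ) ≤ ε * n then 0 else a k) ∧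
      PowerSeries.coeff n (PowerSeries.mk a ^ (n + 1)) =
        PowerSeries.coeff n (truncSeries a (ε * n) ^ (n + 1)) +
        (n + 1) * PowerSeries.coeff n (tailSeries a (ε * n) * truncSeries a (ε * n) ^ n) + E := by
    intro n
    have hA := nonnegEval_truncSeries ha0 (ε * n) 1
    have hB := nonnegEval_tailSeries ha0 hs.summable (ε * n)
    obtain ⟨Q, v, hQ, hv, he⟩ := exists_add_pow_succ_eq hA hB (trunc_add_tail_value ha0 hs _) n
    rw [truncSeries_add_tailSeries] at he
    have hv0 := hQ.value_nonneg zero_le_one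
    set vB := ∑' k : ℕ, if (k : ℝ) ≤ ε * n then 0 else a k with hvB
    have hvB0 : 0 ≤ vB := hB.value_nonneg zero_le_one
    refine ⟨_, (hB.mul (hB.mul hQ)).1 n, ?_, ?_⟩
    · rcases Nat.eq_zero_or_pos n with rfl | hn
      · rw [Nat.cast_zero, Real.zero_rpow (by linarith)]; simp
      have hn' : (0 : ℝ) < n := by exact_mod_cast hn
      have hnγ : 0 < (n : ℝ) ^ γ := Real.rpow_pos_of_pos hn' γ
      have hb : ∀ k, PowerSeries.coeff k (tailSeries a (ε * n)) ≤ C / (n : ℝ) ^ γ := fun k => by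
        rw [le_div_iff₀ hnγ, mul_comm]; exact hC n k
      have h1 := NonnegEval.coeff_mul_le (by positivity) hb (hB.mul hQ) n
      calc (n : ℝ) ^ (γ - 1) *
            PowerSeries.coeff n (tailSeries a (ε * n) * (tailSeries a (ε * n) * Q))
          ≤ (n : ℝ) ^ (γ - 1) * (C / (n : ℝ) ^ γ * (vB * v)) :=
            mul_le_mul_of_nonneg_left h1 (by positivity)
        _ ≤ (n : ℝ) ^ (γ - 1) * (C / (n : ℝ) ^ γ * (vB * (n : ℝ) ^ 2)) := by gcongr
        _ = C * (n * vB) := by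
            rw [Real.rpow_sub_one hn'.ne']
            field_simp
    · rw [he]
      rw [map_add, map_add, map_nsmul, nsmul_eq_mul]
      push_cast
      rfl
  choose E hE0 hE1 hE2 using hdec
  have hEt : Tendsto (fun n : ℕ => (n : ℝ) ^ (γ - 1) * E n) atTop (𝓝 0) := by
    have h1 := htail.const_mul C
    rw [mul_zero] at h1
    exact squeeze_zero (fun n => mul_nonneg (by positivity) (hE0 n)) hE1 h1
  have hone := tendsto_add_one_div
  have hmain : Tendsto (fun n : ℕ => (n : ℝ) ^ (γ - 1) *
      PowerSeries.coeff n (PowerSeries.mk a ^ (n + 1))) atTop (𝓝 (c * (1 - m) ^ (-γ))) := by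
    have h1 := (hsmall.add (hone.mul hjump)).add hEt
    rw [zero_add, one_mul, add_zero] at h1
    refine h1.congr' ?_
    filter_upwards [eventually_gt_atTop 0] with n hn
    have hn' : (0 : ℝ) < n := by exact_mod_cast hn
    rw [hE2 n, show (n : ℝ) ^ γ = (n : ℝ) ^ (γ - 1) * n by
      rw [← Real.rpow_add_one hn'.ne', sub_add_cancel]]
    field_simp
  rw [← tendsto_add_atTop_iff_nat 1]
  have hpow := hone.rpow_const (p := γ - 1) (Or.inl one_ne_zero)
  rw [Real.one_rpow] at hpow
  have h2 := hpow.mul hmain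
  rw [one_mul] at h2
  refine h2.congr' ?_
  filter_upwards [eventually_gt_atTop 0] with n hn
  have hn' : (0 : ℝ) < n := by exact_mod_cast hn
  have := (Real.rpow_pos_of_pos hn' (γ - 1)).ne'
  rw [Real.div_rpow (by positivity) hn'.le, Nat.add_sub_cancel]
  push_cast
  field_simp

/-- Subcritical case, power-law out-degrees. -/
lemma progeny_isEquivalent_of_hasPowerTail_of_pos {p : ℕ → ℝ} (hp : IsOutDegreeDistribution p)
    {lam μ : ℝ} (h0 : 0 < lam) (h1 : lam ≤ 1) (hμ0 : 0 < μ) (hμ : μ < 1) {D γ : ℝ} (hD : 0 < D)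
    (hγ2 : 2 < γ) (hγ3 : γ < 3) (htail : HasPowerTail p D γ) :
    progeny p lam μ ~[atTop] fun n : ℕ => prefactorC p lam μ D γ * (n : ℝ) ^ (-γ) := by
  have hα1 : 1 < γ - 1 := by linarith
  have hα2 : γ - 1 < 2 := by linarith
  have hT : Tendsto (fun k : ℕ => p k * (k : ℝ) ^ (γ - 1 + 1)) atTop (𝓝 D) := by
    simpa using htail.tendsto hD.ne'
  have hr := lam_mul_reshareProb_mem hp h0 h1 hμ0.le hμ
  have hz := lam_mul_mean_pos hp h0
  set r := lam * reshareProb p lam μ with hrdef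
  have ha := tendsto_coeff_offspringSeries_mul_rpow hα1 hα2 hr hp hT (reshareProb p lam μ)
  rw [← childSeries, sub_add_cancel] at ha
  have hsum1 : Summable fun k : ℕ => (k : ℝ) * PowerSeries.coeff k (childSeries p lam μ) := by
    have := summable_rpow_mul_of_tendsto (τ := 1) (by linarith) ha
    simpa using this
  have h := tendsto_coeff_pow_of_powerTail (coeff_childSeries_nonneg hp h0 h1 hμ0.le hμ)
    (hasSum_coeff_childSeries hp h0 h1 hμ0.le hμ)
    (hasSum_natCast_mul_coeff_childSeries hp h0 h1 hμ0.le hμ hsum1) (by linarith) hγ2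
    (by linarith) ha
  have hmk : PowerSeries.mk (fun k => PowerSeries.coeff k (childSeries p lam μ)) =
      childSeries p lam μ := by ext k; simp
  have hr' : r = lam * (1 - μ) / (lam * meanDegree p + 1) := by rw [hrdef, reshareProb]; ring
  have h1μ : 0 < 1 - μ := by linarith
  have hC : D * r ^ (γ - 1) * (1 - (1 - μ)) ^ (-γ) = prefactorC p lam μ D γ := by
    have e : lam * (1 - μ) / (μ * (lam * meanDegree p + 1)) = r / μ := by
      rw [hr']; field_simp
    rw [prefactorC, e, sub_sub_cancel, Real.div_rpow hr.1.le hμ0.le, Real.rpow_neg hμ0.le,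
      Real.rpow_sub_one hr.1.ne']
    have e2 : D * (lam * meanDegree p + 1) / (lam * (1 - μ)) = D / r := by
      rw [hr']; field_simp
    rw [e2]
    field_simp
  rw [hmk, hC] at h
  have hC0 : prefactorC p lam μ D γ ≠ 0 := by
    rw [← hC, sub_sub_cancel]
    have := hr.1
    positivity
  refine isEquivalent_mul_rpow_of_tendsto hC0 (h.congr' ?_)
  filter_upwards [eventually_ge_atTop 1] with n hn
  have hn' : (0 : ℝ) < n := by exact_mod_cast hn
  rw [← mul_progeny p lam μ hn, Real.rpow_sub_one hn'.ne']
  field_simp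

end MemeModel

end

/-! ### Assembly of the cases through `eq_progeny`. -/

open MemeModel in
theorem mainTheorem2 (p : ℕ → ℝ) (hp : IsOutDegreeDistribution p)
    (lam : ℝ) (hlam0 : 0 < lam) (hlam1 : lam ≤ 1) :
    -- the limiting popularity distribution exists, is unique, is a probability distribution
    (∀ μ : ℝ, 0 ≤ μ → μ < 1 →
      (∃! q : ℕ → ℝ, IsLimitingPopularity p lam μ q) ∧
      ∀ q : ℕ → ℝ, IsLimitingPopularity p lam μ q → (∀ n, 0 ≤ q n) ∧ HasSum q 1) ∧
    -- the stationary solution is the old-age limit of the age-dependent one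
    (∀ μ : ℝ, 0 ≤ μ → μ < 1 → ∀ c : ℕ, 1 ≤ c →
      ∀ G : ℝ → ℝ, IsStationarySolution p lam μ G →
      ∀ x ∈ Set.Icc (0 : ℝ) 1, ∀ g : ℝ → ℝ, IsAgeSolution p lam μ c x g →
        Tendsto g atTop (𝓝 (G x))) ∧
    -- finite second moment, no innovation
    (FiniteSecondMoment p → ∀ q : ℕ → ℝ, IsLimitingPopularity p lam 0 q →
      q ~[atTop] fun n : ℕ => prefactorA p lam * (n : ℝ) ^ (-(3 / 2) : ℝ)) ∧
    -- finite second moment, small innovation rate: `n → ∞`, `μ → 0` with `n / κ` bounded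
    (FiniteSecondMoment p → ∀ K : ℝ, ∀ ε : ℝ, 0 < ε → ∃ δ : ℝ, 0 < δ ∧ ∃ N : ℕ,
      ∀ μ : ℝ, 0 < μ → μ < δ → ∀ q : ℕ → ℝ, IsLimitingPopularity p lam μ q →
      ∀ n : ℕ, N ≤ n → (n : ℝ) ≤ K * cutoff p lam μ →
        |q n / (prefactorA p lam * (n : ℝ) ^ (-(3 / 2) : ℝ)
          * Real.exp (-((n : ℝ) / cutoff p lam μ))) - 1| ≤ ε) ∧
    -- the same, without restriction on `n / κ`, with absolute error
    (FiniteSecondMoment p → ∀ ε : ℝ, 0 < ε → ∃ δ : ℝ, 0 < δ ∧ ∃ N : ℕ,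
      ∀ μ : ℝ, 0 < μ → μ < δ → ∀ q : ℕ → ℝ, IsLimitingPopularity p lam μ q →
      ∀ n : ℕ, N ≤ n →
        |q n * (n : ℝ) ^ (3 / 2 : ℝ)
          - prefactorA p lam * Real.exp (-((n : ℝ) / cutoff p lam μ))| ≤ ε) ∧
    -- `f` analytic at `1`: the same form for each fixed small `μ`, with constants that
    -- agree with `A` and `κ` to leading order as `μ → 0`
    ((∃ R : ℝ, 1 < R ∧ Summable fun k : ℕ => p k * R ^ k) →
      ∃ A' κ' : ℝ → ℝ,
        Tendsto A' (𝓝[>] 0) (𝓝 (prefactorA p lam)) ∧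
        Tendsto (fun μ => κ' μ / cutoff p lam μ) (𝓝[>] 0) (𝓝 1) ∧
        ∀ᶠ μ in 𝓝[>] (0 : ℝ), ∀ q : ℕ → ℝ, IsLimitingPopularity p lam μ q →
          q ~[atTop] fun n : ℕ =>
            A' μ * (n : ℝ) ^ (-(3 / 2) : ℝ) * Real.exp (-((n : ℝ) / κ' μ))) ∧
    -- power-law out-degree distribution
    (∀ D γ : ℝ, 0 < D → 2 < γ → γ < 3 → HasPowerTail p D γ →
      (∀ q : ℕ → ℝ, IsLimitingPopularity p lam 0 q →
        q ~[atTop] fun n : ℕ => prefactorB p lam D γ * (n : ℝ) ^ (-(γ / (γ - 1)))) ∧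
      (∀ μ : ℝ, 0 < μ → μ < 1 → ∀ q : ℕ → ℝ, IsLimitingPopularity p lam μ q →
        q ~[atTop] fun n : ℕ => prefactorC p lam μ D γ * (n : ℝ) ^ (-γ))) := by
  refine ⟨fun μ hμ0 hμ => ⟨⟨progeny p lam μ, isLimitingPopularity_progeny hp hlam0 hlam1 hμ0 hμ,
      fun q hq => eq_progeny hp hlam0 hlam1 hμ0 hμ hq⟩, fun q hq => ?_⟩,
    fun μ hμ0 hμ c hc G hG x hx g hg => tendsto_ageSolution hp hlam0 hlam1 hμ0 hμ hc hx
      (hG x hx).1 (hG x hx).2 hg, fun h2 q hq => ?_, fun h2 K ε hε => ?_, fun h2 ε hε => ?_,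
    fun hR => ?_, fun D γ hD hγ2 hγ3 htail => ⟨fun q hq => ?_, fun μ hμ0 hμ q hq => ?_⟩⟩
  · rw [eq_progeny hp hlam0 hlam1 hμ0 hμ hq]
    exact ⟨progeny_nonneg hp hlam0 hlam1 hμ0 hμ, hasSum_progeny hp hlam0 hlam1 hμ0 hμ⟩
  · rw [eq_progeny hp hlam0 hlam1 le_rfl one_pos hq]
    exact progeny_isEquivalent_of_finiteSecondMoment hp hlam0 hlam1 h2
  -- The bound `δ ≤ 1` makes `μ < 1`, the range in which the popularity is identified with the
  -- progeny law.
  · obtain ⟨δ, hδ, hδ1, N, hN⟩ := exists_abs_progeny_div_sub_one_le hp hlam0 hlam1 h2 K hε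
    refine ⟨δ, hδ, N, fun μ hμ hμδ q hq n hn hnK => ?_⟩
    rw [eq_progeny hp hlam0 hlam1 hμ.le (hμδ.trans_le hδ1) hq]
    exact hN μ hμ hμδ n hn hnK
  · obtain ⟨δ, hδ, hδ1, N, -, hN⟩ := exists_abs_progeny_sub_le hp hlam0 hlam1 h2 hε
    refine ⟨δ, hδ, N, fun μ hμ hμδ q hq n hn => ?_⟩
    rw [eq_progeny hp hlam0 hlam1 hμ.le (hμδ.trans_le hδ1) hq]
    exact hN μ hμ hμδ n hn
  · obtain ⟨R, hR1, hs⟩ := hR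
    obtain ⟨A', κ', hA, hκ, hq'⟩ :=
      exists_progeny_isEquivalent_of_analytic hp hlam0 hlam1 hR1 hs
    refine ⟨A', κ', hA, hκ, ?_⟩
    have hμ1 : ∀ᶠ μ in 𝓝[>] (0 : ℝ), μ < 1 := nhdsWithin_le_nhds (gt_mem_nhds one_pos)
    filter_upwards [hq', hμ1, self_mem_nhdsWithin] with μ h3 h4 (h5 : 0 < μ) q hq
    rw [eq_progeny hp hlam0 hlam1 h5.le h4 hq]
    exact h3
  · rw [eq_progeny hp hlam0 hlam1 le_rfl one_pos hq]
    exact progeny_isEquivalent_of_hasPowerTail hp hlam0 hlam1 hD hγ2 hγ3 htail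
  · rw [eq_progeny hp hlam0 hlam1 hμ0.le hμ hq]
    exact progeny_isEquivalent_of_hasPowerTail_of_pos hp hlam0 hlam1 hμ0 hμ hD hγ2 hγ3 htail
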